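/- **Setting.** Let $d=2^n$, let $K$ be an even positive integer, and let $D,B,\sigma,L,P,\sigma_z>0$ with $\sigma\le B$. Let $\mathcal X\subset\mathbb R^d$ be nonempty, closed and convex with $\|x-y\|\le D$ for all $x,y\in\mathcal X$. Let $\mathcal O$ be the set of all pairs $(f,\mathcal C)$ in which $f$ is convex on $\mathcal X$, has a gradient $\nabla f$ there and satisfies $f(y)-f(x)\le\langle\nabla f(x),y-x\rangle+\frac L2\|y-x\|^2$ for $x,y\in\mathcal X$, and $\mathcal C$ consists of $K$ clients; client $k$, queried at $x\in\mathcal X$, outputs a random vector $\hat g_k(x)$, drawn with fresh randomness independent of everything else, such that $\mathbb E\,\hat g_k(x)=\nabla f(x)$, $\mathbb E\|\hat g_k(x)-\nabla f(x)\|^2\le\sigma^2$ and $\|\hat g_k(x)\|\le B$ almost surely. In each channel use the server receives the sum of the $K$ transmitted real numbers plus independent $\mathcal N(0,\sigma_z^2)$ noise. Put $\mathrm{SNR}=KP/\sigma_z^2$. **Lattice/ASK transmission.** Suppose $m$ senders $k$ hold vectors $q_k\in\{0,\dots,v-1\}^d$, and let $p$ divide $d$. Put $w=m(v-1)+1$ and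 $r=(w^p-1)/m+1$. Split $[d]$ into $d/p$ consecutive blocks $\mathcal B_j$ of length $p$. In channel use $j$, sender $k$ transmits $-\sqrt P+\tau_{k,j}\frac{2\sqrt P}{r-1}$, where $\tau_{k,j}=\sum_{i=1}^p q_k(\mathcal B_j(i))\,w^{i-1}$. The server maps its $j$-th received value to the nearest of the points $-m\sqrt P+t\frac{2\sqrt P}{r-1}$, $0\le t\le m(r-1)$, and lets $\lambda(\mathcal B_j(1)),\dots,\lambda(\mathcal B_j(p))\in\{0,\dots,w-1\}$ be the base-$w$ digits of the resulting $t$, lowest digit first. **WZ-OTA.** The parameters are an integer $I\ge1$, a real $M>0$, $v=7$, and divisors $p,p'$ of $d$. Split the clients into halves $\mathcal C_1,\mathcal C_2$ of size $K/2$ and put $\tilde g_k=2\hat g_k/K$. Each iteration uses $\ell=d/p+d/p'$ channel uses and fresh independent randomness. 1. In $d/p$ channel uses, each $k\in\mathcal C_1$ quantizes coordinate $i$ as follows: with $a=\frac{(v-1)(\hat g_k(i)+B)}{2B}$ it takes $\lceil a\rceil$ with probability $a-\lfloor a\rfloor$ and $\lfloor a\rfloor$ otherwise. It transmits the result as above with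 $m=K/2$ senders, $v=7$ levels and block length $p$, while $\mathcal C_2$ sends $0$. From the decoded $\lambda$ the server forms $S=\frac2K\bigl(-B+\frac{2B}{(K/2)(v-1)}\lambda\bigr)$. 2. Let $\mathbf R=d^{-1/2}\mathbf H\mathbf D'$, where $\mathbf H$ is the $d\times d$ Walsh–Hadamard matrix and $\mathbf D'$ is diagonal with independent uniform signs. Let $U_{k,i}(j)$ be independent uniform variables on $[-M,M]$, for $k\in\mathcal C_2$, $i\in[I]$, $j\in[d]$. The matrix $\mathbf R$ and all $U_{k,i}(j)$ are shared randomness. In $d/p'$ channel uses, each $k\in\mathcal C_2$ transmits $Q_k(j)=\sum_{i\in[I]}\mathbf 1\{U_{k,i}(j)\le(\mathbf R\tilde g_k)(j)\}$ as above with $m=K/2$ senders, $I+1$ levels and block length $p'$, while $\mathcal C_1$ sends $0$. From the newly decoded $\lambda$ the server forms $$\psi=\frac{2M}{I}\mathbf R^{-1}(\lambda-\omega)+\frac K2S,\qquad \omega(j)=\sum_{k\in\mathcal C_2}\sum_{i\in[I]}\mathbf 1\{U_{k,i}(j)\le(\mathbf RS)(j)\}.$$ **PSGD.** From $x_0\in\mathcal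 X$, for $t=0,\dots,T-1$, put $x_{t+1}=\Gamma_{\mathcal X}(x_t-\eta\psi_t)$, where $\psi_t$ is the estimate obtained at query point $x_t$ and $\Gamma_{\mathcal X}$ is the Euclidean projection onto $\mathcal X$. Output $\bar x_T=\frac1T\sum_{t=1}^Tx_t$. **Theorem.** There are universal constants $c_2,c_3,c_4,c_5>0$ such that the following holds. Suppose $K\ge B^2d/\sigma^2$, $T\ge1$ and $N=T\ell=T(d/p+d/p')$. Take $$M=\frac{c_2B}{K\sqrt d}\sqrt{\ln(K^{1.5}N)},\quad I=\Bigl\lceil c_2\sqrt{\ln(K^{1.5}N)}\Bigr\rceil,\quad \eta=\min\Bigl\{\frac1L,\frac{D}{c_4\sqrt{B\sigma/K}\,\sqrt{2T}}\Bigr\},$$ and let the positive divisors $p,p'$ of $d$ satisfy $$p\le\left\lfloor\frac{\ln\Bigl(1+\sqrt{\frac{K\,\mathrm{SNR}}{8\ln(KN^{1.5})}}\Bigr)}{\ln(3K+1)}\right\rfloor,\qquad p'\le\left\lfloor\frac{\ln\Bigl(1+\sqrt{\frac{K\,\mathrm{SNR}}{8\ln(KN^{1.5})}}\Bigr)}{\ln(KI/2+1)}\right\rfloor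 .$$ Here $\ln(3K+1)\le c_5\ln K$ and $\ln(KI/2+1)\le c_5(\ln K+\ln\ln N)$. Every client's transmission satisfies the power constraint: its squared norm over the $\ell$ channel uses of an iteration is at most $\ell P$ whenever its gradient estimate has norm at most $B$. For every $\mathcal X$ and $x_0\in\mathcal X$ as above, and with $\frac1q=\frac1p+\frac1{p'}$, the variable $f(\bar x_T)$ is integrable for every $(f,\mathcal C)\in\mathcal O$, and $$\sup_{(f,\mathcal C)\in\mathcal O}\Bigl(\mathbb E f(\bar x_T)-\min_{x\in\mathcal X}f(x)\Bigr)\le\frac{c_3D\sqrt{B\sigma}}{\sqrt{KN}}\sqrt{\frac dq}+\frac{LD^2d}{2Nq}.$$ -/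

import Mathlib

open MeasureTheory ProbabilityTheory
open scoped Matrix

noncomputable section

namespace OTA

/-- `ℝᵈ` with its Euclidean norm. -/
abbrev E (d : ℕ) := EuclideanSpace ℝ (Fin d)

/-! ### Functions and stochastic gradient oracles -/

/-- A client: when queried at `x` it draws fresh randomness `ξ` from `law` and outputs the
stochastic gradient `est x ξ`. -/
structure Client (d : ℕ) where
  Ξ : Type*
  mΞ : MeasurableSpace Ξ
  law : Measure Ξ
  isProb : IsProbabilityMeasure law
  est : E d → Ξ → E d
  measurable_est : Measurable (Function.uncurry est)

attribute [instance] Client.mΞ Client.isProb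

/-- The class `𝒪` of pairs (function, clients) on the domain `X`: `f` is convex and `L`-smooth on
`X` with gradient `gradf`, and every client is unbiased, has mean square deviation at most `σ²`,
and is almost surely bounded by `B`. -/
structure InClass {d K : ℕ} (X : Set (E d)) (L B σ : ℝ) (f : E d → ℝ) (gradf : E d → E d)
    (C : Fin K → Client d) : Prop where
  convex : ConvexOn ℝ X f
  hasGradient : ∀ x ∈ X, HasGradientWithinAt f (gradf x) X x
  smooth : ∀ x ∈ X, ∀ y ∈ X, f y - f x ≤ inner ℝ (gradf x) (y - x) + L / 2 * ‖y - x‖ ^ 2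
  unbiased : ∀ k, ∀ x ∈ X, ∫ ξ, (C k).est x ξ ∂(C k).law = gradf x
  deviation : ∀ k, ∀ x ∈ X, ∫ ξ, ‖(C k).est x ξ - gradf x‖ ^ 2 ∂(C k).law ≤ σ ^ 2
  bounded : ∀ k, ∀ x ∈ X, ∀ᵐ ξ ∂(C k).law, ‖(C k).est x ξ‖ ^ 2 ≤ B ^ 2

/-! ### Quantization, lattice encoding, amplitude shift keying and their decoders -/

/-- `v`-level uniform quantizer on `[-B/m, B/m]`: the input `y` lies at position
`a = (v-1)(m y + B)/(2B) ∈ [0, v-1]` of the grid; the output index is `⌈a⌉` with probability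
`a - ⌊a⌋` and `⌊a⌋` otherwise.  The random choice is made by a uniform `θ ∈ [0,1]`. -/
def cuq (v m : ℕ) (B y θ : ℝ) : ℕ :=
  let a : ℝ := ((v : ℝ) - 1) * (m * y + B) / (2 * B)
  if θ < Int.fract a then ⌈a⌉₊ else ⌊a⌋₊

/-- Basis `w = m(v-1)+1` of the lattice used by `m` simultaneous senders of values in
`{0, …, v-1}`. -/
def latticeBase (m v : ℕ) : ℕ := m * (v - 1) + 1

/-- Size `r = (wᵖ-1)/m + 1` of the ASK code (`m` divides `wᵖ-1`). -/
def askSize (m v p : ℕ) : ℕ := (latticeBase m v ^ p - 1) / m + 1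

/-- The `i`-th point (counted from `0`) of the ASK code of size `r`. -/
def askPoint (P : ℝ) (r i : ℕ) : ℝ := -√P + i * (2 * √P / ((r : ℝ) - 1))

/-- Lattice point `∑ᵢ q(𝓑ⱼ(i)) wⁱ` of the `j`-th block of `p` consecutive coordinates. -/
def latticeEncode (w p : ℕ) {d : ℕ} (q : Fin d → ℕ) (j : Fin (d / p)) : ℕ :=
  ∑ i : Fin d, if (i : ℕ) / p = j then q i * w ^ ((i : ℕ) % p) else 0

/-- Lattice encoding followed by ASK modulation. -/
def modulate (P : ℝ) (m v p : ℕ) {d : ℕ} (q : Fin d → ℕ) (j : Fin (d / p)) : ℝ :=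
  askPoint P (askSize m v p) (latticeEncode (latticeBase m v) p q j)

/-- The `i`-th point (counted from `0`) of the constellation of sums of `m` ASK codewords. -/
def sumPoint (P : ℝ) (m r i : ℕ) : ℝ := -(m * √P) + i * (2 * √P / ((r : ℝ) - 1))

/-- Minimum distance decoder: the index in `{0, …, m(r-1)}` of the nearest point of the sum
constellation. -/
def mdDecode (P : ℝ) (m r : ℕ) (y : ℝ) : ℕ :=
  min ⌊(y + m * √P) / (2 * √P / ((r : ℝ) - 1)) + 1 / 2⌋₊ (m * (r - 1))

theorem mdDecode_nearest {P : ℝ} (hP : 0 < P) (m : ℕ) {r : ℕ} (hr : 2 ≤ r) (y : ℝ) {i : ℕ}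
    (hi : i ≤ m * (r - 1)) :
    |y - sumPoint P m r (mdDecode P m r y)| ≤ |y - sumPoint P m r i| := by
  have hr' : (0 : ℝ) < (r : ℝ) - 1 := by
    have : (2 : ℝ) ≤ r := by exact_mod_cast hr
    linarith
  have hδ : 0 < 2 * √P / ((r : ℝ) - 1) := by positivity
  unfold mdDecode sumPoint
  set δ := 2 * √P / ((r : ℝ) - 1) with hδdef
  set z := (y + m * √P) / δ with hz
  have hy : y = z * δ - m * √P := by rw [hz]; field_simp; ring
  have key : ∀ j : ℕ, |y - (-(m * √P) + j * δ)| = |z - j| * δ := by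
    intro j
    rw [hy, ← abs_of_pos hδ, ← abs_mul, abs_of_pos hδ]
    congr 1; ring
  rw [key, key]
  refine mul_le_mul_of_nonneg_right ?_ hδ.le
  set n := m * (r - 1)
  rcases lt_or_ge (z + 1 / 2) 0 with h | h
  · rw [Nat.floor_of_nonpos h.le]
    have hi0 : (0 : ℝ) ≤ i := Nat.cast_nonneg i
    simp only [Nat.zero_min, Nat.cast_zero]
    rw [abs_of_nonpos (by linarith), abs_of_nonpos (by linarith)]
    linarith
  · have h1 := Nat.floor_le h
    have h2 := Nat.lt_floor_add_one (z + 1 / 2)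
    set k := ⌊z + 1 / 2⌋₊
    rcases le_or_gt k n with hk | hk
    · rw [min_eq_left hk]
      have h3 : |z - k| ≤ 1 / 2 := by rw [abs_le]; constructor <;> linarith
      rcases lt_trichotomy i k with hik | hik | hik
      · have : (i : ℝ) + 1 ≤ k := by exact_mod_cast hik
        refine h3.trans (le_trans ?_ (le_abs_self _)); linarith
      · rw [hik]
      · have : (k : ℝ) + 1 ≤ i := by exact_mod_cast hik
        refine h3.trans (le_trans ?_ (neg_le_abs _)); linarith
    · rw [min_eq_right hk.le]
      have h4 : (n : ℝ) + 1 ≤ k := by exact_mod_cast hk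
      have h5 : (i : ℝ) ≤ n := by exact_mod_cast hi
      rw [abs_of_nonneg (by linarith), abs_of_nonneg (by linarith)]
      linarith

/-- The `i`-th digit in base `w`, as recovered by the modulo-lattice decoder. -/
def digit (w τ i : ℕ) : ℕ := τ / w ^ i % w

/-- The digits are those recovered successively: subtract the part already decoded, divide by
`wⁱ`, reduce modulo `w`. -/
theorem digit_successive {w : ℕ} (hw : 0 < w) (τ i : ℕ) :
    digit w τ i = (τ - ∑ l ∈ Finset.range i, digit w τ l * w ^ l) / w ^ i % w := by
  have h : ∀ i, ∑ l ∈ Finset.range i, digit w τ l * w ^ l = τ % w ^ i := by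
    intro i
    induction i with
    | zero => simp [Nat.mod_one]
    | succ k ih => rw [Finset.sum_range_succ, ih, Nat.mod_pow_succ, digit, mul_comm]
  rw [h, digit]
  congr 1
  have h1 : τ - τ % w ^ i = w ^ i * (τ / w ^ i) := by
    have := Nat.div_add_mod τ (w ^ i)
    omega
  rw [h1, Nat.mul_div_cancel_left _ (pow_pos hw i)]

/-- Minimum distance decoding of every channel use followed by modulo-lattice decoding. -/
def latticeDecode (P : ℝ) (m v p : ℕ) {d : ℕ} (hd : p ∣ d) (Y : Fin (d / p) → ℝ) (i : Fin d) : ℕ :=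
  digit (latticeBase m v)
    (mdDecode P m (askSize m v p) (Y ⟨i / p, Nat.div_lt_div_of_lt_of_dvd hd i.2⟩)) ((i : ℕ) % p)

/-! ### Random rotation -/

/-- The `2ⁿ × 2ⁿ` Walsh–Hadamard matrix: `H i j = (-1)^⟨i,j⟩`, where `⟨i,j⟩` is the inner product
of the binary expansions. -/
def walshHadamard (n : ℕ) : Matrix (Fin (2 ^ n)) (Fin (2 ^ n)) ℝ :=
  Matrix.of fun i j =>
    ∏ b ∈ Finset.range n, if (i : ℕ).testBit b && (j : ℕ).testBit b then -1 else 1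

/-- The rotation `R = d^{-1/2} H D'`, where `D'` is the diagonal matrix with the signs `ε`. -/
def rotation (n : ℕ) (ε : Fin (2 ^ n) → Bool) : Matrix (Fin (2 ^ n)) (Fin (2 ^ n)) ℝ :=
  (1 / √((2 : ℝ) ^ n)) • (walshHadamard n * Matrix.diagonal fun i => if ε i then 1 else -1)

/-! ### The Wyner–Ziv over-the-air scheme -/

/-- Parameters of the scheme: dimension `2ⁿ`, `K` clients, `v` quantization levels and block size
`p` in the first phase, `I` dithers on `[-M, M]` per coordinate and block size `p'` in the second
phase, gradient bound `B`, power `P`. -/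
structure WZ where
  n : ℕ
  K : ℕ
  v : ℕ
  I : ℕ
  p : ℕ
  p' : ℕ
  B : ℝ
  M : ℝ
  P : ℝ
  p_dvd : p ∣ 2 ^ n
  p'_dvd : p' ∣ 2 ^ n

namespace WZ

variable (s : WZ)

/-- Dimension. -/
abbrev d : ℕ := 2 ^ s.n

/-- Number of clients in each of the two halves `𝒞₁ = {k < K/2}` and `𝒞₂ = {k ≥ K/2}`. -/
abbrev m : ℕ := s.K / 2

/-- The channel uses of one iteration: `d/p` for the first phase, `d/p'` for the second. -/
abbrev Uses := Fin (s.d / s.p) ⊕ Fin (s.d / s.p')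

/-- Length `ℓ` of the scheme. -/
abbrev len : ℕ := s.d / s.p + s.d / s.p'

/-- The coins of one iteration: signs of the rotation, dithers of the uniform quantizers, and the
vectors `U_{k,i}`. -/
abbrev Coins := (Fin s.d → Bool) × (Fin s.K → Fin s.d → ℝ) × (Fin s.K → Fin s.I → Fin s.d → ℝ)

/-- Law of the coins: all independent; uniform signs, uniform dithers on `[0,1]`,
and `U_{k,i}(j)` uniform on `[-M, M]`. -/
def coinLaw : Measure s.Coins :=
  (PMF.uniformOfFintype (Fin s.d → Bool)).toMeasure.prod
    ((Measure.pi fun _ => Measure.pi fun _ => cond volume (Set.Icc 0 1)).prod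
      (Measure.pi fun _ => Measure.pi fun _ => Measure.pi fun _ =>
        cond volume (Set.Icc (-s.M) s.M)))

/-- Law of the channel noise of one iteration: independent centred Gaussians of variance `σz²`. -/
def noiseLaw (σz : ℝ) : Measure (s.Uses → ℝ) :=
  Measure.pi fun _ => gaussianReal 0 (σz ^ 2).toNNReal

/-- Scaled gradient `g̃ = 2 ĝ / K`. -/
def scaled (g : E s.d) : Fin s.d → ℝ := fun j => 2 * g j / s.K

/-- Quantized vector sent by client `k ∈ 𝒞₁`. -/
def quant₁ (k : Fin s.K) (g : E s.d) (u : s.Coins) : Fin s.d → ℕ :=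
  fun j => cuq s.v s.m s.B (s.scaled g j) (u.2.1 k j)

open Classical in
/-- Counts `#{i : U_{k,i}(j) ≤ x(j)}`. -/
def count (k : Fin s.K) (x : Fin s.d → ℝ) (u : s.Coins) : Fin s.d → ℕ :=
  fun j => ∑ i : Fin s.I, if u.2.2 k i j ≤ x j then 1 else 0

/-- Quantized vector sent by client `k ∈ 𝒞₂`: counts at the rotated scaled gradient. -/
def quant₂ (k : Fin s.K) (g : E s.d) (u : s.Coins) : Fin s.d → ℕ :=
  s.count k (rotation s.n u.1 *ᵥ s.scaled g) u

/-- Encoder of client `k`; each half is silent during the phase of the other half. -/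
def encoder (k : Fin s.K) (g : E s.d) (u : s.Coins) : s.Uses → ℝ :=
  Sum.elim
    (fun j => if (k : ℕ) < s.m then modulate s.P s.m s.v s.p (s.quant₁ k g u) j else 0)
    (fun j => if s.m ≤ (k : ℕ) then modulate s.P s.m (s.I + 1) s.p' (s.quant₂ k g u) j else 0)

/-- The additive multiple access channel. -/
def channel (x : Fin s.K → s.Uses → ℝ) (z : s.Uses → ℝ) : s.Uses → ℝ :=
  fun j => ∑ k, x k j + z j

/-- Side information `S`: the uniform-quantization estimate from the first phase, divided
by `K/2`. -/
def sideInfo (Y : s.Uses → ℝ) : Fin s.d → ℝ := fun i =>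
  (-s.B + 2 * s.B / (s.m * ((s.v : ℝ) - 1)) *
    latticeDecode s.P s.m s.v s.p s.p_dvd (fun j => Y (Sum.inl j)) i) / (s.K / 2)

/-- Decoder: the Wyner–Ziv estimate `(2M/I) R⁻¹ (λ - ω) + (K/2) S`. -/
def decoder (Y : s.Uses → ℝ) (u : s.Coins) : E s.d :=
  let R := rotation s.n u.1
  let S := s.sideInfo Y
  let lam : Fin s.d → ℝ := fun i =>
    latticeDecode s.P s.m (s.I + 1) s.p' s.p'_dvd (fun j => Y (Sum.inr j)) i
  let omega : Fin s.d → ℝ := fun j =>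
    ∑ k : Fin s.K, if s.m ≤ (k : ℕ) then (s.count k (R *ᵥ S) u j : ℝ) else 0
  WithLp.toLp 2 ((2 * s.M / s.I) • (R⁻¹ *ᵥ (lam - omega)) + ((s.K : ℝ) / 2) • S)

/-- All the randomness of one iteration: the clients' oracles, the coins, the channel noise. -/
abbrev Round (C : Fin s.K → Client s.d) := (∀ k, (C k).Ξ) × s.Coins × (s.Uses → ℝ)

/-- Law of the randomness of one iteration. -/
def roundLaw (C : Fin s.K → Client s.d) (σz : ℝ) : Measure (s.Round C) :=
  (Measure.pi fun k => (C k).law).prod (s.coinLaw.prod (s.noiseLaw σz))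

/-- The gradient estimate decoded by the server in an iteration with query point `x`. -/
def estimate (C : Fin s.K → Client s.d) (x : E s.d) (ω : s.Round C) : E s.d :=
  s.decoder (s.channel (fun k => s.encoder k ((C k).est x (ω.1 k)) ω.2.1) ω.2.2) ω.2.1

end WZ

/-! ### Projected stochastic gradient descent -/

/-- A nearest point of `X` to `y` (the nearest one if `X` is nonempty, closed and convex). -/
def proj {d : ℕ} (X : Set (E d)) (y : E d) : E d :=
  Classical.epsilon fun x => x ∈ X ∧ ∀ z ∈ X, ‖y - x‖ ≤ ‖y - z‖

theorem proj_spec {d : ℕ} {X : Set (E d)} (hne : X.Nonempty) (hcl : IsClosed X) (y : E d) :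
    proj X y ∈ X ∧ ∀ z ∈ X, ‖y - proj X y‖ ≤ ‖y - z‖ := by
  have h : ∃ x, x ∈ X ∧ ∀ z ∈ X, ‖y - x‖ ≤ ‖y - z‖ := by
    obtain ⟨x, hx, hd⟩ := hcl.exists_infDist_eq_dist hne y
    refine ⟨x, hx, fun z hz => ?_⟩
    rw [← dist_eq_norm, ← dist_eq_norm, ← hd]
    exact Metric.infDist_le_dist_of_mem hz
  exact Classical.epsilon_spec h

/-- The iterates `x₀, …, x_T` of projected stochastic gradient descent with constant step `η`,
where `est x w` is the gradient estimate at query `x` under the round randomness `w`. -/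
def psgd {d T : ℕ} {W : Type*} (X : Set (E d)) (η : ℝ) (est : E d → W → E d) (x₀ : E d)
    (ω : Fin T → W) : Fin (T + 1) → E d :=
  Fin.induction (motive := fun _ => E d) x₀ fun t x => proj X (x - η • est x (ω t))

/-- The output `(x₁ + ⋯ + x_T)/T`. -/
def psgdOutput {d T : ℕ} {W : Type*} (X : Set (E d)) (η : ℝ) (est : E d → W → E d) (x₀ : E d)
    (ω : Fin T → W) : E d :=
  (1 / (T : ℝ)) • ∑ t : Fin T, psgd X η est x₀ ω t.succ

end OTA

end

/-!
The error of the scheme is controlled by comparing it with an idealised scheme whose channel is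
noiseless, and by running projected stochastic gradient descent with the idealised estimate.

*Channel.* The lattice base `w = m(v-1)+1` leaves no carries when `m` digits are added, so the sum
of the `m` codewords determines the sum of the quantized vectors, and the decoder is exact as long
as the noise stays below half the distance of the constellation points
(`WZ.decoder_eq_of_small_noise`). The block lengths are chosen so that a Gaussian tail bound and a
union bound over all `N` channel uses make the complementary event have probability at most
`2/(K√N)` (`WZ.measureReal_largeNoise_le`, `WZ.noiseBound_le`). As `f` is `B`-Lipschitz on a set of
diameter `D`, this event costs at most `B D` times its probability.

*Idealised estimate.* The side information `S` is `1/m` times the average of the first half of the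
clients, up to unbiased rounding. In the second phase each count at `R g̃ₖ` is compared with the
count at `R S` under the same dithers: only dithers between the two values contribute, so the
variance is at most `2M/I` times the `ℓ¹` distance of `R g̃ₖ` and `R S`, of order `B σ / K` rather
than `B² / K` after summation over the clients (`dither_moments`,
`WZ.integral_noiseless_sub_sq_le`). Values outside `[-M, M]` are the only source of bias. The
random signs make every rotated coordinate subgaussian with parameter of order `B/(K√d)`, so with
`M` larger by a factor `√ln (K^{1.5} N)` this overflow is negligible (`WZ.integral_overflow_sq_le`,
`WZ.abs_integral_inner_noiseless_le`).

*Descent.* `psgd_convergence` treats an estimate with bias `b` and mean square error `V`. Each step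
compares `x - η ψ` with `x - η ∇f(x)`, which is deterministic given the past, so that only the bias
and the square of the error enter (`psgd_step`). With `V` of order `B σ / K`, the prescribed step
size balances the optimisation error against the variance (`error_terms_le`).
-/

noncomputable section

namespace OTA

/-! ### Lattice encoding, amplitude shift keying and decoding -/

/-- Digits of a base-`w` expansion whose coefficients are all smaller than `w`. -/
theorem digit_sum {w : ℕ} (p : ℕ) (a : ℕ → ℕ) (ha : ∀ l, l < p → a l < w) {i : ℕ} (hi : i < p) :
    digit w (∑ l ∈ Finset.range p, a l * w ^ l) i = a i := by
  have hw : 0 < w := (Nat.zero_le _).trans_lt (ha i hi)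
  have hlt : ∀ n, n ≤ p → ∑ l ∈ Finset.range n, a l * w ^ l < w ^ n := by
    intro n
    induction n with
    | zero => simp
    | succ n ih =>
      intro hn
      rw [Finset.sum_range_succ, pow_succ]
      have h1 := ih (by omega)
      have h2 : (a n + 1) * w ^ n ≤ w * w ^ n := Nat.mul_le_mul_right _ (ha n (by omega))
      nlinarith
  have hsplit : ∀ n, ∃ c, ∑ l ∈ Finset.range (i + 1 + n), a l * w ^ l
      = ∑ l ∈ Finset.range i, a l * w ^ l + w ^ i * (a i + w * c) := by
    intro n
    induction n with
    | zero => exact ⟨0, by rw [add_zero, Finset.sum_range_succ]; ring⟩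
    | succ n ih =>
      obtain ⟨c, hc⟩ := ih
      refine ⟨c + a (i + 1 + n) * w ^ n, ?_⟩
      rw [← add_assoc, Finset.sum_range_succ, hc]
      ring
  obtain ⟨c, hc⟩ := hsplit (p - (i + 1))
  rw [show i + 1 + (p - (i + 1)) = p by omega] at hc
  rw [digit, hc, Nat.add_mul_div_left _ _ (pow_pos hw i), Nat.div_eq_of_lt (hlt i hi.le), zero_add,
    Nat.add_mul_mod_self_left, Nat.mod_eq_of_lt (ha i hi)]

theorem latticeEncode_eq_sum_range {w p d : ℕ} (hp : 0 < p) (q : Fin d → ℕ) (j : Fin (d / p)) :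
    latticeEncode w p q j = ∑ l ∈ Finset.range p,
      (if h : (j : ℕ) * p + l < d then q ⟨j * p + l, h⟩ else 0) * w ^ l := by
  set Q : ℕ → ℕ := fun i => if h : i < d then q ⟨i, h⟩ else 0 with hQ
  have h1 : latticeEncode w p q j
      = ∑ i ∈ Finset.range d, if i / p = j then Q i * w ^ (i % p) else 0 := by
    rw [latticeEncode, ← Fin.sum_univ_eq_sum_range
      (fun i => if i / p = (j : ℕ) then Q i * w ^ (i % p) else 0)]
    refine Finset.sum_congr rfl fun i _ => ?_
    simp [hQ]
  have hj : (j : ℕ) * p + p ≤ d := by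
    have := Nat.mul_le_mul_right p (Nat.succ_le_of_lt j.2)
    have h2 := Nat.div_mul_le_self d p
    rw [Nat.succ_mul] at this
    omega
  rw [h1, ← Finset.sum_filter]
  refine Finset.sum_nbij' (fun i => i % p) (fun l => j * p + l) ?_ ?_ ?_ ?_ ?_
  · intro i _
    simpa using Nat.mod_lt _ hp
  · intro l hl
    simp only [Finset.mem_range] at hl
    simp only [Finset.mem_filter, Finset.mem_range]
    refine ⟨by omega, ?_⟩
    rw [add_comm, Nat.add_mul_div_right _ _ hp, Nat.div_eq_of_lt hl, zero_add]
  · intro i hi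
    simp only [Finset.mem_filter, Finset.mem_range] at hi
    have := Nat.div_add_mod i p
    rw [hi.2, mul_comm] at this
    exact this
  · intro l hl
    simp only [Finset.mem_range] at hl
    rw [add_comm, Nat.add_mul_mod_self_right, Nat.mod_eq_of_lt hl]
  · intro i hi
    simp only [Finset.mem_filter, Finset.mem_range] at hi
    have := Nat.div_add_mod i p
    rw [hi.2, mul_comm] at this
    simp only [hQ]
    simp only [this]

theorem sum_latticeEncode {ι : Type*} (A : Finset ι) {w p d : ℕ} (q : ι → Fin d → ℕ)
    (j : Fin (d / p)) :
    ∑ k ∈ A, latticeEncode w p (q k) j = latticeEncode w p (fun i => ∑ k ∈ A, q k i) j := by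
  unfold latticeEncode
  rw [Finset.sum_comm]
  refine Finset.sum_congr rfl fun i _ => ?_
  split_ifs
  · rw [Finset.sum_mul]
  · simp

theorem latticeBase_pow (m v p : ℕ) :
    latticeBase m v ^ p = m * ((v - 1) * ∑ l ∈ Finset.range p, latticeBase m v ^ l) + 1 := by
  have := geom_sum_mul_add (m * (v - 1)) p
  rw [latticeBase, ← this]
  ring

/-- The division in the definition of the code size is exact. -/
theorem askSize_eq {m : ℕ} (hm : 0 < m) (v p : ℕ) :
    askSize m v p = (v - 1) * ∑ l ∈ Finset.range p, latticeBase m v ^ l + 1 := by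
  rw [askSize, latticeBase_pow, Nat.add_sub_cancel, Nat.mul_div_cancel_left _ hm]

theorem mul_askSize_sub_one {m : ℕ} (hm : 0 < m) (v p : ℕ) :
    m * (askSize m v p - 1) + 1 = latticeBase m v ^ p := by
  rw [askSize_eq hm, latticeBase_pow, Nat.add_sub_cancel]

theorem two_le_askSize {m v p : ℕ} (hm : 0 < m) (hv : 2 ≤ v) (hp : 0 < p) :
    2 ≤ askSize m v p := by
  rw [askSize_eq hm]
  have h1 : 1 ≤ ∑ l ∈ Finset.range p, latticeBase m v ^ l := by
    refine le_trans ?_ (Finset.single_le_sum (f := fun l => latticeBase m v ^ l)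
      (fun _ _ => Nat.zero_le _) (Finset.mem_range.2 hp))
    simp
  have : 1 * 1 ≤ (v - 1) * ∑ l ∈ Finset.range p, latticeBase m v ^ l :=
    Nat.mul_le_mul (by omega) h1
  omega

theorem latticeEncode_le {m v p d a : ℕ} (hp : 0 < p) (q : Fin d → ℕ)
    (hq : ∀ i, q i ≤ a * (v - 1)) (hm : 0 < m) (j : Fin (d / p)) :
    latticeEncode (latticeBase m v) p q j ≤ a * (askSize m v p - 1) := by
  rw [latticeEncode_eq_sum_range hp, askSize_eq hm, Nat.add_sub_cancel, ← mul_assoc,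
    Finset.mul_sum]
  refine Finset.sum_le_sum fun l _ => Nat.mul_le_mul_right _ ?_
  split_ifs
  · exact hq _
  · exact Nat.zero_le _

theorem mdDecode_sumPoint_add {P : ℝ} (hP : 0 < P) (m : ℕ) {r : ℕ} (hr : 2 ≤ r) (τ : ℕ) {z : ℝ}
    (hz : |z| < √P / ((r : ℝ) - 1)) :
    mdDecode P m r (sumPoint P m r τ + z) = min τ (m * (r - 1)) := by
  have hr' : (0 : ℝ) < (r : ℝ) - 1 := by
    have : (2 : ℝ) ≤ r := by exact_mod_cast hr
    linarith
  have hδ : 0 < 2 * √P / ((r : ℝ) - 1) := by positivity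
  unfold mdDecode sumPoint
  set δ := 2 * √P / ((r : ℝ) - 1) with hδdef
  have h1 : (-(m * √P) + τ * δ + z + m * √P) / δ + 1 / 2 = (z / δ + 1 / 2) + τ := by
    field_simp
    ring
  have h2 : |z / δ| < 1 / 2 := by
    have h3 : 1 / 2 * δ = √P / ((r : ℝ) - 1) := by rw [hδdef]; ring
    rwa [abs_div, abs_of_pos hδ, div_lt_iff₀ hδ, h3]
  rw [abs_lt] at h2
  rw [h1, Nat.floor_add_natCast (by linarith), Nat.floor_eq_zero.2 (by linarith), zero_add]

theorem sum_askPoint {ι : Type*} (A : Finset ι) (P : ℝ) (r : ℕ) (τ : ι → ℕ) :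
    ∑ k ∈ A, askPoint P r (τ k) = sumPoint P A.card r (∑ k ∈ A, τ k) := by
  simp only [askPoint, sumPoint, Finset.sum_add_distrib, Finset.sum_const, nsmul_eq_mul,
    ← Finset.sum_mul, Nat.cast_sum]
  ring

/-- Noise of modulus smaller than half the distance of the constellation points has no effect on
the decoder. -/
theorem latticeDecode_sumPoint_add {P : ℝ} (hP : 0 < P) {m v p d : ℕ} (hm : 0 < m) (hv : 2 ≤ v)
    (hp : 0 < p) (hd : p ∣ d) (τ : Fin (d / p) → ℕ) (z : Fin (d / p) → ℝ)
    (hz : ∀ j, |z j| < √P / ((askSize m v p : ℝ) - 1)) :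
    latticeDecode P m v p hd (fun j => sumPoint P m (askSize m v p) (τ j) + z j)
      = fun i : Fin d => digit (latticeBase m v)
          (min (τ ⟨(i : ℕ) / p, Nat.div_lt_div_of_lt_of_dvd hd i.2⟩) (m * (askSize m v p - 1)))
          ((i : ℕ) % p) := by
  funext i
  rw [latticeDecode, mdDecode_sumPoint_add hP m (two_le_askSize hm hv hp) _ (hz _)]

/-- Without noise the decoder recovers the sum of the quantized vectors. -/
theorem latticeDecode_exact {P : ℝ} (hP : 0 < P) {m v p d : ℕ} (hm : 0 < m) (hv : 2 ≤ v)
    (hp : 0 < p) (hd : p ∣ d) (q : Fin d → ℕ) (hq : ∀ i, q i ≤ m * (v - 1)) :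
    latticeDecode P m v p hd (fun j => sumPoint P m (askSize m v p)
      (latticeEncode (latticeBase m v) p q j)) = q := by
  have hr := two_le_askSize (p := p) hm hv hp
  have h := latticeDecode_sumPoint_add hP hm hv hp hd
    (fun j => latticeEncode (latticeBase m v) p q j) (fun _ => 0) (fun _ => by
      have : (2 : ℝ) ≤ askSize m v p := by exact_mod_cast hr
      have : (0 : ℝ) < (askSize m v p : ℝ) - 1 := by linarith
      rw [abs_zero]; positivity)
  simp only [add_zero] at h
  rw [h]
  funext i
  rw [min_eq_left (latticeEncode_le hp q hq hm _), latticeEncode_eq_sum_range hp,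
    digit_sum _ _ _ (Nat.mod_lt _ hp)]
  · have : (i : ℕ) / p * p + i % p = i := Nat.div_add_mod' _ _
    simp [this]
  · intro l _
    rw [latticeBase]
    split_ifs
    · exact Nat.lt_succ_of_le (hq _)
    · exact Nat.succ_pos _

theorem abs_askPoint_le {P : ℝ} {r i : ℕ} (hi : i ≤ r - 1) (hr : 2 ≤ r) :
    |askPoint P r i| ≤ √P := by
  have h2 : (2 : ℝ) ≤ r := by exact_mod_cast hr
  have hr' : (0 : ℝ) < (r : ℝ) - 1 := by linarith
  have hi' : (i : ℝ) ≤ r - 1 := by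
    have : ((i + 1 : ℕ) : ℝ) ≤ r := by exact_mod_cast (by omega : i + 1 ≤ r)
    push_cast at this; linarith
  have h0 : 0 ≤ √P := Real.sqrt_nonneg P
  have h3 : (i : ℝ) * (2 * √P / ((r : ℝ) - 1)) = (i / ((r : ℝ) - 1)) * (2 * √P) := by ring
  have h4 : (i : ℝ) / ((r : ℝ) - 1) ≤ 1 := (div_le_one hr').2 hi'
  have h5 : 0 ≤ (i : ℝ) / ((r : ℝ) - 1) := by positivity
  rw [askPoint, h3, abs_le]
  constructor <;> nlinarith

theorem cuq_le {v m : ℕ} (hv : 2 ≤ v) {B y : ℝ} (hB : 0 < B) (hy : |m * y| ≤ B) (θ : ℝ) :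
    cuq v m B y θ ≤ v - 1 := by
  have hv' : (2 : ℝ) ≤ v := by exact_mod_cast hv
  have hcast : ((v - 1 : ℕ) : ℝ) = (v : ℝ) - 1 := by
    rw [Nat.cast_sub (by omega)]; simp
  have ha : ((v : ℝ) - 1) * (m * y + B) / (2 * B) ≤ ((v - 1 : ℕ) : ℝ) := by
    rw [div_le_iff₀ (by positivity), hcast]
    have := (abs_le.1 hy).2
    nlinarith
  rw [cuq]
  split_ifs
  · exact Nat.ceil_le.2 ha
  · exact (Nat.floor_le_ceil _).trans (Nat.ceil_le.2 ha)

namespace WZ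

variable (s : WZ)

/-- The first half of the clients. -/
def firstHalf : Finset (Fin s.K) := Finset.univ.filter fun k => (k : ℕ) < s.m

/-- The second half of the clients. -/
def secondHalf : Finset (Fin s.K) := Finset.univ.filter fun k => s.m ≤ (k : ℕ)

theorem card_firstHalf : s.firstHalf.card = s.m := by
  rw [firstHalf, Fin.card_filter_val_lt]
  exact min_eq_right (Nat.div_le_self _ _)

theorem card_secondHalf (hK : Even s.K) : s.secondHalf.card = s.m := by
  have h := Finset.card_filter_add_card_filter_not (s := (Finset.univ : Finset (Fin s.K)))
    (fun k => (k : ℕ) < s.m)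
  simp only [not_lt, Finset.card_univ, Fintype.card_fin] at h
  have h1 := s.card_firstHalf
  rw [firstHalf] at h1
  rw [secondHalf]
  obtain ⟨a, ha⟩ := hK
  have : s.m = a := by rw [m, ha]; omega
  omega

theorem m_pos (hK : Even s.K) (hK0 : 0 < s.K) : 0 < s.m := by
  obtain ⟨a, ha⟩ := hK
  rw [m]; omega

theorem cast_K (hK : Even s.K) : (s.K : ℝ) = 2 * s.m := by
  obtain ⟨a, ha⟩ := hK
  have : s.K = 2 * s.m := by rw [m, ha]; omega
  exact_mod_cast this

theorem count_le (k : Fin s.K) (x : Fin s.d → ℝ) (u : s.Coins) (j : Fin s.d) :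
    s.count k x u j ≤ s.I := by
  rw [count]
  refine (Finset.sum_le_card_nsmul _ _ 1 fun i _ => ?_).trans (by simp)
  split_ifs <;> simp

theorem abs_coord_le {d : ℕ} (g : E d) (j : Fin d) : |g j| ≤ ‖g‖ := by
  rw [← Real.norm_eq_abs]; exact PiLp.norm_apply_le g j

theorem quant₁_le (hK : Even s.K) (hK0 : 0 < s.K) (hv : 2 ≤ s.v) (hB : 0 < s.B) (k : Fin s.K)
    (g : E s.d) (hg : ‖g‖ ≤ s.B) (u : s.Coins) (j : Fin s.d) : s.quant₁ k g u j ≤ s.v - 1 := by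
  refine cuq_le hv hB ?_ _
  have hm : (s.m : ℝ) ≠ 0 := by exact_mod_cast (s.m_pos hK hK0).ne'
  have : (s.m : ℝ) * s.scaled g j = g j := by
    rw [scaled, s.cast_K hK]; field_simp
  rw [this]
  exact (abs_coord_le g j).trans hg

/-- Every client transmits points of an ASK code, whose modulus is at most `√P`, or stays
silent. -/
theorem sum_encoder_sq_le (hK : Even s.K) (hK0 : 0 < s.K) (hv : 2 ≤ s.v) (hI : 1 ≤ s.I)
    (hB : 0 < s.B) (hP : 0 < s.P) (hp : 0 < s.p) (hp' : 0 < s.p') (k : Fin s.K) (g : E s.d)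
    (hg : ‖g‖ ≤ s.B) (u : s.Coins) : ∑ j, s.encoder k g u j ^ 2 ≤ s.len * s.P := by
  have hm := s.m_pos hK hK0
  have key : ∀ j, s.encoder k g u j ^ 2 ≤ s.P := by
    have hsq : ∀ x : ℝ, |x| ≤ √s.P → x ^ 2 ≤ s.P := fun x hx => by
      rw [← sq_abs]
      calc |x| ^ 2 ≤ √s.P ^ 2 := by gcongr
        _ = s.P := Real.sq_sqrt hP.le
    rintro (j | j)
    · refine hsq _ ?_
      simp only [encoder, Sum.elim_inl]
      split_ifs
      · refine abs_askPoint_le ?_ (two_le_askSize hm hv hp)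
        have := latticeEncode_le (a := 1) hp (s.quant₁ k g u)
          (fun i => by rw [one_mul]; exact s.quant₁_le hK hK0 hv hB k g hg u i) hm j
        rwa [one_mul] at this
      · simp
    · refine hsq _ ?_
      simp only [encoder, Sum.elim_inr]
      split_ifs
      · refine abs_askPoint_le ?_ (two_le_askSize hm (by omega) hp')
        have := latticeEncode_le (a := 1) (v := s.I + 1) hp' (s.quant₂ k g u)
          (fun i => by
            rw [one_mul, Nat.add_sub_cancel]; exact s.count_le k _ u i) hm j
        rwa [one_mul] at this
      · simp
  calc ∑ j, s.encoder k g u j ^ 2 ≤ ∑ _j : s.Uses, s.P := Finset.sum_le_sum fun j _ => key j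
    _ = s.len * s.P := by
      simp [len]

theorem channel_encoder_inl (g : Fin s.K → E s.d) (u : s.Coins) (z : s.Uses → ℝ)
    (j : Fin (s.d / s.p)) :
    s.channel (fun k => s.encoder k (g k) u) z (Sum.inl j)
      = sumPoint s.P s.m (askSize s.m s.v s.p) (latticeEncode (latticeBase s.m s.v) s.p
          (fun i => ∑ k ∈ s.firstHalf, s.quant₁ k (g k) u i) j) + z (Sum.inl j) := by
  simp only [channel, encoder, Sum.elim_inl, modulate]
  rw [← Finset.sum_filter, sum_askPoint, ← sum_latticeEncode]
  have := s.card_firstHalf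
  rw [firstHalf] at *
  rw [this]

theorem channel_encoder_inr (hK : Even s.K) (g : Fin s.K → E s.d) (u : s.Coins) (z : s.Uses → ℝ)
    (j : Fin (s.d / s.p')) :
    s.channel (fun k => s.encoder k (g k) u) z (Sum.inr j)
      = sumPoint s.P s.m (askSize s.m (s.I + 1) s.p') (latticeEncode (latticeBase s.m (s.I + 1))
          s.p' (fun i => ∑ k ∈ s.secondHalf, s.quant₂ k (g k) u i) j) + z (Sum.inr j) := by
  simp only [channel, encoder, Sum.elim_inr, modulate]
  rw [← Finset.sum_filter, sum_askPoint, ← sum_latticeEncode]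
  have := s.card_secondHalf hK
  rw [secondHalf] at *
  rw [this]

/-- Half the distance between neighbouring constellation points in the given channel use. -/
def tolerance : s.Uses → ℝ :=
  Sum.elim (fun _ => √s.P / ((askSize s.m s.v s.p : ℝ) - 1))
    (fun _ => √s.P / ((askSize s.m (s.I + 1) s.p' : ℝ) - 1))

/-- Noise below the tolerance does not change the estimate of the server at all. -/
theorem decoder_eq_of_small_noise (hK : Even s.K) (hK0 : 0 < s.K) (hv : 2 ≤ s.v) (hI : 1 ≤ s.I)
    (hP : 0 < s.P) (hp : 0 < s.p) (hp' : 0 < s.p') (g : Fin s.K → E s.d) (u : s.Coins)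
    {z : s.Uses → ℝ} (hz : ∀ j, |z j| < s.tolerance j) :
    s.decoder (s.channel (fun k => s.encoder k (g k) u) z) u
      = s.decoder (s.channel (fun k => s.encoder k (g k) u) 0) u := by
  have hm := s.m_pos hK hK0
  have h0 : ∀ j, |(0 : s.Uses → ℝ) j| < s.tolerance j := fun j => by
    rw [Pi.zero_apply, abs_zero]
    exact (abs_nonneg _).trans_lt (hz j)
  have e1 : ∀ z : s.Uses → ℝ, (∀ j, |z j| < s.tolerance j) → _ := fun z hz =>
    latticeDecode_sumPoint_add hP hm hv hp s.p_dvd (fun j => latticeEncode (latticeBase s.m s.v) s.p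
      (fun i => ∑ k ∈ s.firstHalf, s.quant₁ k (g k) u i) j) (fun j => z (Sum.inl j))
      (fun j => hz (Sum.inl j))
  have e2 : ∀ z : s.Uses → ℝ, (∀ j, |z j| < s.tolerance j) → _ := fun z hz =>
    latticeDecode_sumPoint_add hP hm (v := s.I + 1) (by omega) hp' s.p'_dvd
      (fun j => latticeEncode (latticeBase s.m (s.I + 1))
          s.p' (fun i => ∑ k ∈ s.secondHalf, s.quant₂ k (g k) u i) j) (fun j => z (Sum.inr j))
      (fun j => hz (Sum.inr j))
  have hS : s.sideInfo (s.channel (fun k => s.encoder k (g k) u) z)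
      = s.sideInfo (s.channel (fun k => s.encoder k (g k) u) 0) := by
    funext i
    simp only [sideInfo, channel_encoder_inl, e1 z hz, e1 0 h0]
  simp only [decoder, hS, channel_encoder_inr _ hK, e2 z hz, e2 0 h0]

/-- The side information that the server forms when the first phase is decoded correctly. -/
def exactSide (g : Fin s.K → E s.d) (u : s.Coins) : Fin s.d → ℝ := fun i =>
  (-s.B + 2 * s.B / (s.m * ((s.v : ℝ) - 1)) *
    ((∑ k ∈ s.firstHalf, s.quant₁ k (g k) u i : ℕ) : ℝ)) / (s.K / 2)

/-- Without noise both phases are decoded correctly. -/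
theorem decoder_zero_noise (hK : Even s.K) (hK0 : 0 < s.K) (hv : 2 ≤ s.v) (hI : 1 ≤ s.I)
    (hB : 0 < s.B) (hP : 0 < s.P) (hp : 0 < s.p) (hp' : 0 < s.p') (g : Fin s.K → E s.d)
    (hg : ∀ k, ‖g k‖ ≤ s.B) (u : s.Coins) :
    s.decoder (s.channel (fun k => s.encoder k (g k) u) 0) u
      = WithLp.toLp 2 ((2 * s.M / s.I) • ((rotation s.n u.1)⁻¹ *ᵥ fun j =>
          ∑ k ∈ s.secondHalf, ((s.quant₂ k (g k) u j : ℝ)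
            - s.count k (rotation s.n u.1 *ᵥ s.exactSide g u) u j))
          + ((s.K : ℝ) / 2) • s.exactSide g u) := by
  have hm := s.m_pos hK hK0
  have e1 := latticeDecode_exact hP hm hv hp s.p_dvd
      (fun i => ∑ k ∈ s.firstHalf, s.quant₁ k (g k) u i) (fun i => by
        rw [← s.card_firstHalf, ← smul_eq_mul]
        exact Finset.sum_le_card_nsmul _ _ _ fun k _ =>
          s.quant₁_le hK hK0 hv hB k _ (hg k) u i)
  have e2 := latticeDecode_exact hP hm (v := s.I + 1) (by omega) hp' s.p'_dvd
      (fun i => ∑ k ∈ s.secondHalf, s.quant₂ k (g k) u i) (fun i => by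
        rw [Nat.add_sub_cancel, ← s.card_secondHalf hK, ← smul_eq_mul]
        exact Finset.sum_le_card_nsmul _ _ _ fun k _ => s.count_le k _ u i)
  have hS : s.sideInfo (s.channel (fun k => s.encoder k (g k) u) 0) = s.exactSide g u := by
    funext i
    simp only [sideInfo, channel_encoder_inl, Pi.zero_apply, add_zero, e1, exactSide]
  simp only [decoder, hS, channel_encoder_inr _ hK, Pi.zero_apply, add_zero, e2]
  congr 5
  funext j
  simp only [Pi.sub_apply, Finset.sum_sub_distrib, Nat.cast_sum]
  rw [← Finset.sum_filter]
  rfl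

end WZ

/-! ### Orthogonality of the random rotation -/

theorem walshHadamard_sq (n : ℕ) (i j : Fin (2 ^ n)) : walshHadamard n i j ^ 2 = 1 := by
  rw [walshHadamard, Matrix.of_apply, ← Finset.prod_pow]
  refine Finset.prod_eq_one fun b _ => ?_
  split_ifs <;> norm_num

/-- Flipping one bit of the column index multiplies the entry by the corresponding character. -/
theorem walshHadamard_flip (n : ℕ) {b : ℕ} (hb : b < n) (i l l' : Fin (2 ^ n))
    (hl : (l' : ℕ) = (l : ℕ) ^^^ 2 ^ b) :
    walshHadamard n i l' = (if (i : ℕ).testBit b then -1 else 1) * walshHadamard n i l := by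
  have h : (if (i : ℕ).testBit b then (-1 : ℝ) else 1)
      = ∏ b' ∈ Finset.range n, if b' = b then (if (i : ℕ).testBit b then (-1 : ℝ) else 1)
        else 1 := by
    rw [Finset.prod_ite_eq' (Finset.range n) b
      (fun _ => if (i : ℕ).testBit b then (-1 : ℝ) else 1), if_pos (Finset.mem_range.2 hb)]
  rw [walshHadamard, Matrix.of_apply, Matrix.of_apply, h, ← Finset.prod_mul_distrib]
  refine Finset.prod_congr rfl fun b' _ => ?_
  rw [hl, Nat.testBit_xor, Nat.testBit_two_pow]
  by_cases hbb : b' = b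
  · subst hbb
    cases (i : ℕ).testBit b' <;> cases (l : ℕ).testBit b' <;> norm_num
  · have : ¬ b = b' := fun h => hbb h.symm
    simp [hbb, this]

/-- Rows `i ≠ j` are orthogonal because flipping a bit in which `i` and `j` differ reverses the sign
of every product of their entries. -/
theorem walshHadamard_mul_transpose (n : ℕ) :
    walshHadamard n * (walshHadamard n)ᵀ = ((2 : ℝ) ^ n) • (1 : Matrix _ _ ℝ) := by
  ext i j
  rw [Matrix.mul_apply, Matrix.smul_apply, Matrix.one_apply]
  simp only [Matrix.transpose_apply]
  split_ifs with hij
  · subst hij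
    simp only [← sq, walshHadamard_sq]
    simp
  · obtain ⟨b, hb⟩ : ∃ b, (i : ℕ).testBit b ≠ (j : ℕ).testBit b := by
      by_contra! h
      exact hij (Fin.ext (Nat.eq_of_testBit_eq h))
    have hbn : b < n := by
      by_contra! h
      have hlt : ∀ l : Fin (2 ^ n), (l : ℕ).testBit b = false := fun l =>
        Nat.testBit_lt_two_pow (l.2.trans_le (Nat.pow_le_pow_right (by norm_num) h))
      exact hb (by rw [hlt, hlt])
    let σ : Fin (2 ^ n) → Fin (2 ^ n) := fun l =>
      ⟨(l : ℕ) ^^^ 2 ^ b, Nat.xor_lt_two_pow l.2 (Nat.pow_lt_pow_right (by norm_num) hbn)⟩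
    have hσ : Function.Involutive σ := fun l => Fin.ext (by simp [σ])
    let τ : Equiv.Perm (Fin (2 ^ n)) := Function.Involutive.toPerm σ hσ
    have hs := Equiv.sum_comp τ (fun l => walshHadamard n i l * walshHadamard n j l)
    have hneg : ∀ l, walshHadamard n i (τ l) * walshHadamard n j (τ l)
        = -(walshHadamard n i l * walshHadamard n j l) := fun l => by
      have hl : ((τ l : Fin (2 ^ n)) : ℕ) = (l : ℕ) ^^^ 2 ^ b := rfl
      rw [walshHadamard_flip n hbn i l _ hl, walshHadamard_flip n hbn j l _ hl]
      revert hb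
      cases (i : ℕ).testBit b <;> cases (j : ℕ).testBit b <;> simp
    simp only [hneg, Finset.sum_neg_distrib] at hs
    simp only [smul_zero]
    linarith

theorem rotation_apply (n : ℕ) (ε : Fin (2 ^ n) → Bool) (j i : Fin (2 ^ n)) :
    rotation n ε j i = 1 / √((2 : ℝ) ^ n) * walshHadamard n j i * (if ε i then 1 else -1) := by
  rw [rotation, Matrix.smul_apply, Matrix.mul_diagonal, smul_eq_mul, mul_assoc]

theorem rotation_sq (n : ℕ) (ε : Fin (2 ^ n) → Bool) (j i : Fin (2 ^ n)) :
    rotation n ε j i ^ 2 = 1 / (2 : ℝ) ^ n := by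
  rw [rotation_apply, mul_pow, mul_pow, walshHadamard_sq, div_pow, Real.sq_sqrt (by positivity)]
  split_ifs <;> norm_num

theorem rotation_mul_transpose (n : ℕ) (ε : Fin (2 ^ n) → Bool) :
    rotation n ε * (rotation n ε)ᵀ = 1 := by
  have hD : (Matrix.diagonal fun i => if ε i then (1 : ℝ) else -1) *
      (Matrix.diagonal fun i => if ε i then (1 : ℝ) else -1)ᵀ = 1 := by
    rw [Matrix.diagonal_transpose, Matrix.diagonal_mul_diagonal, ← Matrix.diagonal_one]
    congr 1
    funext i
    split_ifs <;> norm_num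
  rw [rotation, Matrix.transpose_smul, Matrix.transpose_mul, Matrix.smul_mul, Matrix.mul_smul,
    Matrix.mul_assoc, ← Matrix.mul_assoc (Matrix.diagonal _), hD, Matrix.one_mul,
    walshHadamard_mul_transpose, smul_smul, smul_smul, one_div, ← mul_inv,
    Real.mul_self_sqrt (by positivity), inv_mul_cancel₀ (by positivity), one_smul]

theorem rotation_inv (n : ℕ) (ε : Fin (2 ^ n) → Bool) :
    (rotation n ε)⁻¹ = (rotation n ε)ᵀ :=
  Matrix.inv_eq_right_inv (rotation_mul_transpose n ε)

theorem rotation_inv_mulVec (n : ℕ) (ε : Fin (2 ^ n) → Bool) (x : Fin (2 ^ n) → ℝ) :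
    (rotation n ε)⁻¹ *ᵥ (rotation n ε *ᵥ x) = x := by
  rw [Matrix.mulVec_mulVec, rotation_inv, mul_eq_one_comm.1 (rotation_mul_transpose n ε),
    Matrix.one_mulVec]

theorem rotation_mulVec_inv (n : ℕ) (ε : Fin (2 ^ n) → Bool) (x : Fin (2 ^ n) → ℝ) :
    rotation n ε *ᵥ ((rotation n ε)⁻¹ *ᵥ x) = x := by
  rw [Matrix.mulVec_mulVec, rotation_inv, rotation_mul_transpose, Matrix.one_mulVec]

theorem rotation_inv_dotProduct (n : ℕ) (ε : Fin (2 ^ n) → Bool) (x y : Fin (2 ^ n) → ℝ) :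
    ((rotation n ε)⁻¹ *ᵥ x) ⬝ᵥ y = x ⬝ᵥ (rotation n ε *ᵥ y) := by
  rw [rotation_inv, Matrix.mulVec_transpose, Matrix.dotProduct_mulVec]

theorem sum_sq_rotation_inv (n : ℕ) (ε : Fin (2 ^ n) → Bool) (x : Fin (2 ^ n) → ℝ) :
    ∑ j, ((rotation n ε)⁻¹ *ᵥ x) j ^ 2 = ∑ j, x j ^ 2 := by
  have h := rotation_inv_dotProduct n ε x ((rotation n ε)⁻¹ *ᵥ x)
  rw [rotation_mulVec_inv] at h
  simpa only [dotProduct, ← sq] using h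

theorem sum_sq_rotation (n : ℕ) (ε : Fin (2 ^ n) → Bool) (x : Fin (2 ^ n) → ℝ) :
    ∑ j, (rotation n ε *ᵥ x) j ^ 2 = ∑ j, x j ^ 2 := by
  rw [← sum_sq_rotation_inv n ε (rotation n ε *ᵥ x), rotation_inv_mulVec]

/-- The `ℓ¹` norm of a rotated vector is at most `√d` times the Euclidean norm of the vector. -/
theorem sum_abs_rotation_le (n : ℕ) (ε : Fin (2 ^ n) → Bool) (x : Fin (2 ^ n) → ℝ) :
    ∑ j, |(rotation n ε *ᵥ x) j| ≤ √((2 : ℝ) ^ n) * √(∑ j, x j ^ 2) := by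
  rw [← Real.sqrt_mul (by positivity), ← sum_sq_rotation n ε x]
  refine Real.le_sqrt_of_sq_le ?_
  have h := sq_sum_le_card_mul_sum_sq (s := Finset.univ) (f := fun j => |(rotation n ε *ᵥ x) j|)
  simpa [sq_abs] using h

/-! ### Functions of independent variables -/

section Pi

variable {ι Ω : Type*} [Fintype ι] [MeasurableSpace Ω] {μ : Measure Ω} [IsProbabilityMeasure μ]

theorem integrable_of_bdd {α : Type*} [MeasurableSpace α] {ν : Measure α} [IsFiniteMeasure ν]
    {F : Type*} [NormedAddCommGroup F] {f : α → F} (hf : AEStronglyMeasurable f ν) {C : ℝ}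
    (hC : ∀ a, ‖f a‖ ≤ C) : Integrable f ν :=
  Integrable.of_bound hf C (ae_of_all _ hC)

theorem memLp_two_of_bdd {α : Type*} [MeasurableSpace α] {ν : Measure α} [IsFiniteMeasure ν]
    {f : α → ℝ} (hf : Measurable f) {C : ℝ} (hC : ∀ a, |f a| ≤ C) : MemLp f 2 ν :=
  MemLp.of_bound hf.aestronglyMeasurable C (ae_of_all _ hC)

theorem integral_sum_pi {X : ι → Ω → ℝ} (h : ∀ i, Integrable (X i) μ) :
    ∫ ω, ∑ i, X i (ω i) ∂(Measure.pi fun _ : ι => μ) = ∑ i, ∫ w, X i w ∂μ := by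
  have hmp := fun i => measurePreserving_eval (fun _ : ι => μ) i
  rw [integral_finsetSum _ fun i _ => show Integrable (fun ω : ι → Ω => X i (ω i)) _ from
    (hmp i).integrable_comp_of_integrable (h i)]
  refine Finset.sum_congr rfl fun i _ => ?_
  have h1 := integral_map (hmp i).measurable.aemeasurable (f := X i)
    (by rw [(hmp i).map_eq]; exact (h i).aestronglyMeasurable)
  rw [(hmp i).map_eq] at h1
  exact h1.symm

theorem variance_sum_pi' {X : ι → Ω → ℝ} (h : ∀ i, MemLp (X i) 2 μ) :
    Var[fun ω => ∑ i, X i (ω i); Measure.pi fun _ : ι => μ] = ∑ i, Var[X i; μ] := by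
  rw [← variance_sum_pi h]
  congr 1
  funext ω
  rw [Finset.sum_apply]

theorem integral_exp_sum_pi_le {X : ι → Ω → ℝ} {c : ι → ℝ}
    (h : ∀ i, ∫ w, Real.exp (X i w) ∂μ ≤ Real.exp (c i)) :
    ∫ ω, Real.exp (∑ i, X i (ω i)) ∂(Measure.pi fun _ : ι => μ) ≤ Real.exp (∑ i, c i) := by
  simp only [Real.exp_sum]
  rw [integral_fintype_prod_eq_prod (fun i w => Real.exp (X i w))]
  exact Finset.prod_le_prod (fun i _ => integral_nonneg fun w => (Real.exp_pos _).le)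
    fun i _ => h i

/-- Second moment of an affine function of the sum of independent variables. -/
theorem integral_sq_eq_variance_add {α : Type*} [MeasurableSpace α] {ν : Measure α}
    [IsProbabilityMeasure ν] {f : α → ℝ} (hf : MemLp f 2 ν) (c : ℝ) :
    ∫ a, (f a + c) ^ 2 ∂ν = Var[f; ν] + ((∫ a, f a ∂ν) + c) ^ 2 := by
  have h1 : MemLp (fun a => f a + c) 2 ν := hf.add (memLp_const c)
  have h2 := variance_eq_sub h1
  rw [variance_add_const hf.aestronglyMeasurable] at h2
  have h3 : ∫ a, (f a + c) ∂ν = (∫ a, f a ∂ν) + c := by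
    rw [integral_add (hf.integrable (by norm_num)) (integrable_const c)]
    simp
  simp only [Pi.pow_apply, h3] at h2
  linarith

end Pi

/-! ### Uniform dithers -/

theorem isProbabilityMeasure_uniform {a b : ℝ} (h : a < b) :
    IsProbabilityMeasure (cond volume (Set.Icc a b)) := by
  have : (volume (Set.Icc a b)) ≠ 0 := by
    rw [Real.volume_Icc]
    exact (ENNReal.ofReal_pos.2 (by linarith)).ne'
  exact cond_isProbabilityMeasure_of_finite this (by simp)

instance : IsProbabilityMeasure (cond volume (Set.Icc (0 : ℝ) 1)) :=
  isProbabilityMeasure_uniform one_pos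

/-- Projection of the real line onto `[-M, M]`. -/
def clip (M y : ℝ) : ℝ := max (-M) (min y M)

/-- The amount by which `y` exceeds the interval `[-M, M]`. -/
def excess (M y : ℝ) : ℝ := y - clip M y

theorem abs_clip_sub_clip_le (M a b : ℝ) : |clip M a - clip M b| ≤ |a - b| := by
  rw [clip, clip]
  exact (abs_max_sub_max_le_max _ _ _ _).trans (by
    rw [sub_self, abs_zero]
    exact max_le (abs_nonneg _) ((abs_min_sub_min_le_max _ _ _ _).trans (by simp)))

theorem sq_le_two_mul_exp {x : ℝ} (hx : 0 ≤ x) : x ^ 2 ≤ 2 * Real.exp x := by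
  have := Real.quadratic_le_exp_of_nonneg hx
  nlinarith

/-- Exponential moments control the second moment of the excess. -/
theorem excess_sq_le {M l : ℝ} (hM : 0 ≤ M) (hl : 0 < l) (y : ℝ) :
    excess M y ^ 2 ≤ 2 / l ^ 2 * Real.exp (-(l * M)) * (Real.exp (l * y) + Real.exp (-l * y)) := by
  have key : ∀ t, 0 ≤ t → t ^ 2 ≤ 2 / l ^ 2 * Real.exp (l * t) := fun t ht => by
    have := sq_le_two_mul_exp (mul_nonneg hl.le ht)
    rw [div_mul_eq_mul_div, le_div_iff₀ (by positivity)]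
    nlinarith
  have e1 : Real.exp (-(l * M)) * Real.exp (l * y) = Real.exp (l * (y - M)) := by
    rw [← Real.exp_add]; congr 1; ring
  have e2 : Real.exp (-(l * M)) * Real.exp (-l * y) = Real.exp (l * (-y - M)) := by
    rw [← Real.exp_add]; congr 1; ring
  rw [mul_assoc, mul_add, e1, e2]
  have p1 : 0 < 2 / l ^ 2 * Real.exp (l * (y - M)) := by positivity
  have p2 : 0 < 2 / l ^ 2 * Real.exp (l * (-y - M)) := by positivity
  rw [mul_add]
  rcases lt_or_ge M y with h | h
  · have : excess M y = y - M := by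
      rw [excess, clip, min_eq_right h.le, max_eq_right (by linarith)]
    rw [this]
    linarith [key (y - M) (by linarith)]
  · rcases lt_or_ge y (-M) with h' | h'
    · have : excess M y = -(-y - M) := by
        rw [excess, clip, min_eq_left h, max_eq_left h'.le]; ring
      rw [this, neg_sq]
      linarith [key (-y - M) (by linarith)]
    · have : excess M y = 0 := by
        rw [excess, clip, min_eq_left h, max_eq_right h', sub_self]
      rw [this]
      nlinarith

theorem integral_indicator_uniform {a b : ℝ} (h : a < b) (y : ℝ) :
    ∫ u, (if u ≤ y then (1 : ℝ) else 0) ∂(cond volume (Set.Icc a b))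
      = (max a (min y b) - a) / (b - a) := by
  have h1 : (fun u : ℝ => if u ≤ y then (1 : ℝ) else 0) = (Set.Iic y).indicator 1 := by
    funext u
    simp [Set.indicator_apply]
  rw [h1, integral_indicator_one measurableSet_Iic, measureReal_def,
    cond_apply measurableSet_Icc]
  have h2 : Set.Icc a b ∩ Set.Iic y = Set.Icc a (min y b) := by
    ext u
    simp only [Set.mem_inter_iff, Set.mem_Icc, Set.mem_Iic, le_min_iff]
    tauto
  rw [h2, Real.volume_Icc, Real.volume_Icc, ENNReal.toReal_mul, ENNReal.toReal_inv,
    ENNReal.toReal_ofReal (by linarith)]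
  rcases le_total a (min y b) with h3 | h3
  · rw [max_eq_right h3, ENNReal.toReal_ofReal (by linarith)]
    field_simp
  · rw [max_eq_left h3, ENNReal.ofReal_of_nonpos (by linarith)]
    simp

/-- Difference of the indicators of `u ≤ a` and `u ≤ b`. -/
def stepDiff (a b u : ℝ) : ℝ := (if u ≤ a then 1 else 0) - if u ≤ b then 1 else 0

@[fun_prop]
theorem measurable_stepDiff (a b : ℝ) : Measurable (stepDiff a b) :=
  (Measurable.ite measurableSet_Iic measurable_const measurable_const).sub
    (Measurable.ite measurableSet_Iic measurable_const measurable_const)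

theorem abs_stepDiff_le (a b u : ℝ) : |stepDiff a b u| ≤ 1 := by
  rw [stepDiff]
  split_ifs <;> norm_num

theorem integrable_step {ν : Measure ℝ} [IsFiniteMeasure ν] (y : ℝ) :
    Integrable (fun u : ℝ => if u ≤ y then (1 : ℝ) else 0) ν := by
  refine integrable_of_bdd (C := 1)
    (Measurable.ite measurableSet_Iic measurable_const measurable_const).aestronglyMeasurable ?_
  intro a
  split_ifs <;> norm_num

theorem integral_stepDiff {M : ℝ} (hM : 0 < M) (a b : ℝ) :
    ∫ u, stepDiff a b u ∂(cond volume (Set.Icc (-M) M)) = (clip M a - clip M b) / (2 * M) := by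
  have := isProbabilityMeasure_uniform (show -M < M by linarith)
  simp only [stepDiff]
  rw [integral_sub (integrable_step a) (integrable_step b),
    integral_indicator_uniform (by linarith), integral_indicator_uniform (by linarith),
    ← sub_div]
  congr 1
  · rw [clip, clip]; ring
  · ring

/-- A dither distinguishes `a` from `b` only if it falls between them; this makes the variance of
the Wyner–Ziv quantizer proportional to the distance of input and side information. -/
theorem integral_stepDiff_sq_le {M : ℝ} (hM : 0 < M) (a b : ℝ) :
    ∫ u, stepDiff a b u ^ 2 ∂(cond volume (Set.Icc (-M) M)) ≤ |a - b| / (2 * M) := by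
  have key : ∀ a b, b ≤ a →
      ∫ u, stepDiff a b u ^ 2 ∂(cond volume (Set.Icc (-M) M)) ≤ |a - b| / (2 * M) := by
    intro a b hba
    have : ∀ u, stepDiff a b u ^ 2 = stepDiff a b u := fun u => by
      rw [stepDiff]
      split_ifs <;> norm_num
      linarith
    simp only [this, integral_stepDiff hM]
    gcongr
    exact (le_abs_self _).trans (abs_clip_sub_clip_le M a b)
  rcases le_total b a with h | h
  · exact key a b h
  · have : ∀ u, stepDiff a b u ^ 2 = stepDiff b a u ^ 2 := fun u => by
      rw [stepDiff, stepDiff]; ring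
    simp only [this]
    rw [abs_sub_comm]
    exact key b a h

/-! ### Rounding noise of the uniform quantizer -/

/-- Rounding error of randomized rounding of `a` with coin `θ`. -/
def roundErr (a θ : ℝ) : ℝ := ((if θ < Int.fract a then ⌈a⌉₊ else ⌊a⌋₊ : ℕ) : ℝ) - a

@[fun_prop]
theorem measurable_roundErr (a : ℝ) : Measurable (roundErr a) :=
  (measurable_from_top.comp
    (Measurable.ite measurableSet_Iio measurable_const measurable_const)).sub measurable_const

theorem floor_eq_sub_fract {a : ℝ} (ha : 0 ≤ a) : (⌊a⌋₊ : ℝ) = a - Int.fract a := by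
  rw [natCast_floor_eq_intCast_floor ha, Int.self_sub_fract]

theorem roundErr_mem {a : ℝ} (ha : 0 ≤ a) (θ : ℝ) :
    roundErr a θ ∈ Set.Icc (-Int.fract a) (1 - Int.fract a) := by
  have h1 := floor_eq_sub_fract ha
  have h2 : (⌈a⌉₊ : ℝ) ≤ ⌊a⌋₊ + 1 := by exact_mod_cast Nat.ceil_le_floor_add_one a
  have h3 : (⌊a⌋₊ : ℝ) ≤ ⌈a⌉₊ := by exact_mod_cast Nat.floor_le_ceil a
  rw [roundErr]
  split_ifs <;> constructor <;> linarith

theorem abs_roundErr_le {a : ℝ} (ha : 0 ≤ a) (θ : ℝ) : |roundErr a θ| ≤ 1 := by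
  have h := roundErr_mem ha θ
  have h1 := Int.fract_nonneg a
  have h2 := (Int.fract_lt_one a).le
  rw [abs_le]
  constructor <;> linarith [h.1, h.2]

theorem roundErr_eq {a θ : ℝ} (ha : 0 ≤ a) (hθ : 0 ≤ θ) :
    roundErr a θ = 1 - (if Int.fract a ≤ θ then 1 else 0) - Int.fract a := by
  have h1 := floor_eq_sub_fract ha
  rw [roundErr]
  by_cases h : θ < Int.fract a
  · rw [if_pos h, if_neg (not_le.2 h)]
    have h2 : (⌈a⌉₊ : ℝ) = ⌊a⌋₊ + 1 := by
      have h3 : ⌊a⌋₊ < ⌈a⌉₊ := Nat.lt_ceil.2 (by linarith)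
      have h4 := Nat.ceil_le_floor_add_one a
      exact_mod_cast (by omega : ⌈a⌉₊ = ⌊a⌋₊ + 1)
    rw [h2]; linarith
  · rw [if_neg h, if_pos (not_lt.1 h)]
    linarith

theorem integral_roundErr {a : ℝ} (ha : 0 ≤ a) :
    ∫ θ, roundErr a θ ∂(cond volume (Set.Icc (0 : ℝ) 1)) = 0 := by
  have hfr := Int.fract_nonneg a
  have hfr' := (Int.fract_lt_one a).le
  have hae : ∀ᵐ θ ∂(cond volume (Set.Icc (0 : ℝ) 1)),
      roundErr a θ = (if θ ≤ Int.fract a then (1 : ℝ) else 0) - Int.fract a := by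
    have h0 : ∀ᵐ θ ∂(cond volume (Set.Icc (0 : ℝ) 1)), θ ∈ Set.Icc (0 : ℝ) 1 :=
      ae_cond_mem measurableSet_Icc
    have h1 : ∀ᵐ θ ∂(cond volume (Set.Icc (0 : ℝ) 1)), θ ≠ Int.fract a := by
      exact cond_absolutelyContinuous.ae_le (Measure.ae_ne volume _)
    filter_upwards [h0, h1] with θ hθ hne
    rw [roundErr_eq ha hθ.1]
    by_cases h : θ ≤ Int.fract a
    · rw [if_pos h, if_neg (not_le.2 (lt_of_le_of_ne h hne))]; ring
    · rw [if_neg h, if_pos (not_le.1 h).le]; ring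
  rw [integral_congr_ae hae, integral_sub (integrable_step _) (integrable_const _),
    integral_indicator_uniform one_pos, min_eq_left hfr', max_eq_right hfr]
  simp

theorem variance_roundErr_le {a : ℝ} (ha : 0 ≤ a) :
    Var[roundErr a; cond volume (Set.Icc (0 : ℝ) 1)] ≤ 1 / 4 := by
  refine (variance_le_sq_of_bounded (ae_of_all _ (roundErr_mem ha))
    (measurable_roundErr a).aemeasurable).trans (le_of_eq ?_)
  ring

theorem integral_exp_roundErr_le {a : ℝ} (ha : 0 ≤ a) (t : ℝ) :
    ∫ θ, Real.exp (t * roundErr a θ) ∂(cond volume (Set.Icc (0 : ℝ) 1))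
      ≤ Real.exp (t ^ 2 / 8) := by
  have h := (hasSubgaussianMGF_of_mem_Icc_of_integral_eq_zero
    (measurable_roundErr a).aemeasurable (ae_of_all _ (roundErr_mem ha))
    (integral_roundErr ha)).mgf_le t
  rw [mgf] at h
  refine h.trans (le_of_eq ?_)
  congr 1
  have : (1 - Int.fract a - -Int.fract a) = 1 := by ring
  rw [this]
  simp
  ring

/-! ### Random signs -/

/-- Exponential moments of a linear combination of independent uniform signs. -/
theorem integral_exp_signs_le {ι : Type*} [Fintype ι] [DecidableEq ι] (c : ι → ℝ) :
    ∫ ε, Real.exp (∑ i, c i * (if ε i then 1 else -1))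
        ∂(PMF.uniformOfFintype (ι → Bool)).toMeasure
      ≤ Real.exp ((∑ i, c i ^ 2) / 2) := by
  rw [PMF.integral_eq_sum]
  have hcard : Fintype.card (ι → Bool) = 2 ^ Fintype.card ι := by simp
  have h1 : ∑ ε : ι → Bool, ((PMF.uniformOfFintype (ι → Bool)) ε).toReal •
      Real.exp (∑ i, c i * (if ε i then 1 else -1))
      = ∏ i, Real.cosh (c i) := by
    simp only [PMF.uniformOfFintype_apply, smul_eq_mul, Real.exp_sum]
    rw [← Finset.mul_sum]
    have h2 := Finset.prod_univ_sum (fun _ : ι => (Finset.univ : Finset Bool))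
      (fun i b => Real.exp (c i * (if b then 1 else -1)))
    rw [Fintype.piFinset_univ] at h2
    rw [← h2, hcard]
    simp only [Real.cosh_eq, Finset.prod_div_distrib, Finset.prod_const, Finset.card_univ,
      Fintype.univ_bool]
    simp [ENNReal.toReal_inv, div_eq_inv_mul]
  rw [h1, Finset.sum_div, Real.exp_sum]
  exact Finset.prod_le_prod (fun i _ => (Real.cosh_pos _).le)
    fun i _ => Real.cosh_le_exp_half_sq _

/-! ### Measurability and boundedness of the estimate of the server -/

namespace WZ

variable (s : WZ)

theorem measurable_rotation_mulVec {α : Type*} [MeasurableSpace α] {n : ℕ}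
    {ε : α → Fin (2 ^ n) → Bool} (hε : Measurable ε) {x : α → Fin (2 ^ n) → ℝ}
    (hx : Measurable x) : Measurable fun a => rotation n (ε a) *ᵥ x a := by
  refine measurable_pi_iff.2 fun j => ?_
  simp only [Matrix.mulVec, dotProduct]
  refine Finset.measurable_sum _ fun i _ => ?_
  exact ((measurable_of_finite (fun e : Fin (2 ^ n) → Bool => rotation n e j i)).comp hε).mul
    (measurable_pi_iff.1 hx i)

theorem measurable_rotation_inv_mulVec {α : Type*} [MeasurableSpace α] {n : ℕ}
    {ε : α → Fin (2 ^ n) → Bool} (hε : Measurable ε) {x : α → Fin (2 ^ n) → ℝ}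
    (hx : Measurable x) : Measurable fun a => (rotation n (ε a))⁻¹ *ᵥ x a := by
  refine measurable_pi_iff.2 fun j => ?_
  simp only [Matrix.mulVec, dotProduct]
  refine Finset.measurable_sum _ fun i _ => ?_
  exact ((measurable_of_finite (fun e : Fin (2 ^ n) → Bool => (rotation n e)⁻¹ j i)).comp hε).mul
    (measurable_pi_iff.1 hx i)

variable {α : Type*} [MeasurableSpace α]

theorem measurable_scaled {g : α → E s.d} (hg : Measurable g) :
    Measurable fun a => s.scaled (g a) := by
  refine measurable_pi_iff.2 fun j => ?_
  simp only [scaled]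
  have : Measurable fun a => g a j := (EuclideanSpace.proj (𝕜 := ℝ) j).measurable.comp hg
  exact (this.const_mul 2).div_const _

theorem measurable_quant₁ (k : Fin s.K) {g : α → E s.d} (hg : Measurable g) {u : α → s.Coins}
    (hu : Measurable u) : Measurable fun a => s.quant₁ k (g a) (u a) := by
  refine measurable_pi_iff.2 fun j => ?_
  simp only [quant₁, cuq]
  have h1 : Measurable fun a => s.scaled (g a) j :=
    measurable_pi_iff.1 (s.measurable_scaled hg) j
  have h2 : Measurable fun a => ((s.v : ℝ) - 1) * (s.m * s.scaled (g a) j + s.B) / (2 * s.B) :=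
    (((h1.const_mul _).add_const _).const_mul _).div_const _
  have h3 : Measurable fun a => (u a).2.1 k j :=
    measurable_pi_iff.1 (measurable_pi_iff.1 hu.snd.fst k) j
  exact Measurable.ite (measurableSet_lt h3 (measurable_fract.comp h2))
    (Nat.measurable_ceil.comp h2) (Nat.measurable_floor.comp h2)

theorem measurable_count (k : Fin s.K) {x : α → Fin s.d → ℝ} (hx : Measurable x)
    {u : α → s.Coins} (hu : Measurable u) : Measurable fun a => s.count k (x a) (u a) := by
  refine measurable_pi_iff.2 fun j => ?_
  simp only [count]
  refine Finset.measurable_sum _ fun i _ => ?_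
  have h3 : Measurable fun a => (u a).2.2 k i j :=
    measurable_pi_iff.1 (measurable_pi_iff.1 (measurable_pi_iff.1 hu.snd.snd k) i) j
  exact Measurable.ite (measurableSet_le h3 (measurable_pi_iff.1 hx j)) measurable_const
    measurable_const

theorem measurable_quant₂ (k : Fin s.K) {g : α → E s.d} (hg : Measurable g) {u : α → s.Coins}
    (hu : Measurable u) : Measurable fun a => s.quant₂ k (g a) (u a) :=
  s.measurable_count k (measurable_rotation_mulVec hu.fst (s.measurable_scaled hg)) hu

theorem measurable_modulate (P : ℝ) (m v p : ℕ) {d : ℕ} {q : α → Fin d → ℕ} (hq : Measurable q)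
    (j : Fin (d / p)) : Measurable fun a => modulate P m v p (q a) j := by
  simp only [modulate]
  refine (measurable_from_top (f := askPoint P (askSize m v p))).comp ?_
  simp only [latticeEncode]
  refine Finset.measurable_sum _ fun i _ => ?_
  split_ifs
  · exact (measurable_pi_iff.1 hq i).mul_const _
  · exact measurable_const

theorem measurable_encoder (k : Fin s.K) {g : α → E s.d} (hg : Measurable g) {u : α → s.Coins}
    (hu : Measurable u) (j : s.Uses) : Measurable fun a => s.encoder k (g a) (u a) j := by
  rcases j with j | j
  · simp only [encoder, Sum.elim_inl]
    split_ifs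
    · exact measurable_modulate _ _ _ _ (s.measurable_quant₁ k hg hu) j
    · exact measurable_const
  · simp only [encoder, Sum.elim_inr]
    split_ifs
    · exact measurable_modulate _ _ _ _ (s.measurable_quant₂ k hg hu) j
    · exact measurable_const

theorem measurable_latticeDecode (P : ℝ) (m v p : ℕ) {d : ℕ} (hd : p ∣ d)
    {Y : α → Fin (d / p) → ℝ} (hY : Measurable Y) (i : Fin d) :
    Measurable fun a => latticeDecode P m v p hd (Y a) i := by
  simp only [latticeDecode]
  refine (measurable_from_top (f := fun τ => digit (latticeBase m v) τ ((i : ℕ) % p))).comp ?_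
  simp only [mdDecode]
  refine Measurable.min (Nat.measurable_floor.comp ?_) measurable_const
  exact (((measurable_pi_iff.1 hY _).add_const _).div_const _).add_const _

theorem measurable_sideInfo {Y : α → s.Uses → ℝ} (hY : Measurable Y) :
    Measurable fun a => s.sideInfo (Y a) := by
  refine measurable_pi_iff.2 fun i => ?_
  simp only [sideInfo]
  have h1 : Measurable fun a => latticeDecode s.P s.m s.v s.p s.p_dvd
      (fun j => Y a (Sum.inl j)) i :=
    measurable_latticeDecode _ _ _ _ _
      (measurable_pi_iff.2 fun j => measurable_pi_iff.1 hY (Sum.inl j)) i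
  have h2 : Measurable fun a => (latticeDecode s.P s.m s.v s.p s.p_dvd
      (fun j => Y a (Sum.inl j)) i : ℝ) := measurable_from_top.comp h1
  exact ((h2.const_mul _).const_add _).div_const _

theorem measurable_decoder {Y : α → s.Uses → ℝ} (hY : Measurable Y) {u : α → s.Coins}
    (hu : Measurable u) : Measurable fun a => s.decoder (Y a) (u a) := by
  simp only [decoder]
  have hS := s.measurable_sideInfo hY
  refine (WithLp.measurable_toLp 2 (Fin s.d → ℝ)).comp ?_
  refine Measurable.add (Measurable.const_smul (measurable_rotation_inv_mulVec hu.fst ?_)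
    (2 * s.M / (s.I : ℝ)))
    (hS.const_smul ((s.K : ℝ) / 2))
  refine Measurable.sub ?_ ?_
  · refine measurable_pi_iff.2 fun i => ?_
    exact measurable_from_top.comp (measurable_latticeDecode _ _ _ _ _
      (measurable_pi_iff.2 fun j => measurable_pi_iff.1 hY (Sum.inr j)) i)
  · refine measurable_pi_iff.2 fun j => ?_
    refine Finset.measurable_sum _ fun k _ => ?_
    split_ifs
    · exact measurable_from_top.comp (measurable_pi_iff.1
        (s.measurable_count k (measurable_rotation_mulVec hu.fst hS) hu) j)
    · exact measurable_const

theorem measurable_decoder_channel {g : α → Fin s.K → E s.d} (hg : Measurable g)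
    {u : α → s.Coins} (hu : Measurable u) {z : α → s.Uses → ℝ} (hz : Measurable z) :
    Measurable fun a =>
      s.decoder (s.channel (fun k => s.encoder k (g a k) (u a)) (z a)) (u a) := by
  refine s.measurable_decoder (measurable_pi_iff.2 fun j => ?_) hu
  simp only [channel]
  exact (Finset.measurable_sum _ fun k _ =>
    s.measurable_encoder k (measurable_pi_iff.1 hg k) hu j).add (measurable_pi_iff.1 hz j)

theorem measurable_est (C : Fin s.K → Client s.d) {x : α → E s.d} (hx : Measurable x)
    {ξ : α → ∀ k, (C k).Ξ} (hξ : Measurable ξ) :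
    Measurable fun a => fun k => (C k).est (x a) (ξ a k) := by
  refine measurable_pi_iff.2 fun k => ?_
  exact (C k).measurable_est.comp (hx.prodMk (measurable_pi_iff.1 hξ k))

theorem measurable_estimate (C : Fin s.K → Client s.d) :
    Measurable (Function.uncurry (s.estimate C)) := by
  unfold estimate Function.uncurry
  exact s.measurable_decoder_channel
    (s.measurable_est C measurable_fst measurable_snd.fst) measurable_snd.snd.fst
    measurable_snd.snd.snd

theorem norm_le_of_coord_le {d : ℕ} (x : E d) {c : ℝ} (hc : ∀ j, |x j| ≤ c) :
    ‖x‖ ≤ √(d * c ^ 2) := by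
  rw [EuclideanSpace.norm_eq]
  refine Real.sqrt_le_sqrt ?_
  refine (Finset.sum_le_card_nsmul _ _ (c ^ 2) fun j _ => ?_).trans (by simp)
  rw [Real.norm_eq_abs]
  exact pow_le_pow_left₀ (abs_nonneg _) (hc j) 2

theorem abs_rotation_le (n : ℕ) (ε : Fin (2 ^ n) → Bool) (j i : Fin (2 ^ n)) :
    |rotation n ε j i| ≤ 1 := by
  rw [← sq_le_one_iff_abs_le_one, rotation_sq]
  exact (div_le_one (by positivity)).2 (one_le_pow₀ (by norm_num))

theorem abs_rotation_mulVec_le {n : ℕ} (ε : Fin (2 ^ n) → Bool) {x : Fin (2 ^ n) → ℝ} {c : ℝ}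
    (hx : ∀ i, |x i| ≤ c) (j : Fin (2 ^ n)) : |(rotation n ε *ᵥ x) j| ≤ 2 ^ n * c := by
  rw [Matrix.mulVec, dotProduct]
  refine (Finset.abs_sum_le_sum_abs _ _).trans ?_
  refine (Finset.sum_le_card_nsmul _ _ c fun i _ => ?_).trans (by simp)
  rw [abs_mul]
  calc _ ≤ 1 * |x i| := mul_le_mul_of_nonneg_right (abs_rotation_le _ _ _ _) (abs_nonneg _)
    _ ≤ c := by rw [one_mul]; exact hx i

theorem abs_rotation_inv_mulVec_le {n : ℕ} (ε : Fin (2 ^ n) → Bool) {x : Fin (2 ^ n) → ℝ} {c : ℝ}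
    (hx : ∀ i, |x i| ≤ c) (j : Fin (2 ^ n)) : |((rotation n ε)⁻¹ *ᵥ x) j| ≤ 2 ^ n * c := by
  rw [rotation_inv, Matrix.mulVec, dotProduct]
  refine (Finset.abs_sum_le_sum_abs _ _).trans ?_
  refine (Finset.sum_le_card_nsmul _ _ c fun i _ => ?_).trans (by simp)
  rw [abs_mul]
  calc _ ≤ 1 * |x i| := mul_le_mul_of_nonneg_right (abs_rotation_le _ _ _ _) (abs_nonneg _)
    _ ≤ c := by rw [one_mul]; exact hx i

theorem latticeDecode_le (P : ℝ) (m v p : ℕ) {d : ℕ} (hd : p ∣ d) (Y : Fin (d / p) → ℝ)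
    (i : Fin d) : latticeDecode P m v p hd Y i ≤ latticeBase m v :=
  (Nat.mod_lt _ (Nat.succ_pos _)).le

/-- The estimate is bounded whatever the noise is, since the decoder returns digits. -/
theorem exists_norm_decoder_le : ∃ c : ℝ, ∀ Y u, ‖s.decoder Y u‖ ≤ c := by
  set cS : ℝ := (|s.B| + |2 * s.B / (s.m * ((s.v : ℝ) - 1))| * latticeBase s.m s.v)
    / (s.K / 2) with hcS
  have hS : ∀ Y i, |s.sideInfo Y i| ≤ cS := fun Y i => by
    rw [sideInfo, hcS, abs_div, abs_of_nonneg (by positivity : (0 : ℝ) ≤ s.K / 2)]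
    gcongr
    refine (abs_add_le _ _).trans ?_
    rw [abs_neg, abs_mul, Nat.abs_cast]
    gcongr
    exact latticeDecode_le _ _ _ _ _ _ _
  set cL : ℝ := latticeBase s.m (s.I + 1) + s.K * s.I with hcL
  refine ⟨√(s.d * (|2 * s.M / s.I| * (2 ^ s.n * cL) + s.K / 2 * cS) ^ 2), fun Y u =>
    norm_le_of_coord_le _ fun j => ?_⟩
  simp only [decoder, Pi.add_apply, Pi.smul_apply, smul_eq_mul]
  refine (abs_add_le _ _).trans ?_
  rw [abs_mul, abs_mul, abs_of_nonneg (by positivity : (0 : ℝ) ≤ s.K / 2)]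
  gcongr
  · refine abs_rotation_inv_mulVec_le _ (fun i => ?_) j
    rw [Pi.sub_apply]
    refine (abs_sub _ _).trans ?_
    rw [Nat.abs_cast, hcL]
    gcongr
    · exact latticeDecode_le _ _ _ _ _ _ _
    · refine (Finset.abs_sum_le_sum_abs _ _).trans ?_
      refine (Finset.sum_le_card_nsmul _ _ (s.I : ℝ) fun k _ => ?_).trans (by simp)
      split_ifs
      · rw [Nat.abs_cast]
        exact_mod_cast s.count_le k _ u i
      · rw [abs_zero]; positivity
  · exact hS Y j

end WZ

/-! ### Doubly indexed independent variables -/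

section Nested

variable {ι κ Ω : Type*} [Fintype ι] [Fintype κ] [MeasurableSpace Ω] {ν : Measure Ω}
  [IsProbabilityMeasure ν]

theorem integral_sum_nested (A : Finset ι) {φ : ι → κ → Ω → ℝ}
    (h : ∀ k i, MemLp (φ k i) 2 ν) :
    ∫ U, ∑ k ∈ A, ∑ i, φ k i (U k i) ∂(Measure.pi fun _ : ι => Measure.pi fun _ : κ => ν)
      = ∑ k ∈ A, ∑ i, ∫ w, φ k i w ∂ν := by
  classical
  have hint : ∀ k i, Integrable (φ k i) ν := fun k i => (h k i).integrable (by norm_num)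
  have e : ∀ f : ι → ℝ, ∑ k ∈ A, f k = ∑ k, if k ∈ A then f k else 0 := fun f => by
    rw [Finset.sum_ite_mem, Finset.univ_inter]
  simp only [e]
  rw [integral_sum_pi (X := fun k (V : κ → Ω) => if k ∈ A then ∑ i, φ k i (V i) else 0)]
  · refine Finset.sum_congr rfl fun k _ => ?_
    split_ifs
    · exact integral_sum_pi (hint k)
    · simp
  · intro k
    split_ifs
    · exact integrable_finsetSum _ fun i _ =>
        (measurePreserving_eval (fun _ : κ => ν) i).integrable_comp_of_integrable (hint k i)
    · exact integrable_zero _ _ _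

theorem memLp_sum_nested (A : Finset ι) {φ : ι → κ → Ω → ℝ}
    (h : ∀ k i, MemLp (φ k i) 2 ν) :
    MemLp (fun U : ι → κ → Ω => ∑ k ∈ A, ∑ i, φ k i (U k i)) 2
      (Measure.pi fun _ : ι => Measure.pi fun _ : κ => ν) := by
  refine memLp_finsetSum _ fun k _ => memLp_finsetSum _ fun i _ => ?_
  exact ((h k i).comp_measurePreserving
    (measurePreserving_eval (fun _ : κ => ν) i)).comp_measurePreserving
    (measurePreserving_eval (fun _ : ι => Measure.pi fun _ : κ => ν) k)

theorem variance_sum_nested (A : Finset ι) {φ : ι → κ → Ω → ℝ}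
    (h : ∀ k i, MemLp (φ k i) 2 ν) :
    Var[fun U : ι → κ → Ω => ∑ k ∈ A, ∑ i, φ k i (U k i);
      Measure.pi fun _ : ι => Measure.pi fun _ : κ => ν] = ∑ k ∈ A, ∑ i, Var[φ k i; ν] := by
  classical
  have e : ∀ f : ι → ℝ, ∑ k ∈ A, f k = ∑ k, if k ∈ A then f k else 0 := fun f => by
    rw [Finset.sum_ite_mem, Finset.univ_inter]
  simp only [e]
  rw [variance_sum_pi' (X := fun k (V : κ → Ω) => if k ∈ A then ∑ i, φ k i (V i) else 0)]
  · refine Finset.sum_congr rfl fun k _ => ?_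
    split_ifs
    · exact variance_sum_pi' (h k)
    · exact variance_zero _
  · intro k
    split_ifs
    · exact memLp_finsetSum _ fun i _ =>
        (h k i).comp_measurePreserving (measurePreserving_eval (fun _ : κ => ν) i)
    · exact memLp_const 0

theorem integral_exp_sum_nested_le (A : Finset ι) {φ : ι → κ → Ω → ℝ} {c : ι → κ → ℝ}
    (h : ∀ k i, ∫ w, Real.exp (φ k i w) ∂ν ≤ Real.exp (c k i)) :
    ∫ U, Real.exp (∑ k ∈ A, ∑ i, φ k i (U k i))
        ∂(Measure.pi fun _ : ι => Measure.pi fun _ : κ => ν)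
      ≤ Real.exp (∑ k ∈ A, ∑ i, c k i) := by
  classical
  have e : ∀ f : ι → ℝ, ∑ k ∈ A, f k = ∑ k, if k ∈ A then f k else 0 := fun f => by
    rw [Finset.sum_ite_mem, Finset.univ_inter]
  simp only [e]
  refine integral_exp_sum_pi_le (X := fun k (V : κ → Ω) => if k ∈ A then ∑ i, φ k i (V i) else 0)
    fun k => ?_
  split_ifs
  · exact integral_exp_sum_pi_le (h k)
  · simp

end Nested

/-! ### The dithers of the second phase -/

section Dither

variable {K I d : ℕ} {M : ℝ}

/-- Mean and second moment of the Wyner–Ziv quantization error of one coordinate, for fixed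
values `y k` of the senders and side information `b`. -/
theorem dither_moments (hM : 0 < M) (hI : 0 < I) (A : Finset (Fin K)) (y : Fin K → ℝ) (b : ℝ)
    (j : Fin d) :
    (∫ U, ∑ k ∈ A, (2 * M / I * ∑ i, stepDiff (y k) b (U k i j) - (y k - b))
        ∂(Measure.pi fun _ : Fin K => Measure.pi fun _ : Fin I => Measure.pi fun _ : Fin d =>
          cond volume (Set.Icc (-M) M)) = -∑ k ∈ A, (excess M (y k) - excess M b)) ∧
    (∫ U, (∑ k ∈ A, (2 * M / I * ∑ i, stepDiff (y k) b (U k i j) - (y k - b))) ^ 2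
        ∂(Measure.pi fun _ : Fin K => Measure.pi fun _ : Fin I => Measure.pi fun _ : Fin d =>
          cond volume (Set.Icc (-M) M)) ≤ 2 * M / I * ∑ k ∈ A, |y k - b|
            + (∑ k ∈ A, (excess M (y k) - excess M b)) ^ 2) ∧
    MemLp (fun U => ∑ k ∈ A, (2 * M / I * ∑ i, stepDiff (y k) b (U k i j) - (y k - b))) 2
        (Measure.pi fun _ : Fin K => Measure.pi fun _ : Fin I => Measure.pi fun _ : Fin d =>
          cond volume (Set.Icc (-M) M)) := by
  have hprob := isProbabilityMeasure_uniform (show -M < M by linarith)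
  set u := cond volume (Set.Icc (-M) M) with hu
  set ν : Measure (Fin d → ℝ) := Measure.pi fun _ => u with hν
  have hI' : (0 : ℝ) < I := by exact_mod_cast hI
  have hmp : MeasurePreserving (Function.eval j) ν u := measurePreserving_eval (fun _ => u) j
  let φ : Fin K → Fin I → (Fin d → ℝ) → ℝ := fun k _ w => 2 * M / I * stepDiff (y k) b (w j)
  have hmeas : ∀ k, Measurable fun w : Fin d → ℝ => stepDiff (y k) b (w j) := fun k =>
    (measurable_stepDiff _ _).comp (measurable_pi_apply j)
  have hφ0 : ∀ k, MemLp (fun w : Fin d → ℝ => stepDiff (y k) b (w j)) 2 ν := fun k =>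
    memLp_two_of_bdd (hmeas k) fun w => abs_stepDiff_le _ _ _
  have hφ : ∀ k i, MemLp (φ k i) 2 ν := fun k i => (hφ0 k).const_mul _
  have hmean : ∀ k i, ∫ w, φ k i w ∂ν = (clip M (y k) - clip M b) / I := fun k i => by
    simp only [φ]
    rw [integral_const_mul]
    have := integral_map (μ := ν) hmp.measurable.aemeasurable (f := stepDiff (y k) b)
      (measurable_stepDiff _ _).aestronglyMeasurable
    rw [hmp.map_eq, integral_stepDiff hM] at this
    simp only [Function.eval] at this
    rw [← this]
    field_simp
  have hvar : ∀ k i, Var[φ k i; ν] ≤ 2 * M / I * (|y k - b| / I) := fun k i => by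
    simp only [φ]
    rw [variance_const_mul]
    have h1 := variance_le_expectation_sq (hmeas k).aestronglyMeasurable (μ := ν)
    have := integral_map (μ := ν) hmp.measurable.aemeasurable
      (f := fun x => stepDiff (y k) b x ^ 2)
      ((measurable_stepDiff _ _).pow_const 2).aestronglyMeasurable
    rw [hmp.map_eq] at this
    simp only [Function.eval, Pi.pow_apply] at this h1
    rw [← this] at h1
    have h2 := h1.trans (integral_stepDiff_sq_le hM (y k) b)
    calc _ ≤ (2 * M / I) ^ 2 * (|y k - b| / (2 * M)) := by gcongr
      _ = _ := by field_simp
  have hrew : ∀ U : Fin K → Fin I → Fin d → ℝ,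
      ∑ k ∈ A, (2 * M / I * ∑ i, stepDiff (y k) b (U k i j) - (y k - b))
        = ∑ k ∈ A, ∑ i, φ k i (U k i) + -∑ k ∈ A, (y k - b) := fun U => by
    rw [Finset.sum_sub_distrib, sub_eq_add_neg]
    simp only [φ, Finset.mul_sum]
  have hL := memLp_sum_nested A hφ
  have hE := integral_sum_nested A hφ
  have hV := variance_sum_nested A hφ
  have hEval : ∑ k ∈ A, ∑ i : Fin I, ∫ w, φ k i w ∂ν + -∑ k ∈ A, (y k - b)
      = -∑ k ∈ A, (excess M (y k) - excess M b) := by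
    simp only [hmean, Finset.sum_const, Finset.card_univ, Fintype.card_fin, nsmul_eq_mul]
    rw [← Finset.sum_neg_distrib, ← Finset.sum_neg_distrib, ← Finset.sum_add_distrib]
    refine Finset.sum_congr rfl fun k _ => ?_
    rw [mul_div_cancel₀ _ hI'.ne', excess, excess]
    ring
  simp only [hrew]
  refine ⟨?_, ?_, hL.add (memLp_const _)⟩
  · rw [integral_add (hL.integrable (by norm_num)) (integrable_const _), hE, ← hEval]
    simp
  · rw [integral_sq_eq_variance_add hL, hE, hEval, hV, neg_sq]
    gcongr
    rw [Finset.mul_sum]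
    refine Finset.sum_le_sum fun k _ => ?_
    refine (Finset.sum_le_sum fun i _ => hvar k i).trans (le_of_eq ?_)
    simp only [Finset.sum_const, Finset.card_univ, Fintype.card_fin, nsmul_eq_mul]
    field_simp

end Dither

namespace WZ

variable (s : WZ)

/-- Law of the signs of the rotation and of the coins of the quantizers of the first phase. -/
def signRoundLaw : Measure ((Fin s.d → Bool) × (Fin s.K → Fin s.d → ℝ)) :=
  (PMF.uniformOfFintype (Fin s.d → Bool)).toMeasure.prod
    (Measure.pi fun _ => Measure.pi fun _ => cond volume (Set.Icc 0 1))

instance : IsProbabilityMeasure s.signRoundLaw := by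
  unfold signRoundLaw
  infer_instance

/-- Law of the dithers of the second phase. -/
def ditherLaw : Measure (Fin s.K → Fin s.I → Fin s.d → ℝ) :=
  Measure.pi fun _ => Measure.pi fun _ => Measure.pi fun _ => cond volume (Set.Icc (-s.M) s.M)

theorem isProbabilityMeasure_ditherLaw (hM : 0 < s.M) : IsProbabilityMeasure s.ditherLaw := by
  have := isProbabilityMeasure_uniform (show -s.M < s.M by linarith)
  unfold ditherLaw
  infer_instance

theorem isProbabilityMeasure_coinLaw (hM : 0 < s.M) : IsProbabilityMeasure s.coinLaw := by
  have := isProbabilityMeasure_uniform (show -s.M < s.M by linarith)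
  unfold coinLaw
  infer_instance

theorem integral_coinLaw (hM : 0 < s.M) {f : s.Coins → ℝ} (hf : Integrable f s.coinLaw) :
    Integrable (fun e => ∫ U, f (e.1, e.2, U) ∂s.ditherLaw) s.signRoundLaw ∧
      ∫ u, f u ∂s.coinLaw = ∫ e, ∫ U, f (e.1, e.2, U) ∂s.ditherLaw ∂s.signRoundLaw := by
  have := s.isProbabilityMeasure_ditherLaw hM
  have hmp : MeasurePreserving MeasurableEquiv.prodAssoc (s.signRoundLaw.prod s.ditherLaw)
      s.coinLaw := by
    unfold signRoundLaw coinLaw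
    exact measurePreserving_prodAssoc _ _ _
  have hf' := hmp.integrable_comp_of_integrable hf
  refine ⟨hf'.integral_prod_left, ?_⟩
  rw [← hmp.integral_comp' f]
  exact integral_prod _ hf'

/-! ### Side information -/

/-- Average of the vectors of the first half of the clients. -/
def mean₁ (g : Fin s.K → E s.d) : E s.d := (1 / (s.m : ℝ)) • ∑ k ∈ s.firstHalf, g k

/-- Average of the vectors of the second half of the clients. -/
def mean₂ (g : Fin s.K → E s.d) : E s.d := (1 / (s.m : ℝ)) • ∑ k ∈ s.secondHalf, g k

/-- Position of the coordinate `y` on the grid of the seven-level quantizer. -/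
def gridPos (y : ℝ) : ℝ := 3 * (y + s.B) / s.B

theorem gridPos_nonneg (hB : 0 < s.B) {g : E s.d} (hg : ‖g‖ ≤ s.B) (i : Fin s.d) :
    0 ≤ s.gridPos (g i) := by
  have := (abs_le.1 ((abs_coord_le g i).trans hg)).1
  rw [gridPos]
  exact div_nonneg (by linarith) hB.le

/-- Error of `K/2` times the side information as an estimate of the average of the first half of
the clients. -/
def roundNoise (g : Fin s.K → E s.d) (θ : Fin s.K → Fin s.d → ℝ) (i : Fin s.d) : ℝ :=
  s.B / (3 * s.m) * ∑ k ∈ s.firstHalf, roundErr (s.gridPos (g k i)) (θ k i)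

/-- Conditions on the parameters of the scheme under which it is analysed. -/
structure Admissible : Prop where
  even : Even s.K
  K_pos : 0 < s.K
  v_eq : s.v = 7
  I_pos : 1 ≤ s.I
  p_pos : 0 < s.p
  p'_pos : 0 < s.p'
  B_pos : 0 < s.B
  M_pos : 0 < s.M
  P_pos : 0 < s.P

variable {s}

theorem Admissible.m_pos (hs : s.Admissible) : (0 : ℝ) < s.m := by
  exact_mod_cast s.m_pos hs.even hs.K_pos

theorem exactSide_eq (hs : s.Admissible) (g : Fin s.K → E s.d) (u : s.Coins) (i : Fin s.d) :
    s.exactSide g u i = 1 / s.m * (s.mean₁ g i + s.roundNoise g u.2.1 i) := by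
  have hm := hs.m_pos
  have hB := hs.B_pos
  have hK := s.cast_K hs.even
  have hq : ∀ k, (s.quant₁ k (g k) u i : ℝ)
      = roundErr (s.gridPos (g k i)) (u.2.1 k i) + s.gridPos (g k i) := fun k => by
    have ha : ((s.v : ℝ) - 1) * (s.m * s.scaled (g k) i + s.B) / (2 * s.B)
        = s.gridPos (g k i) := by
      rw [hs.v_eq, scaled, hK, gridPos]
      push_cast
      field_simp
      ring
    simp only [quant₁, cuq, ha, roundErr]
    ring
  have hmean : s.mean₁ g i = 1 / s.m * ∑ k ∈ s.firstHalf, g k i := by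
    rw [mean₁, PiLp.smul_apply, smul_eq_mul, WithLp.ofLp_sum, Finset.sum_apply]
  have hgrid : ∑ k ∈ s.firstHalf, s.gridPos (g k i)
      = 3 / s.B * ∑ k ∈ s.firstHalf, g k i + 3 * s.m := by
    have : ∀ k, s.gridPos (g k i) = 3 / s.B * g k i + 3 := fun k => by
      rw [gridPos]; field_simp
    simp only [this, Finset.sum_add_distrib, ← Finset.mul_sum, Finset.sum_const,
      s.card_firstHalf, nsmul_eq_mul]
    ring
  rw [exactSide, hmean, roundNoise, Nat.cast_sum]
  simp only [hq, Finset.sum_add_distrib, hgrid]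
  rw [hs.v_eq, hK]
  push_cast
  field_simp
  ring

theorem integral_roundNoise_sq_le (hs : s.Admissible) {g : Fin s.K → E s.d}
    (hg : ∀ k, ‖g k‖ ≤ s.B) (i : Fin s.d) :
    ∫ θ, s.roundNoise g θ i ^ 2
        ∂(Measure.pi fun _ => Measure.pi fun _ => cond volume (Set.Icc (0 : ℝ) 1))
      ≤ s.B ^ 2 / (36 * s.m) := by
  classical
  have hm := hs.m_pos
  have hpos := fun k => s.gridPos_nonneg hs.B_pos (hg k)
  let φ : Fin s.K → Fin s.d → ℝ → ℝ := fun k i' w =>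
    if i' = i then roundErr (s.gridPos (g k i)) w else 0
  have hφ : ∀ k i', MemLp (φ k i') 2 (cond volume (Set.Icc (0 : ℝ) 1)) := fun k i' => by
    simp only [φ]
    split_ifs
    · exact memLp_two_of_bdd (measurable_roundErr _) fun w => abs_roundErr_le (hpos k i) w
    · exact memLp_const 0
  have hrew : ∀ θ : Fin s.K → Fin s.d → ℝ, s.roundNoise g θ i ^ 2
      = (s.B / (3 * s.m)) ^ 2 * (∑ k ∈ s.firstHalf, ∑ i', φ k i' (θ k i') + 0) ^ 2 := fun θ => by
    simp only [φ, Finset.sum_ite_eq', Finset.mem_univ, if_true, roundNoise]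
    ring
  simp only [hrew]
  rw [integral_const_mul, integral_sq_eq_variance_add (memLp_sum_nested s.firstHalf hφ),
    integral_sum_nested s.firstHalf hφ, variance_sum_nested s.firstHalf hφ]
  have h0 : ∀ k i', ∫ w, φ k i' w ∂(cond volume (Set.Icc (0 : ℝ) 1)) = 0 := fun k i' => by
    simp only [φ]
    split_ifs
    · exact integral_roundErr (hpos k i)
    · simp
  have h1 : ∀ k, ∑ i', Var[φ k i'; cond volume (Set.Icc (0 : ℝ) 1)] ≤ 1 / 4 := fun k => by
    rw [Finset.sum_eq_single i]
    · simp only [φ, if_true]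
      exact variance_roundErr_le (hpos k i)
    · intro b _ hb
      simp only [φ, if_neg hb]
      exact variance_zero _
    · simp
  simp only [h0, Finset.sum_const_zero, add_zero]
  have h2 : ∑ k ∈ s.firstHalf, ∑ i', Var[φ k i'; cond volume (Set.Icc (0 : ℝ) 1)]
      ≤ s.m * (1 / 4) := by
    refine (Finset.sum_le_card_nsmul _ _ _ fun k _ => h1 k).trans ?_
    rw [s.card_firstHalf, nsmul_eq_mul]
  calc _ ≤ (s.B / (3 * s.m)) ^ 2 * (s.m * (1 / 4) + 0 ^ 2) := by gcongr
    _ = _ := by field_simp; ring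


/-! ### Exponential moments after rotation -/

/-- The random rotation spreads a vector evenly over the coordinates. -/
theorem integral_exp_rotation_le (n : ℕ) (x : Fin (2 ^ n) → ℝ) (t : ℝ) (j : Fin (2 ^ n)) :
    ∫ ε, Real.exp (t * (rotation n ε *ᵥ x) j)
        ∂(PMF.uniformOfFintype (Fin (2 ^ n) → Bool)).toMeasure
      ≤ Real.exp (t ^ 2 * (∑ i, x i ^ 2) / (2 * 2 ^ n)) := by
  have h := integral_exp_signs_le
    (fun i => t * (1 / √((2 : ℝ) ^ n) * walshHadamard n j i) * x i)
  have h1 : ∀ ε : Fin (2 ^ n) → Bool, t * (rotation n ε *ᵥ x) j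
      = ∑ i, t * (1 / √((2 : ℝ) ^ n) * walshHadamard n j i) * x i * (if ε i then 1 else -1) := by
    intro ε
    rw [Matrix.mulVec, dotProduct, Finset.mul_sum]
    refine Finset.sum_congr rfl fun i _ => ?_
    rw [rotation_apply]
    ring
  simp only [h1]
  refine h.trans (Real.exp_le_exp.2 (le_of_eq ?_))
  have h2 : ∀ i, (t * (1 / √((2 : ℝ) ^ n) * walshHadamard n j i) * x i) ^ 2
      = t ^ 2 / 2 ^ n * x i ^ 2 := fun i => by
    rw [mul_pow, mul_pow, mul_pow, walshHadamard_sq, div_pow, Real.sq_sqrt (by positivity)]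
    ring
  simp only [h2, ← Finset.mul_sum]
  field_simp

/-- Rotated scaled gradient of a client. -/
def rotated (k : Fin s.K) (g : Fin s.K → E s.d) (e : Fin s.d → Bool) : Fin s.d → ℝ :=
  rotation s.n e *ᵥ s.scaled (g k)

/-- Side information, as a function of the coins on which it depends. -/
def side (g : Fin s.K → E s.d) (θ : Fin s.K → Fin s.d → ℝ) : Fin s.d → ℝ := fun i =>
  1 / s.m * (s.mean₁ g i + s.roundNoise g θ i)

/-- Rotated side information. -/
def rotatedSide (g : Fin s.K → E s.d)
    (e : (Fin s.d → Bool) × (Fin s.K → Fin s.d → ℝ)) : Fin s.d → ℝ :=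
  rotation s.n e.1 *ᵥ side g e.2

theorem sum_sq_coord {d : ℕ} (x : E d) : ∑ i, x i ^ 2 = ‖x‖ ^ 2 := by
  rw [EuclideanSpace.norm_sq_eq]
  simp

theorem norm_mean_le {ι : Type*} (A : Finset ι) {F : Type*} [NormedAddCommGroup F]
    [NormedSpace ℝ F] (g : ι → F) {B : ℝ} (hB : 0 ≤ B) (hg : ∀ k, ‖g k‖ ≤ B) :
    ‖(1 / (A.card : ℝ)) • ∑ k ∈ A, g k‖ ≤ B := by
  rw [norm_smul, Real.norm_of_nonneg (by positivity)]
  have h := norm_sum_le_of_le A fun k _ => hg k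
  rw [Finset.sum_const, nsmul_eq_mul] at h
  rcases Nat.eq_zero_or_pos A.card with h0 | h0
  · rw [h0]; simpa
  · have : (0 : ℝ) < A.card := by exact_mod_cast h0
    rw [one_div, inv_mul_le_iff₀ this]
    exact h

theorem integral_exp_rotated_le (hs : s.Admissible) {g : Fin s.K → E s.d}
    (hg : ∀ k, ‖g k‖ ≤ s.B) (k : Fin s.K) (t : ℝ) (j : Fin s.d) :
    ∫ ε, Real.exp (t * rotated k g ε j) ∂(PMF.uniformOfFintype (Fin s.d → Bool)).toMeasure
      ≤ Real.exp (t ^ 2 * s.B ^ 2 / (s.m ^ 2 * 2 ^ s.n)) := by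
  refine (integral_exp_rotation_le s.n _ t j).trans (Real.exp_le_exp.2 ?_)
  have hm := hs.m_pos
  have h1 : ∑ i, s.scaled (g k) i ^ 2 = ‖g k‖ ^ 2 / s.m ^ 2 := by
    rw [← sum_sq_coord, Finset.sum_div]
    refine Finset.sum_congr rfl fun i _ => ?_
    rw [scaled, s.cast_K hs.even]
    field_simp
  have h2 : ‖g k‖ ^ 2 ≤ s.B ^ 2 := pow_le_pow_left₀ (norm_nonneg _) (hg k) 2
  rw [h1]
  calc t ^ 2 * (‖g k‖ ^ 2 / s.m ^ 2) / (2 * 2 ^ s.n)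
      ≤ t ^ 2 * (s.B ^ 2 / s.m ^ 2) / (1 * 2 ^ s.n) := by gcongr; norm_num
    _ = _ := by field_simp

theorem measurable_roundNoise (g : Fin s.K → E s.d) (i : Fin s.d) :
    Measurable fun θ => s.roundNoise g θ i := by
  unfold roundNoise
  refine Measurable.const_mul (Finset.measurable_sum _ fun k _ => ?_) _
  exact (measurable_roundErr _).comp
    ((measurable_pi_apply i).comp (measurable_pi_apply k))

theorem measurable_side (g : Fin s.K → E s.d) : Measurable (side g) :=
  measurable_pi_iff.2 fun i =>
    ((measurable_roundNoise g i).const_add (s.mean₁ g i)).const_mul (1 / (s.m : ℝ))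

theorem measurable_rotatedSide (g : Fin s.K → E s.d) : Measurable (rotatedSide g) :=
  measurable_rotation_mulVec measurable_fst ((measurable_side g).comp measurable_snd)

theorem measurable_rotated (k : Fin s.K) (g : Fin s.K → E s.d) :
    Measurable fun e : (Fin s.d → Bool) × (Fin s.K → Fin s.d → ℝ) => rotated k g e.1 :=
  measurable_rotation_mulVec measurable_fst measurable_const

theorem abs_roundNoise_le (hs : s.Admissible) {g : Fin s.K → E s.d} (hg : ∀ k, ‖g k‖ ≤ s.B)
    (θ : Fin s.K → Fin s.d → ℝ) (i : Fin s.d) : |s.roundNoise g θ i| ≤ s.B := by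
  have hm := hs.m_pos
  have hB := hs.B_pos
  rw [roundNoise, abs_mul, abs_of_nonneg (by positivity)]
  have h : |∑ k ∈ s.firstHalf, roundErr (s.gridPos (g k i)) (θ k i)| ≤ s.m := by
    refine (Finset.abs_sum_le_sum_abs _ _).trans ((Finset.sum_le_card_nsmul _ _ 1 fun k _ =>
      abs_roundErr_le (s.gridPos_nonneg hB (hg k) i) _).trans ?_)
    rw [s.card_firstHalf, nsmul_eq_mul, mul_one]
  calc _ ≤ s.B / (3 * s.m) * s.m := by gcongr
    _ = s.B / 3 := by field_simp
    _ ≤ s.B := by linarith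

theorem abs_side_le (hs : s.Admissible) {g : Fin s.K → E s.d} (hg : ∀ k, ‖g k‖ ≤ s.B)
    (θ : Fin s.K → Fin s.d → ℝ) (i : Fin s.d) : |side g θ i| ≤ 1 / s.m * (2 * s.B) := by
  have hm := hs.m_pos
  rw [side, abs_mul, abs_of_nonneg (by positivity)]
  gcongr
  have h1 : |s.mean₁ g i| ≤ s.B := by
    refine (abs_coord_le _ i).trans ?_
    rw [mean₁, ← s.card_firstHalf]
    exact norm_mean_le _ _ hs.B_pos.le hg
  have := abs_add_le (s.mean₁ g i) (s.roundNoise g θ i)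
  linarith [abs_roundNoise_le hs hg θ i]

theorem abs_rotatedSide_le (hs : s.Admissible) {g : Fin s.K → E s.d} (hg : ∀ k, ‖g k‖ ≤ s.B)
    (e : (Fin s.d → Bool) × (Fin s.K → Fin s.d → ℝ)) (j : Fin s.d) :
    |rotatedSide g e j| ≤ 2 ^ s.n * (1 / s.m * (2 * s.B)) :=
  abs_rotation_mulVec_le _ (abs_side_le hs hg e.2) j

theorem integral_exp_roundNoise_le (hs : s.Admissible) {g : Fin s.K → E s.d}
    (hg : ∀ k, ‖g k‖ ≤ s.B) (hd : (2 : ℝ) ^ s.n ≤ 2 * s.m) (ε : Fin s.d → Bool) (t : ℝ)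
    (j : Fin s.d) :
    ∫ θ, Real.exp (t * (rotation s.n ε *ᵥ fun i => 1 / s.m * s.roundNoise g θ i) j)
        ∂(Measure.pi fun _ => Measure.pi fun _ => cond volume (Set.Icc (0 : ℝ) 1))
      ≤ Real.exp (t ^ 2 * s.B ^ 2 / (2 * (s.m ^ 2 * 2 ^ s.n))) := by
  have hm := hs.m_pos
  have hpos := fun k => s.gridPos_nonneg hs.B_pos (hg k)
  let c : Fin s.d → ℝ := fun i => t * (rotation s.n ε j i * (s.B / (3 * s.m ^ 2)))
  have h := integral_exp_sum_nested_le (ν := cond volume (Set.Icc (0 : ℝ) 1)) s.firstHalf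
    (φ := fun k i w => c i * roundErr (s.gridPos (g k i)) w) (c := fun _ i => c i ^ 2 / 8)
    (fun k i => integral_exp_roundErr_le (hpos k i) (c i))
  have hrew : ∀ θ : Fin s.K → Fin s.d → ℝ,
      t * (rotation s.n ε *ᵥ fun i => 1 / s.m * s.roundNoise g θ i) j
        = ∑ k ∈ s.firstHalf, ∑ i, c i * roundErr (s.gridPos (g k i)) (θ k i) := fun θ => by
    rw [Finset.sum_comm, Matrix.mulVec, dotProduct, Finset.mul_sum]
    refine Finset.sum_congr rfl fun i _ => ?_
    rw [← Finset.mul_sum, roundNoise]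
    simp only [c]
    field_simp
  simp only [hrew]
  refine h.trans (Real.exp_le_exp.2 ?_)
  have hc : ∀ i, c i ^ 2 = t ^ 2 * (s.B / (3 * s.m ^ 2)) ^ 2 / 2 ^ s.n := fun i => by
    simp only [c]
    rw [mul_pow, mul_pow, rotation_sq]
    ring
  simp only [hc, Finset.sum_const, Finset.card_univ, Fintype.card_fin, nsmul_eq_mul,
    s.card_firstHalf, d]
  push_cast
  have e1 : (s.m : ℝ) * (2 ^ s.n * (t ^ 2 * (s.B / (3 * s.m ^ 2)) ^ 2 / 2 ^ s.n / 8))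
      = t ^ 2 * s.B ^ 2 / (2 * (s.m ^ 2 * 2 ^ s.n)) * (2 ^ s.n / (36 * s.m)) := by
    field_simp
    ring
  rw [e1]
  refine mul_le_of_le_one_right (by positivity) ?_
  rw [div_le_one (by positivity)]
  linarith

theorem integrable_signs {f : (Fin s.d → Bool) → ℝ} :
    Integrable f (PMF.uniformOfFintype (Fin s.d → Bool)).toMeasure :=
  Integrable.of_finite

theorem integrable_exp_rotatedSide (hs : s.Admissible) {g : Fin s.K → E s.d}
    (hg : ∀ k, ‖g k‖ ≤ s.B) (t : ℝ) (j : Fin s.d) :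
    Integrable (fun e => Real.exp (t * rotatedSide g e j)) s.signRoundLaw := by
  refine integrable_of_bdd (C := Real.exp (|t| * (2 ^ s.n * (1 / s.m * (2 * s.B))))) ?_ ?_
  · exact (Real.measurable_exp.comp
      ((measurable_pi_iff.1 (measurable_rotatedSide g) j).const_mul t)).aestronglyMeasurable
  · intro e
    rw [Real.norm_of_nonneg (Real.exp_pos _).le]
    refine Real.exp_le_exp.2 ((le_abs_self _).trans ?_)
    rw [abs_mul]
    gcongr
    exact abs_rotatedSide_le hs hg e j

/-- The rounding noise does not spoil the evenness of the rotated side information: its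
coordinates are independent and, as `d ≤ K`, of variance at most `B²/d`. -/
theorem integral_exp_rotatedSide_le (hs : s.Admissible) {g : Fin s.K → E s.d}
    (hg : ∀ k, ‖g k‖ ≤ s.B) (hd : (2 : ℝ) ^ s.n ≤ 2 * s.m) (t : ℝ) (j : Fin s.d) :
    ∫ e, Real.exp (t * rotatedSide g e j) ∂s.signRoundLaw
      ≤ Real.exp (t ^ 2 * s.B ^ 2 / (s.m ^ 2 * 2 ^ s.n)) := by
  have hm := hs.m_pos
  have hint := integrable_exp_rotatedSide hs hg t j
  unfold signRoundLaw at hint ⊢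
  rw [integral_prod _ hint]
  set c : ℝ := t ^ 2 * s.B ^ 2 / (2 * (s.m ^ 2 * 2 ^ s.n)) with hc
  have hinner : ∀ ε : Fin s.d → Bool,
      ∫ θ, Real.exp (t * rotatedSide g (ε, θ) j)
        ∂(Measure.pi fun _ => Measure.pi fun _ => cond volume (Set.Icc (0 : ℝ) 1))
      ≤ Real.exp (t * (rotation s.n ε *ᵥ fun i => 1 / s.m * s.mean₁ g i) j) * Real.exp c := by
    intro ε
    have hsplit : ∀ θ, Real.exp (t * rotatedSide g (ε, θ) j)
        = Real.exp (t * (rotation s.n ε *ᵥ fun i => 1 / s.m * s.mean₁ g i) j)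
          * Real.exp (t * (rotation s.n ε *ᵥ fun i => 1 / s.m * s.roundNoise g θ i) j) := by
      intro θ
      rw [← Real.exp_add, ← mul_add]
      congr 2
      rw [← Pi.add_apply, ← Matrix.mulVec_add]
      have : side g θ = (fun i => 1 / (s.m : ℝ) * s.mean₁ g i)
          + fun i => 1 / (s.m : ℝ) * s.roundNoise g θ i := by
        funext i
        rw [side, mul_add, Pi.add_apply]
      rw [rotatedSide, this]
    simp only [hsplit]
    rw [integral_const_mul]
    gcongr
    exact integral_exp_roundNoise_le hs hg hd ε t j
  refine (integral_mono integrable_signs integrable_signs hinner).trans ?_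
  rw [integral_mul_const]
  have h1 := integral_exp_rotation_le s.n (fun i => 1 / s.m * s.mean₁ g i) t j
  have h2 : ∑ i, (1 / s.m * s.mean₁ g i) ^ 2 ≤ s.B ^ 2 / s.m ^ 2 := by
    simp only [mul_pow, ← Finset.mul_sum]
    have h3 := sum_sq_coord (s.mean₁ g)
    have h4 : ‖s.mean₁ g‖ ≤ s.B := by
      rw [mean₁, ← s.card_firstHalf]
      exact norm_mean_le _ _ hs.B_pos.le hg
    rw [h3]
    calc _ ≤ (1 / (s.m : ℝ)) ^ 2 * s.B ^ 2 := by gcongr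
      _ = _ := by ring
  calc _ ≤ Real.exp c * Real.exp c := by
        gcongr
        refine h1.trans (Real.exp_le_exp.2 ?_)
        calc _ ≤ t ^ 2 * (s.B ^ 2 / s.m ^ 2) / (2 * 2 ^ s.n) := by gcongr
          _ = c := by rw [hc]; field_simp
    _ = _ := by
      rw [← Real.exp_add, hc]
      congr 1
      field_simp
      norm_num

/-! ### Overflow of the dithered quantizer -/

theorem measurable_excess (M : ℝ) : Measurable (excess M) := by
  unfold excess clip
  fun_prop

theorem abs_excess_le {M : ℝ} (hM : 0 ≤ M) (y : ℝ) : |excess M y| ≤ 2 * |y| := by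
  have h0 : clip M 0 = 0 := by
    rw [clip, min_eq_left hM, max_eq_right (by linarith)]
  have h := abs_clip_sub_clip_le M y 0
  rw [h0, sub_zero, sub_zero] at h
  rw [excess]
  have := abs_sub y (clip M y)
  linarith

/-- Bound for the second moment of the excess of one coordinate. -/
def excessBound (s : WZ) (l : ℝ) : ℝ :=
  4 / l ^ 2 * Real.exp (l ^ 2 * s.B ^ 2 / (s.m ^ 2 * 2 ^ s.n) - l * s.M)

theorem integral_excess_sq_le {α : Type*} [MeasurableSpace α] {ν : Measure α}
    [IsProbabilityMeasure ν] (hM : 0 ≤ s.M) {Y : α → ℝ} {l : ℝ} (hl : 0 < l)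
    (hint : ∀ t, Integrable (fun a => Real.exp (t * Y a)) ν)
    (hexp : ∀ t, ∫ a, Real.exp (t * Y a) ∂ν
      ≤ Real.exp (t ^ 2 * s.B ^ 2 / (s.m ^ 2 * 2 ^ s.n))) :
    ∫ a, excess s.M (Y a) ^ 2 ∂ν ≤ excessBound s l := by
  have h1 : ∫ a, excess s.M (Y a) ^ 2 ∂ν ≤ ∫ a, 2 / l ^ 2 * Real.exp (-(l * s.M)) *
      (Real.exp (l * Y a) + Real.exp (-l * Y a)) ∂ν :=
    integral_mono_of_nonneg (ae_of_all _ fun a => sq_nonneg _)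
      (((hint l).add (hint (-l))).const_mul _) (ae_of_all _ fun a => excess_sq_le hM hl _)
  refine h1.trans ?_
  rw [integral_const_mul, integral_add (hint l) (hint (-l))]
  have h2 := hexp l
  have h3 := hexp (-l)
  rw [neg_sq] at h3
  calc _ ≤ 2 / l ^ 2 * Real.exp (-(l * s.M)) *
        (Real.exp (l ^ 2 * s.B ^ 2 / (s.m ^ 2 * 2 ^ s.n))
          + Real.exp (l ^ 2 * s.B ^ 2 / (s.m ^ 2 * 2 ^ s.n))) := by gcongr
    _ = _ := by
      rw [excessBound, sub_eq_add_neg, Real.exp_add]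
      ring

/-- Sum over the second half of the clients of the overflow errors of coordinate `j`. -/
def overflow (g : Fin s.K → E s.d) (e : (Fin s.d → Bool) × (Fin s.K → Fin s.d → ℝ))
    (j : Fin s.d) : ℝ :=
  ∑ k ∈ s.secondHalf, (excess s.M (rotated k g e.1 j) - excess s.M (rotatedSide g e j))

theorem integrable_signRound_of_bdd {f : (Fin s.d → Bool) × (Fin s.K → Fin s.d → ℝ) → ℝ}
    (hf : Measurable f) {C : ℝ} (hC : ∀ e, |f e| ≤ C) : Integrable f s.signRoundLaw :=
  integrable_of_bdd hf.aestronglyMeasurable hC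

theorem abs_rotated_le (hs : s.Admissible) {g : Fin s.K → E s.d} (hg : ∀ k, ‖g k‖ ≤ s.B)
    (k : Fin s.K) (ε : Fin s.d → Bool) (j : Fin s.d) :
    |rotated k g ε j| ≤ 2 ^ s.n * (1 / s.m * (2 * s.B)) := by
  refine abs_rotation_mulVec_le _ (fun i => ?_) j
  have hm := hs.m_pos
  have h : s.scaled (g k) i = 1 / s.m * g k i := by
    rw [scaled, s.cast_K hs.even]; field_simp
  rw [h, abs_mul, abs_of_nonneg (by positivity)]
  gcongr
  linarith [(abs_coord_le (g k) i).trans (hg k), hs.B_pos]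

theorem measurable_overflow (g : Fin s.K → E s.d) (j : Fin s.d) :
    Measurable fun e => overflow g e j := by
  unfold overflow
  refine Finset.measurable_sum _ fun k _ => ?_
  exact ((measurable_excess _).comp (measurable_pi_iff.1 (measurable_rotated k g) j)).sub
    ((measurable_excess _).comp (measurable_pi_iff.1 (measurable_rotatedSide g) j))

theorem abs_overflow_le (hs : s.Admissible) {g : Fin s.K → E s.d} (hg : ∀ k, ‖g k‖ ≤ s.B)
    (e : (Fin s.d → Bool) × (Fin s.K → Fin s.d → ℝ)) (j : Fin s.d) :
    |overflow g e j| ≤ s.m * (4 * (2 ^ s.n * (1 / s.m * (2 * s.B)))) := by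
  rw [overflow]
  refine (Finset.abs_sum_le_sum_abs _ _).trans ((Finset.sum_le_card_nsmul _ _ _
    fun k _ => ?_).trans (by rw [s.card_secondHalf hs.even, nsmul_eq_mul]))
  have h1 := abs_excess_le hs.M_pos.le (rotated k g e.1 j)
  have h2 := abs_excess_le hs.M_pos.le (rotatedSide g e j)
  have h3 := abs_rotated_le hs hg k e.1 j
  have h4 := abs_rotatedSide_le hs hg e j
  have h5 := abs_sub (excess s.M (rotated k g e.1 j)) (excess s.M (rotatedSide g e j))
  linarith

theorem integrable_overflow_sq (hs : s.Admissible) {g : Fin s.K → E s.d}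
    (hg : ∀ k, ‖g k‖ ≤ s.B) (j : Fin s.d) :
    Integrable (fun e => overflow g e j ^ 2) s.signRoundLaw := by
  refine integrable_signRound_of_bdd ((measurable_overflow g j).pow_const 2)
    (C := (s.m * (4 * (2 ^ s.n * (1 / s.m * (2 * s.B))))) ^ 2) fun e => ?_
  rw [abs_pow]
  exact pow_le_pow_left₀ (abs_nonneg _) (abs_overflow_le hs hg e j) 2

/-- The overflow has a small second moment since all the rotated vectors, the side information
included, have subgaussian coordinates. -/
theorem integral_overflow_sq_le (hs : s.Admissible) {g : Fin s.K → E s.d}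
    (hg : ∀ k, ‖g k‖ ≤ s.B) (hd : (2 : ℝ) ^ s.n ≤ 2 * s.m) {l : ℝ} (hl : 0 < l) (j : Fin s.d) :
    ∫ e, overflow g e j ^ 2 ∂s.signRoundLaw ≤ 4 * s.m ^ 2 * excessBound s l := by
  have hexpR : ∀ k t, Integrable (fun e : (Fin s.d → Bool) × (Fin s.K → Fin s.d → ℝ) =>
      Real.exp (t * rotated k g e.1 j)) s.signRoundLaw := fun k t =>
    Integrable.comp_fst (f := fun ε => Real.exp (t * rotated k g ε j)) integrable_signs _
  have hr : ∀ k, ∫ e, excess s.M (rotated k g e.1 j) ^ 2 ∂s.signRoundLaw ≤ excessBound s l :=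
    fun k => integral_excess_sq_le hs.M_pos.le hl (hexpR k) fun t => by
      unfold signRoundLaw
      rw [integral_fun_fst (fun ε => Real.exp (t * rotated k g ε j))]
      simpa using integral_exp_rotated_le hs hg k t j
  have hb : ∫ e, excess s.M (rotatedSide g e j) ^ 2 ∂s.signRoundLaw ≤ excessBound s l :=
    integral_excess_sq_le hs.M_pos.le hl (fun t => integrable_exp_rotatedSide hs hg t j)
      fun t => integral_exp_rotatedSide_le hs hg hd t j
  have hir : ∀ k, Integrable (fun e : (Fin s.d → Bool) × (Fin s.K → Fin s.d → ℝ) =>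
      excess s.M (rotated k g e.1 j) ^ 2) s.signRoundLaw := fun k =>
    Integrable.comp_fst (f := fun ε => excess s.M (rotated k g ε j) ^ 2) integrable_signs _
  have hib : Integrable (fun e => excess s.M (rotatedSide g e j) ^ 2) s.signRoundLaw := by
    refine integrable_signRound_of_bdd (((measurable_excess _).comp
      (measurable_pi_iff.1 (measurable_rotatedSide g) j)).pow_const 2)
      (C := (2 * (2 ^ s.n * (1 / s.m * (2 * s.B)))) ^ 2) fun e => ?_
    rw [abs_pow]
    refine pow_le_pow_left₀ (abs_nonneg _) ((abs_excess_le hs.M_pos.le _).trans ?_) 2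
    linarith [abs_rotatedSide_le hs hg e j]
  have hpt : ∀ e, overflow g e j ^ 2 ≤ s.m * ∑ k ∈ s.secondHalf,
      (2 * excess s.M (rotated k g e.1 j) ^ 2 + 2 * excess s.M (rotatedSide g e j) ^ 2) := by
    intro e
    rw [overflow]
    refine sq_sum_le_card_mul_sum_sq.trans ?_
    rw [s.card_secondHalf hs.even]
    gcongr with k _
    nlinarith [sq_nonneg (excess s.M (rotated k g e.1 j) + excess s.M (rotatedSide g e j))]
  have hi : Integrable (fun e => (s.m : ℝ) * ∑ k ∈ s.secondHalf,
      (2 * excess s.M (rotated k g e.1 j) ^ 2 + 2 * excess s.M (rotatedSide g e j) ^ 2))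
      s.signRoundLaw :=
    (integrable_finsetSum _ fun k _ => ((hir k).const_mul 2).add (hib.const_mul 2)).const_mul _
  refine (integral_mono (integrable_overflow_sq hs hg j) hi hpt).trans ?_
  have hik : ∀ k ∈ s.secondHalf, Integrable (fun e => 2 * excess s.M (rotated k g e.1 j) ^ 2
      + 2 * excess s.M (rotatedSide g e j) ^ 2) s.signRoundLaw := fun k _ =>
    ((hir k).const_mul 2).add (hib.const_mul 2)
  rw [integral_const_mul, integral_finsetSum _ hik]
  have hk : ∀ k ∈ s.secondHalf, ∫ e, (2 * excess s.M (rotated k g e.1 j) ^ 2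
      + 2 * excess s.M (rotatedSide g e j) ^ 2) ∂s.signRoundLaw ≤ 4 * excessBound s l := by
    intro k _
    rw [integral_add ((hir k).const_mul 2) (hib.const_mul 2), integral_const_mul,
      integral_const_mul]
    linarith [hr k]
  calc _ ≤ (s.m : ℝ) * (s.m * (4 * excessBound s l)) := by
        gcongr
        refine (Finset.sum_le_card_nsmul _ _ _ hk).trans ?_
        rw [s.card_secondHalf hs.even, nsmul_eq_mul]
    _ = _ := by ring


/-! ### Bias and variance of the noiseless estimate for fixed client vectors -/

/-- Estimate of the server when the channel noise vanishes. -/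
def noiseless (s : WZ) (g : Fin s.K → E s.d) (u : s.Coins) : E s.d :=
  s.decoder (s.channel (fun k => s.encoder k (g k) u) 0) u

/-- Rotated error of the noiseless estimate of the average of the second half of the clients. -/
def rotatedErr (s : WZ) (g : Fin s.K → E s.d) (u : s.Coins) (j : Fin s.d) : ℝ :=
  ∑ k ∈ s.secondHalf, (2 * s.M / s.I *
    ∑ i, stepDiff (rotated k g u.1 j) (rotatedSide g (u.1, u.2.1) j) (u.2.2 k i j)
      - (rotated k g u.1 j - rotatedSide g (u.1, u.2.1) j))

theorem scaled_eq (hs : s.Admissible) (g : E s.d) (i : Fin s.d) :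
    s.scaled g i = 1 / s.m * g i := by
  have hm := hs.m_pos
  rw [scaled, s.cast_K hs.even]
  field_simp

theorem count_sub_count (k : Fin s.K) (x y : Fin s.d → ℝ) (u : s.Coins) (j : Fin s.d) :
    (s.count k x u j : ℝ) - s.count k y u j = ∑ i, stepDiff (x j) (y j) (u.2.2 k i j) := by
  simp only [count, stepDiff, Finset.sum_sub_distrib, Nat.cast_sum]
  congr 1 <;> refine Finset.sum_congr rfl fun i _ => ?_ <;> split_ifs <;> simp

/-- The side information cancels, up to the quantization error. -/
theorem noiseless_sub_mean₂ (hs : s.Admissible) {g : Fin s.K → E s.d} (hg : ∀ k, ‖g k‖ ≤ s.B)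
    (u : s.Coins) :
    s.noiseless g u - s.mean₂ g
      = WithLp.toLp 2 ((rotation s.n u.1)⁻¹ *ᵥ s.rotatedErr g u) := by
  have hm := hs.m_pos
  have hS : s.exactSide g u = side g u.2.1 := funext fun i => exactSide_eq hs g u i
  have hF : s.rotatedErr g u = (2 * s.M / s.I) • (fun j => ∑ k ∈ s.secondHalf,
      ((s.quant₂ k (g k) u j : ℝ) - s.count k (rotation s.n u.1 *ᵥ s.exactSide g u) u j))
      - rotation s.n u.1 *ᵥ (fun i => s.mean₂ g i - s.m * side g u.2.1 i) := by
    have hsum : (fun i => s.mean₂ g i - s.m * side g u.2.1 i)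
        = ∑ k ∈ s.secondHalf, (s.scaled (g k) - side g u.2.1) := by
      funext i
      rw [Finset.sum_apply]
      simp only [Pi.sub_apply, scaled_eq hs, Finset.sum_sub_distrib, Finset.sum_const,
        s.card_secondHalf hs.even, nsmul_eq_mul, ← Finset.mul_sum]
      rw [mean₂, PiLp.smul_apply, smul_eq_mul, WithLp.ofLp_sum, Finset.sum_apply]
    rw [hsum, Matrix.mulVec_sum]
    funext j
    simp only [Pi.sub_apply, Pi.smul_apply, smul_eq_mul, Finset.sum_apply, Matrix.mulVec_sub,
      Finset.mul_sum, rotatedErr, hS]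
    rw [← Finset.sum_sub_distrib]
    refine Finset.sum_congr rfl fun k _ => ?_
    have := count_sub_count k (rotation s.n u.1 *ᵥ s.scaled (g k))
      (rotation s.n u.1 *ᵥ side g u.2.1) u j
    rw [quant₂, this, Finset.mul_sum]
    rfl
  rw [noiseless, s.decoder_zero_noise hs.even hs.K_pos (by rw [hs.v_eq]; norm_num) hs.I_pos hs.B_pos
    hs.P_pos hs.p_pos hs.p'_pos g hg, hF, Matrix.mulVec_sub, rotation_inv_mulVec,
    Matrix.mulVec_smul, s.cast_K hs.even, hS]
  ext i
  simp only [PiLp.sub_apply, Pi.add_apply, Pi.smul_apply, Pi.sub_apply, smul_eq_mul]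
  ring

theorem measurable_noiseless (g : Fin s.K → E s.d) : Measurable (s.noiseless g) :=
  s.measurable_decoder_channel measurable_const measurable_id measurable_const

theorem dither_rotatedErr (hs : s.Admissible) (g : Fin s.K → E s.d)
    (e : (Fin s.d → Bool) × (Fin s.K → Fin s.d → ℝ)) (j : Fin s.d) :
    (∫ U, s.rotatedErr g (e.1, e.2, U) j ∂s.ditherLaw = -overflow g e j) ∧
    (∫ U, s.rotatedErr g (e.1, e.2, U) j ^ 2 ∂s.ditherLaw
      ≤ 2 * s.M / s.I * ∑ k ∈ s.secondHalf, |rotated k g e.1 j - rotatedSide g e j|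
        + overflow g e j ^ 2) ∧
    MemLp (fun U => s.rotatedErr g (e.1, e.2, U) j) 2 s.ditherLaw :=
  dither_moments hs.M_pos hs.I_pos s.secondHalf (fun k => rotated k g e.1 j) (rotatedSide g e j) j

/-- Total rounding noise of the first phase. -/
theorem integral_sum_roundNoise_sq_le (hs : s.Admissible) {g : Fin s.K → E s.d}
    (hg : ∀ k, ‖g k‖ ≤ s.B) {σ : ℝ} (hσ : s.B ^ 2 * 2 ^ s.n ≤ σ ^ 2 * (2 * s.m)) :
    Integrable (fun e : (Fin s.d → Bool) × (Fin s.K → Fin s.d → ℝ) =>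
      ∑ i, s.roundNoise g e.2 i ^ 2) s.signRoundLaw ∧
    ∫ e, ∑ i, s.roundNoise g e.2 i ^ 2 ∂s.signRoundLaw ≤ σ ^ 2 / 18 := by
  have hm := hs.m_pos
  have hi : ∀ i, Integrable (fun e : (Fin s.d → Bool) × (Fin s.K → Fin s.d → ℝ) =>
      s.roundNoise g e.2 i ^ 2) s.signRoundLaw := fun i => by
    refine integrable_signRound_of_bdd (((measurable_roundNoise g i).comp
      measurable_snd).pow_const 2) (C := s.B ^ 2) fun e => ?_
    rw [abs_pow]
    exact pow_le_pow_left₀ (abs_nonneg _) (abs_roundNoise_le hs hg e.2 i) 2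
  refine ⟨integrable_finsetSum _ fun i _ => hi i, ?_⟩
  rw [integral_finsetSum _ fun i _ => hi i]
  have h1 : ∀ i ∈ Finset.univ, ∫ e : (Fin s.d → Bool) × (Fin s.K → Fin s.d → ℝ),
      s.roundNoise g e.2 i ^ 2 ∂s.signRoundLaw ≤ s.B ^ 2 / (36 * s.m) := fun i _ => by
    unfold signRoundLaw
    rw [integral_fun_snd (fun θ => s.roundNoise g θ i ^ 2)]
    simpa using integral_roundNoise_sq_le hs hg i
  refine (Finset.sum_le_card_nsmul _ _ _ h1).trans ?_
  rw [Finset.card_univ, Fintype.card_fin, nsmul_eq_mul, d]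
  push_cast
  rw [mul_div_assoc', div_le_div_iff₀ (by positivity) (by norm_num)]
  nlinarith

theorem integrable_norm_noiseless_sub_sq (hs : s.Admissible) (g : Fin s.K → E s.d) (c : E s.d) :
    Integrable (fun u => ‖s.noiseless g u - c‖ ^ 2) s.coinLaw := by
  have := s.isProbabilityMeasure_coinLaw hs.M_pos
  obtain ⟨b, hb⟩ := s.exists_norm_decoder_le
  refine integrable_of_bdd (C := (b + ‖c‖) ^ 2) ?_ fun u => ?_
  · exact (((measurable_noiseless g).sub_const c).norm.pow_const 2).aestronglyMeasurable
  · rw [norm_pow, norm_norm]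
    gcongr
    exact (norm_sub_le _ _).trans (add_le_add_left (hb _ _) _)

theorem sqrt_le_amgm {t β : ℝ} (ht : 0 ≤ t) (hβ : 0 < β) : √t ≤ β / 2 + t / (2 * β) := by
  have h := Real.sq_sqrt ht
  have h1 : √t * (2 * β) ≤ (β / 2 + t / (2 * β)) * (2 * β) := by
    have : (β / 2 + t / (2 * β)) * (2 * β) = β ^ 2 + t := by field_simp
    rw [this]
    nlinarith [sq_nonneg (√t - β)]
  exact le_of_mul_le_mul_right h1 (by positivity)

/-- The distance between the vectors of the senders and the side information controls the
variance of the Wyner–Ziv quantizer. -/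
theorem sum_abs_rotated_sub_le (hs : s.Admissible) (g : Fin s.K → E s.d) (c : E s.d) {σ : ℝ}
    (hσ : 0 < σ) (k : Fin s.K) (e : (Fin s.d → Bool) × (Fin s.K → Fin s.d → ℝ)) :
    ∑ j, |rotated k g e.1 j - rotatedSide g e j| ≤ √((2 : ℝ) ^ s.n) * (1 / s.m * (σ / 2
      + 3 * (‖g k - c‖ ^ 2 + ‖s.mean₁ g - c‖ ^ 2 + ∑ i, s.roundNoise g e.2 i ^ 2) / (2 * σ))) := by
  have hm := hs.m_pos
  have h1 : ∀ j, rotated k g e.1 j - rotatedSide g e j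
      = (rotation s.n e.1 *ᵥ (s.scaled (g k) - side g e.2)) j := fun j => by
    rw [Matrix.mulVec_sub, Pi.sub_apply]; rfl
  simp only [h1]
  refine (sum_abs_rotation_le s.n e.1 _).trans ?_
  gcongr
  have h2 : ∑ j, (s.scaled (g k) - side g e.2) j ^ 2
      = (1 / (s.m : ℝ)) ^ 2 * ∑ j, (g k j - s.mean₁ g j - s.roundNoise g e.2 j) ^ 2 := by
    rw [Finset.mul_sum]
    refine Finset.sum_congr rfl fun j _ => ?_
    rw [Pi.sub_apply, scaled_eq hs, side]
    ring
  rw [h2, Real.sqrt_mul (by positivity), Real.sqrt_sq (by positivity)]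
  gcongr
  refine (sqrt_le_amgm (Finset.sum_nonneg fun j _ => sq_nonneg _) hσ).trans ?_
  gcongr
  rw [← sum_sq_coord, ← sum_sq_coord, ← Finset.sum_add_distrib, ← Finset.sum_add_distrib,
    Finset.mul_sum]
  refine Finset.sum_le_sum fun j _ => ?_
  rw [PiLp.sub_apply, PiLp.sub_apply]
  nlinarith [sq_nonneg ((g k j - c j) + (s.mean₁ g j - c j)),
    sq_nonneg ((g k j - c j) + s.roundNoise g e.2 j),
    sq_nonneg ((s.mean₁ g j - c j) - s.roundNoise g e.2 j)]

theorem norm_noiseless_sub_sq (hs : s.Admissible) {g : Fin s.K → E s.d} (hg : ∀ k, ‖g k‖ ≤ s.B)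
    (u : s.Coins) : ‖s.noiseless g u - s.mean₂ g‖ ^ 2 = ∑ j, s.rotatedErr g u j ^ 2 := by
  rw [noiseless_sub_mean₂ hs hg, ← sum_sq_coord]
  exact sum_sq_rotation_inv _ _ _

/-- Mean square error of the noiseless estimate, as an estimate of the average of the second half
of the clients, in terms of the distances of the vectors of the clients to an arbitrary `c`. -/
theorem integral_noiseless_sub_sq_le (hs : s.Admissible) {g : Fin s.K → E s.d}
    (hg : ∀ k, ‖g k‖ ≤ s.B) (hd : (2 : ℝ) ^ s.n ≤ 2 * s.m) {σ : ℝ} (hσ0 : 0 < σ)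
    (hσ : s.B ^ 2 * 2 ^ s.n ≤ σ ^ 2 * (2 * s.m))
    (hMI : s.M / s.I ≤ s.B / (2 * s.m * √((2 : ℝ) ^ s.n))) {l : ℝ} (hl : 0 < l) (c : E s.d) :
    ∫ u, ‖s.noiseless g u - s.mean₂ g‖ ^ 2 ∂s.coinLaw
      ≤ s.B / s.m * (1 / s.m * ∑ k ∈ s.secondHalf,
          (σ + 2 * (‖g k - c‖ ^ 2 + ‖s.mean₁ g - c‖ ^ 2) / σ))
        + 2 ^ s.n * (4 * s.m ^ 2 * excessBound s l) := by
  have hm := hs.m_pos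
  have hB := hs.B_pos
  have hM := hs.M_pos
  have hI : (0 : ℝ) < s.I := by exact_mod_cast hs.I_pos
  have hdpos : 0 < √((2 : ℝ) ^ s.n) := by positivity
  obtain ⟨hNi, hN⟩ := integral_sum_roundNoise_sq_le hs hg hσ
  obtain ⟨hi, heq⟩ := s.integral_coinLaw hs.M_pos
    (integrable_norm_noiseless_sub_sq hs g (s.mean₂ g))
  rw [heq]
  let N : (Fin s.d → Bool) × (Fin s.K → Fin s.d → ℝ) → ℝ := fun e =>
    ∑ i, s.roundNoise g e.2 i ^ 2
  have hpt : ∀ e : (Fin s.d → Bool) × (Fin s.K → Fin s.d → ℝ),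
      ∫ U, ‖s.noiseless g (e.1, e.2, U) - s.mean₂ g‖ ^ 2 ∂s.ditherLaw
        ≤ s.B / s.m * (1 / s.m * ∑ k ∈ s.secondHalf,
          (σ / 2 + 3 * (‖g k - c‖ ^ 2 + ‖s.mean₁ g - c‖ ^ 2 + N e) / (2 * σ)))
          + ∑ j, overflow g e j ^ 2 := by
    intro e
    simp only [norm_noiseless_sub_sq hs hg]
    rw [integral_finsetSum _ fun j _ => (dither_rotatedErr hs g e j).2.2.integrable_sq]
    refine (Finset.sum_le_sum fun j _ => (dither_rotatedErr hs g e j).2.1).trans ?_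
    rw [Finset.sum_add_distrib, ← Finset.mul_sum, Finset.sum_comm]
    refine add_le_add_left ?_ _
    calc _ ≤ 2 * (s.B / (2 * s.m * √((2 : ℝ) ^ s.n))) * ∑ k ∈ s.secondHalf,
          √((2 : ℝ) ^ s.n) * (1 / s.m * (σ / 2
            + 3 * (‖g k - c‖ ^ 2 + ‖s.mean₁ g - c‖ ^ 2 + N e) / (2 * σ))) := by
          rw [mul_div_assoc]
          gcongr with k _
          exact sum_abs_rotated_sub_le hs g c hσ0 k e
      _ = _ := by
          rw [← Finset.mul_sum, ← Finset.mul_sum]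
          field_simp
  have hWi : Integrable (fun e => ∑ j, overflow g e j ^ 2) s.signRoundLaw :=
    integrable_finsetSum _ fun j _ => integrable_overflow_sq hs hg j
  have hKi : ∀ k ∈ s.secondHalf, Integrable (fun e =>
      σ / 2 + 3 * (‖g k - c‖ ^ 2 + ‖s.mean₁ g - c‖ ^ 2 + N e) / (2 * σ)) s.signRoundLaw :=
    fun k _ => (integrable_const _).add ((((integrable_const _).add hNi).const_mul 3).div_const _)
  have hφi := (((integrable_finsetSum _ hKi).const_mul (1 / (s.m : ℝ))).const_mul
    (s.B / s.m))
  refine (integral_mono hi (hφi.add hWi) hpt).trans ?_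
  simp only [Pi.add_apply]
  rw [integral_add hφi hWi, integral_const_mul, integral_const_mul, integral_finsetSum _ hKi,
    integral_finsetSum _ fun j _ => integrable_overflow_sq hs hg j]
  refine add_le_add ?_ ?_
  · gcongr with k _
    have hA : Integrable (fun e => ‖g k - c‖ ^ 2 + ‖s.mean₁ g - c‖ ^ 2 + N e) s.signRoundLaw :=
      (integrable_const _).add hNi
    have hA' : Integrable (fun e => 3 * (‖g k - c‖ ^ 2 + ‖s.mean₁ g - c‖ ^ 2 + N e) / (2 * σ))
      s.signRoundLaw := (hA.const_mul 3).div_const _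
    rw [integral_add (integrable_const _) hA', integral_div (2 * σ), integral_const_mul,
      integral_add (integrable_const _) hNi]
    simp only [integral_const, probReal_univ, one_smul]
    have h3 : 3 * (‖g k - c‖ ^ 2 + ‖s.mean₁ g - c‖ ^ 2 + ∫ e, N e ∂s.signRoundLaw) / (2 * σ)
        ≤ 3 * (‖g k - c‖ ^ 2 + ‖s.mean₁ g - c‖ ^ 2 + σ ^ 2 / 18) / (2 * σ) := by
      gcongr
    have h4 : 3 * (‖g k - c‖ ^ 2 + ‖s.mean₁ g - c‖ ^ 2 + σ ^ 2 / 18) / (2 * σ)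
        = 3 / 4 * (2 * (‖g k - c‖ ^ 2 + ‖s.mean₁ g - c‖ ^ 2) / σ) + σ / 12 := by
      field_simp
      ring
    have h5 : 0 ≤ 2 * (‖g k - c‖ ^ 2 + ‖s.mean₁ g - c‖ ^ 2) / σ := by positivity
    linarith
  · refine (Finset.sum_le_card_nsmul _ _ _ fun j _ =>
      integral_overflow_sq_le hs hg hd hl j).trans (le_of_eq ?_)
    rw [Finset.card_univ, Fintype.card_fin, nsmul_eq_mul, d]
    push_cast
    ring

/-- Overflow of the dithered quantizer is the only source of bias. -/
theorem abs_integral_inner_noiseless_le (hs : s.Admissible) {g : Fin s.K → E s.d}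
    (hg : ∀ k, ‖g k‖ ≤ s.B) (hd : (2 : ℝ) ^ s.n ≤ 2 * s.m) {β : ℝ} (hβ : 0 < β) {l : ℝ}
    (hl : 0 < l) (h : E s.d) :
    |∫ u, inner ℝ (s.noiseless g u - s.mean₂ g) h ∂s.coinLaw|
      ≤ (β / 2 + 2 ^ s.n * (4 * s.m ^ 2 * excessBound s l) / (2 * β)) * ‖h‖ := by
  have := s.isProbabilityMeasure_coinLaw hs.M_pos
  have hinner : ∀ u, inner ℝ (s.noiseless g u - s.mean₂ g) h
      = ∑ j, s.rotatedErr g u j * (rotation s.n u.1 *ᵥ h) j := fun u => by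
    rw [noiseless_sub_mean₂ hs hg]
    have := rotation_inv_dotProduct s.n u.1 (s.rotatedErr g u) h
    simp only [dotProduct] at this
    rw [← this, PiLp.inner_apply]
    refine Finset.sum_congr rfl fun j _ => ?_
    simp [mul_comm]
  have hint : Integrable (fun u => inner ℝ (s.noiseless g u - s.mean₂ g) h) s.coinLaw := by
    obtain ⟨b, hb⟩ := s.exists_norm_decoder_le
    refine integrable_of_bdd (C := (b + ‖s.mean₂ g‖) * ‖h‖) ?_ fun u => ?_
    · exact (((measurable_noiseless g).sub_const _).inner measurable_const).aestronglyMeasurable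
    · refine (norm_inner_le_norm _ _).trans ?_
      gcongr
      exact (norm_sub_le _ _).trans (add_le_add_left (hb _ _) _)
  obtain ⟨-, heq⟩ := s.integral_coinLaw hs.M_pos hint
  rw [heq]
  have hU : ∀ e : (Fin s.d → Bool) × (Fin s.K → Fin s.d → ℝ),
      ∫ U, inner ℝ (s.noiseless g (e.1, e.2, U) - s.mean₂ g) h ∂s.ditherLaw
        = -∑ j, overflow g e j * (rotation s.n e.1 *ᵥ h) j := fun e => by
    have := s.isProbabilityMeasure_ditherLaw hs.M_pos
    simp only [hinner]
    rw [integral_finsetSum _ fun j _ =>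
      ((dither_rotatedErr hs g e j).2.2.integrable (by norm_num)).mul_const _,
      ← Finset.sum_neg_distrib]
    refine Finset.sum_congr rfl fun j _ => ?_
    rw [integral_mul_const, (dither_rotatedErr hs g e j).1, neg_mul]
  simp only [hU]
  have hWi : Integrable (fun e => ∑ j, overflow g e j ^ 2) s.signRoundLaw :=
    integrable_finsetSum _ fun j _ => integrable_overflow_sq hs hg j
  have hbound : ∀ e : (Fin s.d → Bool) × (Fin s.K → Fin s.d → ℝ),
      ‖-∑ j, overflow g e j * (rotation s.n e.1 *ᵥ h) j‖
        ≤ (β / 2 + (∑ j, overflow g e j ^ 2) / (2 * β)) * ‖h‖ := fun e => by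
    rw [norm_neg, Real.norm_eq_abs]
    have hcs := Finset.sum_mul_sq_le_sq_mul_sq Finset.univ (fun j => overflow g e j)
      (fun j => (rotation s.n e.1 *ᵥ h) j)
    rw [sum_sq_rotation, sum_sq_coord] at hcs
    refine (Real.abs_le_sqrt hcs).trans ?_
    have hW0 : 0 ≤ ∑ j, overflow g e j ^ 2 := Finset.sum_nonneg fun j _ => sq_nonneg _
    rw [Real.sqrt_mul hW0, Real.sqrt_sq (norm_nonneg _)]
    gcongr
    exact sqrt_le_amgm hW0 hβ
  rw [← Real.norm_eq_abs]
  refine (norm_integral_le_of_norm_le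
    (((integrable_const _).add (hWi.div_const _)).mul_const _) (ae_of_all _ hbound)).trans ?_
  simp only [Pi.add_apply]
  rw [integral_mul_const, integral_add (integrable_const _) (hWi.div_const _), integral_div (2 * β),
    integral_finsetSum _ fun j _ => integrable_overflow_sq hs hg j]
  simp only [integral_const, probReal_univ, one_smul]
  gcongr
  refine (Finset.sum_le_card_nsmul _ _ _ fun j _ =>
    integral_overflow_sq_le hs hg hd hl j).trans (le_of_eq ?_)
  rw [Finset.card_univ, Fintype.card_fin, nsmul_eq_mul, d]
  push_cast
  ring

end WZ

/-! ### Projected stochastic gradient descent with biased estimates -/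

/-- Resampling one coordinate of a product measure. -/
theorem measurePreserving_update {ι W : Type*} [Fintype ι] [DecidableEq ι] [MeasurableSpace W]
    (μ : Measure W) [IsProbabilityMeasure μ] (t : ι) :
    MeasurePreserving (fun p : (ι → W) × W => Function.update p.1 t p.2)
      ((Measure.pi fun _ => μ).prod μ) (Measure.pi fun _ => μ) := by
  have hmeas : Measurable fun p : (ι → W) × W => Function.update p.1 t p.2 := by
    refine measurable_pi_iff.2 fun i => ?_
    by_cases h : i = t
    · subst h
      simpa using measurable_snd
    · simp only [Function.update_of_ne h]
      exact (measurable_pi_apply i).comp measurable_fst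
  refine ⟨hmeas, (Measure.pi_eq fun S hS => ?_).symm⟩
  rw [Measure.map_apply hmeas (MeasurableSet.univ_pi hS)]
  have hpre : (fun p : (ι → W) × W => Function.update p.1 t p.2) ⁻¹' (Set.univ.pi S)
      = (Set.univ.pi (Function.update S t Set.univ)) ×ˢ S t := by
    ext ⟨ω, w⟩
    simp only [Set.mem_preimage, Set.mem_pi, Set.mem_univ, true_implies, Set.mem_prod]
    constructor
    · intro h
      refine ⟨fun i => ?_, by simpa using h t⟩
      by_cases hi : i = t
      · subst hi; simp
      · simpa [Function.update_of_ne hi] using h i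
    · rintro ⟨h1, h2⟩ i
      by_cases hi : i = t
      · subst hi; simpa using h2
      · simpa [Function.update_of_ne hi] using h1 i
  rw [hpre, Measure.prod_prod, Measure.pi_pi,
    ← Finset.mul_prod_erase _ (fun i => μ (S i)) (Finset.mem_univ t),
    ← Finset.mul_prod_erase _ (fun i => μ (Function.update S t Set.univ i)) (Finset.mem_univ t)]
  rw [Function.update_self, measure_univ, one_mul, mul_comm]
  congr 1
  refine Finset.prod_congr rfl fun i hi => ?_
  rw [Function.update_of_ne (Finset.ne_of_mem_erase hi)]

section Projection

variable {d : ℕ} {X : Set (E d)}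

theorem inner_sub_proj_le (hconv : Convex ℝ X) (hcl : IsClosed X) (y : E d) {z : E d}
    (hz : z ∈ X) : inner ℝ (y - proj X y) (z - proj X y) ≤ 0 := by
  obtain ⟨h1, h2⟩ := proj_spec ⟨z, hz⟩ hcl y
  refine (norm_eq_iInf_iff_real_inner_le_zero hconv h1).1 ?_ z hz
  have : Nonempty X := ⟨⟨z, hz⟩⟩
  refine le_antisymm (le_ciInf fun w => h2 w w.2) ?_
  exact ciInf_le (f := fun w : X => ‖y - w‖) ⟨0, by rintro _ ⟨w, rfl⟩; exact norm_nonneg _⟩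
    ⟨_, h1⟩

theorem norm_proj_sub_proj_le (hconv : Convex ℝ X) (hcl : IsClosed X) (hne : X.Nonempty)
    (y z : E d) : ‖proj X y - proj X z‖ ≤ ‖y - z‖ := by
  have h1 := inner_sub_proj_le hconv hcl y (proj_spec hne hcl z).1
  have h2 := inner_sub_proj_le hconv hcl z (proj_spec hne hcl y).1
  set a := proj X y
  set b := proj X z
  have h3 : ‖a - b‖ ^ 2 ≤ inner ℝ (y - z) (a - b) := by
    rw [← real_inner_self_eq_norm_sq]
    have e1 : inner ℝ (y - z) (a - b) - inner ℝ (a - b) (a - b)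
        = -(inner ℝ (y - a) (b - a) + inner ℝ (z - b) (a - b)) := by
      simp only [inner_sub_left, inner_sub_right]
      ring
    linarith
  have h4 := real_inner_le_norm (y - z) (a - b)
  by_contra! h5
  have : 0 ≤ ‖y - z‖ := norm_nonneg _
  nlinarith

theorem measurable_proj (hconv : Convex ℝ X) (hcl : IsClosed X) (hne : X.Nonempty) :
    Measurable (proj X) :=
  (LipschitzWith.of_dist_le_mul (K := 1) fun y z => by
    rw [dist_eq_norm, dist_eq_norm, NNReal.coe_one, one_mul]
    exact norm_proj_sub_proj_le hconv hcl hne y z).continuous.measurable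

/-- One step of projected gradient descent with the inexact gradient `ψ`: the error `ψ - G` is
tested against a vector that does not depend on `ψ`, at the price of a quadratic term. -/
theorem psgd_step (hconv : Convex ℝ X) (hcl : IsClosed X) {f : E d → ℝ} {G : E d} {L η : ℝ}
    (hη : 0 < η) (hηL : η * L ≤ 1) {x z : E d} (hz : z ∈ X)
    (hlow : f x + inner ℝ G (z - x) ≤ f z)
    (hup : ∀ y ∈ X, f y - f x ≤ inner ℝ G (y - x) + L / 2 * ‖y - x‖ ^ 2) (ψ : E d) :
    f (proj X (x - η • ψ)) - f z
        - (‖x - z‖ ^ 2 - ‖proj X (x - η • ψ) - z‖ ^ 2) / (2 * η)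
      ≤ -inner ℝ (ψ - G) (proj X (x - η • G) - z) + η * ‖ψ - G‖ ^ 2 := by
  have hne : X.Nonempty := ⟨z, hz⟩
  have h1 := inner_sub_proj_le hconv hcl (x - η • ψ) hz
  have h2 := hup _ (proj_spec hne hcl (x - η • ψ)).1
  have h3 := norm_proj_sub_proj_le hconv hcl hne (x - η • ψ) (x - η • G)
  set y := proj X (x - η • ψ)
  set p := proj X (x - η • G)
  have h4 : ‖x - η • ψ - (x - η • G)‖ = η * ‖ψ - G‖ := by
    rw [show x - η • ψ - (x - η • G) = -(η • (ψ - G)) by rw [smul_sub]; abel, norm_neg, norm_smul,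
      Real.norm_of_nonneg hη.le]
  rw [h4] at h3
  have h5 : -inner ℝ (ψ - G) (y - p) ≤ η * ‖ψ - G‖ ^ 2 := by
    have := (neg_le_abs _).trans (abs_real_inner_le_norm (ψ - G) (y - p))
    calc _ ≤ ‖ψ - G‖ * ‖y - p‖ := this
      _ ≤ ‖ψ - G‖ * (η * ‖ψ - G‖) := by gcongr
      _ = _ := by ring
  have h6 : inner ℝ (x - η • ψ - y) (z - y)
      = η * inner ℝ ψ (y - z) + (‖x - y‖ ^ 2 + ‖y - z‖ ^ 2 - ‖x - z‖ ^ 2) / 2 := by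
    have e : x - z = (x - y) + (y - z) := by abel
    rw [e, norm_add_sq_real, show x - η • ψ - y = (x - y) - η • ψ by abel, inner_sub_left,
      inner_smul_left, show z - y = -(y - z) by abel, inner_neg_right, inner_neg_right]
    simp
    ring
  rw [h6] at h1
  have h7 : inner ℝ ψ (y - z) ≤ (‖x - z‖ ^ 2 - ‖y - z‖ ^ 2) / (2 * η) - ‖x - y‖ ^ 2 / (2 * η) := by
    rw [← sub_div, le_div_iff₀ (by positivity)]
    linarith
  have h8 : L / 2 * ‖y - x‖ ^ 2 ≤ ‖x - y‖ ^ 2 / (2 * η) := by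
    rw [norm_sub_rev y x, le_div_iff₀ (by positivity)]
    nlinarith [sq_nonneg ‖x - y‖]
  have h9 : inner ℝ G (y - x) = inner ℝ ψ (y - z) - inner ℝ (ψ - G) (y - p)
      - inner ℝ (ψ - G) (p - z) - inner ℝ G (x - z) := by
    simp only [inner_sub_left, inner_sub_right]
    ring
  have h10 : inner ℝ G (z - x) = -inner ℝ G (x - z) := by
    rw [← inner_neg_right, neg_sub]
  linarith

end Projection

section Iterates

variable {d T : ℕ} {W : Type*} {X : Set (E d)} {η : ℝ} {est : E d → W → E d} {x₀ : E d}

theorem psgd_zero (ω : Fin T → W) : psgd X η est x₀ ω 0 = x₀ := rfl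

theorem psgd_succ (ω : Fin T → W) (t : Fin T) : psgd X η est x₀ ω t.succ
    = proj X (psgd X η est x₀ ω t.castSucc - η • est (psgd X η est x₀ ω t.castSucc) (ω t)) :=
  Fin.induction_succ _ _ t

theorem psgd_mem (hcl : IsClosed X) (hx₀ : x₀ ∈ X) (ω : Fin T → W) (t : Fin (T + 1)) :
    psgd X η est x₀ ω t ∈ X := by
  induction t using Fin.induction with
  | zero => exact hx₀
  | succ t _ =>
    rw [psgd_succ]
    exact (proj_spec ⟨x₀, hx₀⟩ hcl _).1

/-- The iterate at time `t` is determined by the estimates of the rounds before `t`. -/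
theorem psgd_congr {est' : E d → W → E d} {ω ω' : Fin T → W} (t : Fin (T + 1))
    (h : ∀ i : Fin T, i.castSucc < t → ∀ x, est x (ω i) = est' x (ω' i)) :
    psgd X η est x₀ ω t = psgd X η est' x₀ ω' t := by
  induction t using Fin.induction with
  | zero => rw [psgd_zero, psgd_zero]
  | succ t ih =>
    rw [psgd_succ, psgd_succ, ih fun i hi => h i (hi.trans t.castSucc_lt_succ),
      h t t.castSucc_lt_succ]

theorem psgd_update (ω : Fin T → W) (t : Fin T) (w : W) :
    psgd X η est x₀ (Function.update ω t w) t.castSucc = psgd X η est x₀ ω t.castSucc := by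
  refine psgd_congr _ fun i hi x => ?_
  rw [Function.update_of_ne]
  rintro rfl
  exact lt_irrefl _ hi

theorem measurable_psgd [MeasurableSpace W] (hconv : Convex ℝ X) (hcl : IsClosed X)
    (hx₀ : x₀ ∈ X) (hest : Measurable (Function.uncurry est)) (t : Fin (T + 1)) :
    Measurable fun ω : Fin T → W => psgd X η est x₀ ω t := by
  induction t using Fin.induction with
  | zero => exact measurable_const
  | succ t ih =>
    simp only [psgd_succ]
    refine (measurable_proj hconv hcl ⟨x₀, hx₀⟩).comp (ih.sub (Measurable.const_smul ?_ η))
    exact hest.comp (ih.prodMk (measurable_pi_apply t))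

theorem psgdOutput_eq (ω : Fin T → W) : psgdOutput X η est x₀ ω
    = ∑ t : Fin T, (1 / (T : ℝ)) • psgd X η est x₀ ω t.succ := by
  rw [psgdOutput, Finset.smul_sum]

theorem psgdOutput_mem (hconv : Convex ℝ X) (hcl : IsClosed X) (hx₀ : x₀ ∈ X) (hT : 0 < T)
    (ω : Fin T → W) : psgdOutput X η est x₀ ω ∈ X := by
  rw [psgdOutput_eq]
  have hT' : (T : ℝ) ≠ 0 := by exact_mod_cast hT.ne'
  refine hconv.sum_mem (fun _ _ => by positivity) ?_ fun t _ => psgd_mem hcl hx₀ ω _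
  simp [hT']

theorem measurable_psgdOutput [MeasurableSpace W] (hconv : Convex ℝ X) (hcl : IsClosed X)
    (hx₀ : x₀ ∈ X) (hest : Measurable (Function.uncurry est)) :
    Measurable fun ω : Fin T → W => psgdOutput X η est x₀ ω := by
  simp only [psgdOutput_eq]
  exact Finset.measurable_sum _ fun t _ =>
    (measurable_psgd hconv hcl hx₀ hest _).const_smul (1 / (T : ℝ))

theorem measurable_comp_of_lipschitz {α : Type*} [MeasurableSpace α] {f : E d → ℝ} {B : ℝ}
    (hB : 0 ≤ B) (hf : ∀ x ∈ X, ∀ y ∈ X, |f x - f y| ≤ B * ‖x - y‖) {Y : α → E d}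
    (hY : Measurable Y) (hYX : ∀ a, Y a ∈ X) : Measurable fun a => f (Y a) := by
  have hL : LipschitzOnWith B.toNNReal f X := LipschitzOnWith.of_dist_le_mul fun x hx y hy => by
    rw [Real.dist_eq, dist_eq_norm, Real.coe_toNNReal _ hB]
    exact hf x hx y hy
  obtain ⟨F, hF, hFX⟩ := hL.extend_real
  have : (fun a => f (Y a)) = fun a => F (Y a) := funext fun a => hFX (hYX a)
  rw [this]
  exact hF.continuous.measurable.comp hY

theorem integral_le_of_forall_le {α : Type*} [MeasurableSpace α] {ν : Measure α}
    [IsProbabilityMeasure ν] {f : α → ℝ} {c : ℝ} (hf : Integrable f ν) (h : ∀ a, f a ≤ c) :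
    ∫ a, f a ∂ν ≤ c := by
  have := integral_mono hf (integrable_const c) h
  simpa using this

/-- Convergence of projected stochastic gradient descent with an estimate that is bounded, has
mean square error at most `V`, and whose bias tested against vectors of norm `D` is at most `b`. -/
theorem psgd_convergence [MeasurableSpace W] {μ : Measure W} [IsProbabilityMeasure μ]
    (hcl : IsClosed X) {D : ℝ} (hD : ∀ x ∈ X, ∀ y ∈ X, ‖x - y‖ ≤ D) (hx₀ : x₀ ∈ X)
    {f : E d → ℝ} {G : E d → E d} {L B V b : ℝ} (hf : ConvexOn ℝ X f) (hB : 0 ≤ B)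
    (hlip : ∀ x ∈ X, ∀ y ∈ X, |f x - f y| ≤ B * ‖x - y‖)
    (hlow : ∀ x ∈ X, ∀ y ∈ X, f x + inner ℝ (G x) (y - x) ≤ f y)
    (hup : ∀ x ∈ X, ∀ y ∈ X, f y - f x ≤ inner ℝ (G x) (y - x) + L / 2 * ‖y - x‖ ^ 2)
    (hest : Measurable (Function.uncurry est)) {c : ℝ} (hc : ∀ x w, ‖est x w‖ ≤ c)
    (hbias : ∀ x ∈ X, ∀ h : E d, ‖h‖ ≤ D → |∫ w, inner ℝ (est x w - G x) h ∂μ| ≤ b)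
    (hvar : ∀ x ∈ X, ∫ w, ‖est x w - G x‖ ^ 2 ∂μ ≤ V)
    (hη : 0 < η) (hηL : η * L ≤ 1) (hT : 0 < T) {z : E d} (hz : z ∈ X) :
    Integrable (fun ω => f (psgdOutput X η est x₀ ω)) (Measure.pi fun _ : Fin T => μ) ∧
    ∫ ω, f (psgdOutput X η est x₀ ω) ∂(Measure.pi fun _ : Fin T => μ)
      ≤ f z + D ^ 2 / (2 * η * T) + b + η * V := by
  have hconv := hf.1
  have hT' : (0 : ℝ) < T := by exact_mod_cast hT
  have hD0 : 0 ≤ D := (norm_nonneg _).trans (hD z hz z hz)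
  set ν : Measure (Fin T → W) := Measure.pi fun _ => μ
  let x : Fin (T + 1) → (Fin T → W) → E d := fun t ω => psgd X η est x₀ ω t
  have hxm : ∀ t, Measurable (x t) := measurable_psgd hconv hcl hx₀ hest
  have hxX : ∀ t ω, x t ω ∈ X := fun t ω => psgd_mem hcl hx₀ ω t
  have hfx : ∀ t, Measurable fun ω => f (x t ω) := fun t =>
    measurable_comp_of_lipschitz hB hlip (hxm t) (hxX t)
  have hfb : ∀ y ∈ X, |f y - f z| ≤ B * D := fun y hy =>
    (hlip y hy z hz).trans (mul_le_mul_of_nonneg_left (hD y hy z hz) hB)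
  have hfb' : ∀ y ∈ X, ‖f y‖ ≤ B * D + |f z| := fun y hy => by
    rw [Real.norm_eq_abs]
    have := abs_sub_abs_le_abs_sub (f y) (f z)
    linarith [hfb y hy]
  have hfi : ∀ t, Integrable (fun ω => f (x t ω)) ν := fun t =>
    integrable_of_bdd (hfx t).aestronglyMeasurable fun ω => hfb' _ (hxX t ω)
  have hout : Integrable (fun ω => f (psgdOutput X η est x₀ ω)) ν :=
    integrable_of_bdd (measurable_comp_of_lipschitz hB hlip
      (measurable_psgdOutput hconv hcl hx₀ hest)
      (psgdOutput_mem hconv hcl hx₀ hT)).aestronglyMeasurable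
      fun ω => hfb' _ (psgdOutput_mem hconv hcl hx₀ hT ω)
  refine ⟨hout, ?_⟩
  let a : Fin (T + 1) → (Fin T → W) → ℝ := fun t ω => ‖x t ω - z‖ ^ 2
  have ham : ∀ t, Measurable (a t) := fun t => ((hxm t).sub_const z).norm.pow_const 2
  have hab : ∀ t ω, ‖a t ω‖ ≤ D ^ 2 := fun t ω => by
    rw [norm_pow, norm_norm]
    exact pow_le_pow_left₀ (norm_nonneg _) (hD _ (hxX t ω) z hz) 2
  have hai : ∀ t, Integrable (a t) ν := fun t =>
    integrable_of_bdd (ham t).aestronglyMeasurable (hab t)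
  let Φ : Fin T → (Fin T → W) → ℝ := fun t ω =>
    f (x t.succ ω) - f z - (a t.castSucc ω - a t.succ ω) / (2 * η)
  have hΦi : ∀ t, Integrable (Φ t) ν := fun t =>
    ((hfi _).sub (integrable_const _)).sub (((hai _).sub (hai _)).div_const _)
  have hΦm : ∀ t, Measurable (Φ t) := fun t =>
    ((hfx _).sub_const _).sub (((ham _).sub (ham _)).div_const _)
  -- the round `t` is independent of the iterate at which it is queried
  have hΦ : ∀ t, ∫ ω, Φ t ω ∂ν ≤ b + η * V := by
    intro t
    have hmp := measurePreserving_update (ι := Fin T) μ t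
    have hi : Integrable (fun p : (Fin T → W) × W => Φ t (Function.update p.1 t p.2))
      ((Measure.pi fun _ => μ).prod μ) := hmp.integrable_comp_of_integrable (hΦi t)
    have h1 := integral_map hmp.measurable.aemeasurable (f := Φ t)
      (by rw [hmp.map_eq]; exact (hΦi t).aestronglyMeasurable)
    rw [hmp.map_eq] at h1
    rw [h1, integral_prod _ hi]
    refine integral_le_of_forall_le hi.integral_prod_left fun ω => ?_
    set y := psgd X η est x₀ ω t.castSucc with hy
    have hyX : y ∈ X := psgd_mem hcl hx₀ ω _
    have hpt : ∀ w, Φ t (Function.update ω t w)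
        ≤ -inner ℝ (est y w - G y) (proj X (y - η • G y) - z) + η * ‖est y w - G y‖ ^ 2 := by
      intro w
      have := psgd_step hconv hcl hη hηL (x := y) hz (hlow y hyX z hz) (hup y hyX) (est y w)
      simp only [Φ, a, x]
      rw [psgd_succ, psgd_update, Function.update_self]
      exact this
    have hem : Measurable fun w => est y w - G y :=
      (hest.comp (measurable_const.prodMk measurable_id)).sub_const _
    have heb : ∀ w, ‖est y w - G y‖ ≤ c + ‖G y‖ := fun w =>
      (norm_sub_le _ _).trans (add_le_add_left (hc y w) _)
    have hi1 : Integrable (fun w => inner ℝ (est y w - G y) (proj X (y - η • G y) - z)) μ := by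
      refine integrable_of_bdd (C := (c + ‖G y‖) * ‖proj X (y - η • G y) - z‖)
        (hem.inner measurable_const).aestronglyMeasurable fun w => ?_
      exact (norm_inner_le_norm _ _).trans (mul_le_mul_of_nonneg_right (heb w) (norm_nonneg _))
    have hi2 : Integrable (fun w => ‖est y w - G y‖ ^ 2) μ := by
      refine integrable_of_bdd (C := (c + ‖G y‖) ^ 2)
        (hem.norm.pow_const 2).aestronglyMeasurable fun w => ?_
      rw [norm_pow, norm_norm]
      exact pow_le_pow_left₀ (norm_nonneg _) (heb w) 2
    have hΦw : Integrable (fun w => Φ t (Function.update ω t w)) μ := by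
      refine integrable_of_bdd (C := B * D + (D ^ 2 + D ^ 2) / (2 * η)) ?_ fun w => ?_
      · exact ((hΦm t).comp (hmp.measurable.comp
          (measurable_const.prodMk measurable_id))).aestronglyMeasurable
      · simp only [Φ]
        refine (norm_sub_le _ _).trans (add_le_add (hfb _ (hxX _ _)) ?_)
        rw [norm_div, Real.norm_of_nonneg (by positivity : 0 ≤ 2 * η)]
        gcongr
        exact (norm_sub_le _ _).trans (add_le_add (hab _ _) (hab _ _))
    have hi3 : Integrable (fun w => -inner ℝ (est y w - G y) (proj X (y - η • G y) - z)) μ :=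
      hi1.neg
    refine (integral_mono hΦw (hi3.add (hi2.const_mul η)) hpt).trans ?_
    simp only [Pi.add_apply]
    rw [integral_add hi3 (hi2.const_mul η), integral_neg, integral_const_mul]
    have hp := (proj_spec ⟨z, hz⟩ hcl (y - η • G y)).1
    have h2 := hbias y hyX _ (hD _ hp z hz)
    have h3 := hvar y hyX
    have h4 := neg_le_of_abs_le h2
    have h5 := mul_le_mul_of_nonneg_left h3 hη.le
    linarith
  have hpt : ∀ ω, f (psgdOutput X η est x₀ ω)
      ≤ f z + D ^ 2 / (2 * η * T) + 1 / T * ∑ t, Φ t ω := by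
    intro ω
    have hJ : f (psgdOutput X η est x₀ ω) ≤ ∑ t : Fin T, (1 / (T : ℝ)) • f (x t.succ ω) := by
      rw [psgdOutput_eq]
      exact hf.map_sum_le (fun _ _ => by positivity) (by simp [hT'.ne'])
        fun t _ => hxX t.succ ω
    have htel : ∑ t : Fin T, (a t.castSucc ω - a t.succ ω) ≤ D ^ 2 := by
      have e1 := Fin.sum_univ_succ (fun t => a t ω)
      have e2 := Fin.sum_univ_castSucc (fun t => a t ω)
      have e3 := hab 0 ω
      rw [Real.norm_eq_abs] at e3
      have e4 : 0 ≤ a (Fin.last T) ω := sq_nonneg _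
      rw [Finset.sum_sub_distrib]
      linarith [le_abs_self (a 0 ω)]
    have hsum : ∑ t, Φ t ω = ∑ t : Fin T, f (x t.succ ω) - T * f z
        - (∑ t : Fin T, (a t.castSucc ω - a t.succ ω)) / (2 * η) := by
      simp only [Φ]
      rw [Finset.sum_sub_distrib, Finset.sum_sub_distrib, ← Finset.sum_div]
      simp
    rw [← Finset.smul_sum, smul_eq_mul] at hJ
    refine hJ.trans ?_
    have h6 : (∑ t : Fin T, (a t.castSucc ω - a t.succ ω)) / (2 * η) ≤ D ^ 2 / (2 * η) := by
      gcongr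
    have h7 : ∑ t : Fin T, f (x t.succ ω) ≤ ∑ t, Φ t ω + T * f z + D ^ 2 / (2 * η) := by
      linarith
    calc 1 / (T : ℝ) * ∑ t : Fin T, f (x t.succ ω)
        ≤ 1 / (T : ℝ) * (∑ t, Φ t ω + T * f z + D ^ 2 / (2 * η)) := by gcongr
      _ = _ := by field_simp; ring
  have hsi : Integrable (fun ω => ∑ t, Φ t ω) ν := integrable_finsetSum _ fun t _ => hΦi t
  refine (integral_mono hout ((integrable_const _).add (hsi.const_mul _)) hpt).trans ?_
  simp only [Pi.add_apply]
  rw [integral_add (integrable_const _) (hsi.const_mul _), integral_const_mul,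
    integral_finsetSum _ fun t _ => hΦi t]
  simp only [integral_const, probReal_univ, one_smul]
  have h8 : ∑ t, ∫ ω, Φ t ω ∂ν ≤ T * (b + η * V) := by
    refine (Finset.sum_le_card_nsmul _ _ _ fun t _ => hΦ t).trans ?_
    rw [Finset.card_univ, Fintype.card_fin, nsmul_eq_mul]
  have h9 : 1 / (T : ℝ) * ∑ t, ∫ ω, Φ t ω ∂ν ≤ b + η * V := by
    rw [one_div, inv_mul_le_iff₀ hT']
    exact h8
  linarith

end Iterates

/-! ### Consequences of membership in the oracle class -/

/-- A gradient within the domain of a convex function is a subgradient, also at boundary points. -/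
theorem inner_gradient_le {d : ℕ} {X : Set (E d)} {f : E d → ℝ} (hf : ConvexOn ℝ X f) {G x y : E d}
    (hx : x ∈ X) (hy : y ∈ X) (hG : HasGradientWithinAt f G X x) :
    f x + inner ℝ G (y - x) ≤ f y := by
  have hmaps : Set.MapsTo (AffineMap.lineMap (k := ℝ) x y) (Set.Icc 0 1) X := fun t ht =>
    hf.1.lineMap_mem hx hy ht
  have hline : HasDerivWithinAt (AffineMap.lineMap (k := ℝ) x y : ℝ → E d) (y - x)
      (Set.Icc 0 1) 0 := AffineMap.hasDerivWithinAt_lineMap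
  have h1 := hG.hasFDerivWithinAt.comp_hasDerivWithinAt_of_eq (0 : ℝ) hline hmaps (by simp)
  have hconv : ConvexOn ℝ (Set.Icc (0 : ℝ) 1) (f ∘ (AffineMap.lineMap (k := ℝ) x y)) :=
    (hf.comp_affineMap (AffineMap.lineMap (k := ℝ) x y)).subset hmaps (convex_Icc 0 1)
  have h2 := hconv.le_slope_of_hasDerivWithinAt (by simp) (by simp) one_pos h1
  simp only [slope_def_field, Function.comp_apply, AffineMap.lineMap_apply_one,
    AffineMap.lineMap_apply_zero, sub_zero, div_one, InnerProductSpace.toDual_apply_apply] at h2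
  linarith

theorem integral_sq_sum_pi_of_integral_eq_zero {ι : Type*} [Fintype ι] {Ω : ι → Type*}
    {mΩ : ∀ i, MeasurableSpace (Ω i)} {μ : (i : ι) → Measure (Ω i)}
    [∀ i, IsProbabilityMeasure (μ i)] {X : ∀ i, Ω i → ℝ} (h : ∀ i, MemLp (X i) 2 (μ i))
    (h0 : ∀ i, ∫ w, X i w ∂(μ i) = 0) :
    ∫ ω, (∑ i, X i (ω i)) ^ 2 ∂(Measure.pi μ) = ∑ i, ∫ w, X i w ^ 2 ∂(μ i) := by
  have hmp := fun i => measurePreserving_eval μ i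
  have hL : ∀ i, MemLp (fun ω : ∀ i, Ω i => X i (ω i)) 2 (Measure.pi μ) := fun i =>
    (h i).comp_measurePreserving (hmp i)
  have hz : ∀ i, ∫ ω, X i (ω i) ∂(Measure.pi μ) = 0 := fun i => by
    have h1 := integral_map (hmp i).measurable.aemeasurable (f := X i)
      (by rw [(hmp i).map_eq]; exact (h i).aestronglyMeasurable)
    rw [(hmp i).map_eq, h0] at h1
    exact h1.symm
  have hv := variance_sum_pi h
  have e : (∑ i, fun ω : ∀ i, Ω i => X i (ω i)) = fun ω => ∑ i, X i (ω i) := by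
    funext ω; rw [Finset.sum_apply]
  rw [e, variance_of_integral_eq_zero] at hv
  · rw [hv]
    exact Finset.sum_congr rfl fun i _ =>
      variance_of_integral_eq_zero (h i).aestronglyMeasurable.aemeasurable (h0 i)
  · exact (memLp_finsetSum _ fun i _ => hL i).aestronglyMeasurable.aemeasurable
  · rw [integral_finsetSum _ fun i _ => (hL i).integrable (by norm_num)]
    exact Finset.sum_eq_zero fun i _ => hz i

section Class

variable {d K : ℕ} {X : Set (E d)} {L B σ : ℝ} {f : E d → ℝ} {G : E d → E d}
  {C : Fin K → Client d}

/-- Law of the randomness of all clients in one round. -/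
def clientLaw (C : Fin K → Client d) : Measure (∀ k, (C k).Ξ) := Measure.pi fun k => (C k).law

instance : IsProbabilityMeasure (clientLaw C) := by
  unfold clientLaw
  infer_instance

/-- Outputs of all clients at the query point `x`. -/
def replies (C : Fin K → Client d) (x : E d) (ξ : ∀ k, (C k).Ξ) (k : Fin K) : E d :=
  (C k).est x (ξ k)

theorem measurable_est_apply (k : Fin K) (x : E d) : Measurable ((C k).est x) :=
  (C k).measurable_est.comp (measurable_const.prodMk measurable_id)

theorem measurable_replies (x : E d) : Measurable (replies C x) :=
  measurable_pi_iff.2 fun k => (measurable_est_apply k x).comp (measurable_pi_apply k)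

theorem InClass.norm_le (h : InClass X L B σ f G C) (hB : 0 ≤ B) (k : Fin K) {x : E d}
    (hx : x ∈ X) : ∀ᵐ ξ ∂(C k).law, ‖(C k).est x ξ‖ ≤ B := by
  filter_upwards [h.bounded k x hx] with ξ hξ
  exact (pow_le_pow_iff_left₀ (norm_nonneg _) hB two_ne_zero).1 hξ

theorem InClass.integrable_est (h : InClass X L B σ f G C) (hB : 0 ≤ B) (k : Fin K) {x : E d}
    (hx : x ∈ X) : Integrable ((C k).est x) (C k).law :=
  Integrable.of_bound (measurable_est_apply k x).aestronglyMeasurable B (h.norm_le hB k hx)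

theorem InClass.norm_gradient_le (h : InClass X L B σ f G C) (hB : 0 ≤ B) (k : Fin K) {x : E d}
    (hx : x ∈ X) : ‖G x‖ ≤ B := by
  rw [← h.unbiased k x hx]
  simpa using norm_integral_le_of_norm_le_const (h.norm_le hB k hx)

theorem InClass.lower (h : InClass X L B σ f G C) {x y : E d} (hx : x ∈ X) (hy : y ∈ X) :
    f x + inner ℝ (G x) (y - x) ≤ f y :=
  inner_gradient_le h.convex hx hy (h.hasGradient x hx)

theorem InClass.lipschitz (h : InClass X L B σ f G C) (hB : 0 ≤ B) (k : Fin K) {x y : E d}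
    (hx : x ∈ X) (hy : y ∈ X) : |f x - f y| ≤ B * ‖x - y‖ := by
  have key : ∀ x ∈ X, ∀ y ∈ X, f x - f y ≤ B * ‖x - y‖ := fun x hx y hy => by
    have h1 := h.lower hx hy
    have h2 := (neg_le_abs _).trans (abs_real_inner_le_norm (G x) (y - x))
    have h3 := mul_le_mul_of_nonneg_right (h.norm_gradient_le hB k hx) (norm_nonneg (y - x))
    rw [norm_sub_rev x y]
    linarith
  rw [abs_le]
  have h1 := key x hx y hy
  have h2 := key y hy x hx
  rw [norm_sub_rev] at h2
  constructor <;> linarith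

theorem InClass.ae_replies (h : InClass X L B σ f G C) (hB : 0 ≤ B) {x : E d} (hx : x ∈ X) :
    ∀ᵐ ξ ∂(clientLaw C), ∀ k, ‖replies C x ξ k‖ ≤ B := by
  rw [ae_all_iff]
  intro k
  exact (measurePreserving_eval (fun k => (C k).law) k).quasiMeasurePreserving.ae
    (h.norm_le hB k hx)

theorem InClass.integrable_deviation (h : InClass X L B σ f G C) (hB : 0 ≤ B) (k : Fin K)
    {x : E d} (hx : x ∈ X) :
    Integrable (fun ξ => ‖(C k).est x ξ - G x‖ ^ 2) (C k).law := by
  refine Integrable.of_bound (C := (B + ‖G x‖) ^ 2)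
    (((measurable_est_apply k x).sub_const _).norm.pow_const 2).aestronglyMeasurable ?_
  filter_upwards [h.norm_le hB k hx] with ξ hξ
  rw [norm_pow, norm_norm]
  gcongr
  exact (norm_sub_le _ _).trans (add_le_add_left hξ _)

theorem InClass.replies_deviation (h : InClass X L B σ f G C) (hB : 0 ≤ B) (k : Fin K)
    {x : E d} (hx : x ∈ X) :
    Integrable (fun ξ => ‖replies C x ξ k - G x‖ ^ 2) (clientLaw C) ∧
      ∫ ξ, ‖replies C x ξ k - G x‖ ^ 2 ∂(clientLaw C) ≤ σ ^ 2 := by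
  have hmp := measurePreserving_eval (fun k => (C k).law) k
  have hi := h.integrable_deviation hB k hx
  refine ⟨hmp.integrable_comp_of_integrable hi, ?_⟩
  have h1 := integral_map hmp.measurable.aemeasurable
    (f := fun ξ => ‖(C k).est x ξ - G x‖ ^ 2) (by rw [hmp.map_eq]; exact hi.aestronglyMeasurable)
  rw [hmp.map_eq] at h1
  exact h1.symm.le.trans (h.deviation k x hx)

/-- Averaging independent unbiased replies divides the mean square deviation by their number. -/
theorem InClass.mean_deviation (h : InClass X L B σ f G C) (hB : 0 ≤ B) {x : E d} (hx : x ∈ X)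
    {A : Finset (Fin K)} (hA : 0 < A.card) :
    Integrable (fun ξ => ‖(1 / (A.card : ℝ)) • ∑ k ∈ A, replies C x ξ k - G x‖ ^ 2)
      (clientLaw C) ∧
    ∫ ξ, ‖(1 / (A.card : ℝ)) • ∑ k ∈ A, replies C x ξ k - G x‖ ^ 2 ∂(clientLaw C)
      ≤ σ ^ 2 / A.card := by
  classical
  have hA' : (0 : ℝ) < A.card := by exact_mod_cast hA
  have hrm := fun k => measurable_pi_iff.1 (measurable_replies (C := C) x) k
  refine ⟨?_, ?_⟩
  · refine Integrable.of_bound (C := (B + ‖G x‖) ^ 2) ?_ ?_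
    · exact ((((Finset.measurable_sum A fun k _ => hrm k).const_smul
        (1 / (A.card : ℝ))).sub_const (G x)).norm.pow_const 2).aestronglyMeasurable
    · filter_upwards [h.ae_replies hB hx] with ξ hξ
      rw [norm_pow, norm_norm]
      gcongr
      exact (norm_sub_le _ _).trans (add_le_add_left (WZ.norm_mean_le A _ hB hξ) _)
  let Y : Fin d → ∀ k, (C k).Ξ → ℝ := fun j k ξ => if k ∈ A then (C k).est x ξ j - G x j else 0
  have hcoord : ∀ k j, Measurable fun ξ => (C k).est x ξ j := fun k j =>
    (EuclideanSpace.proj (𝕜 := ℝ) j).measurable.comp (measurable_est_apply k x)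
  have hYL : ∀ j k, MemLp (Y j k) 2 (C k).law := fun j k => by
    simp only [Y]
    split_ifs
    · refine MemLp.of_bound ((hcoord k j).sub_const _).aestronglyMeasurable (B + |G x j|) ?_
      filter_upwards [h.norm_le hB k hx] with ξ hξ
      refine (norm_sub_le _ _).trans ?_
      rw [Real.norm_eq_abs, Real.norm_eq_abs]
      exact add_le_add_left ((WZ.abs_coord_le _ j).trans hξ) _
    · exact memLp_const 0
  have hY0 : ∀ j k, ∫ ξ, Y j k ξ ∂(C k).law = 0 := fun j k => by
    simp only [Y]
    split_ifs
    · have hi := h.integrable_est hB k hx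
      have h1 := ContinuousLinearMap.integral_comp_comm
        (EuclideanSpace.proj (𝕜 := ℝ) j : E d →L[ℝ] ℝ) hi
      rw [h.unbiased k x hx] at h1
      have h2 : Integrable (fun ξ => (C k).est x ξ j) (C k).law :=
        (EuclideanSpace.proj (𝕜 := ℝ) j : E d →L[ℝ] ℝ).integrable_comp hi
      rw [integral_sub h2 (integrable_const _)]
      change ∫ ξ, (C k).est x ξ j ∂(C k).law = G x j at h1
      rw [h1]
      simp
    · simp
  have hsq : ∀ ξ, ‖(1 / (A.card : ℝ)) • ∑ k ∈ A, replies C x ξ k - G x‖ ^ 2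
      = (1 / (A.card : ℝ)) ^ 2 * ∑ j, (∑ k, Y j k (ξ k)) ^ 2 := fun ξ => by
    rw [← WZ.sum_sq_coord, Finset.mul_sum]
    refine Finset.sum_congr rfl fun j _ => ?_
    have h1 : ∑ k, Y j k (ξ k) = ∑ k ∈ A, replies C x ξ k j - A.card * G x j := by
      simp only [Y]
      rw [Finset.sum_ite_mem, Finset.univ_inter, Finset.sum_sub_distrib]
      simp [replies]
    rw [h1, PiLp.sub_apply, PiLp.smul_apply, smul_eq_mul, WithLp.ofLp_sum, Finset.sum_apply,
      ← mul_pow]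
    congr 1
    field_simp
  have hYi : ∀ j, Integrable (fun ξ : ∀ k, (C k).Ξ => (∑ k, Y j k (ξ k)) ^ 2) (clientLaw C) :=
    fun j => (memLp_finsetSum _ fun k _ => (hYL j k).comp_measurePreserving
      (measurePreserving_eval (fun k => (C k).law) k)).integrable_sq
  simp only [hsq]
  rw [integral_const_mul, integral_finsetSum _ fun j _ => hYi j]
  have h2 : ∀ j, ∫ ξ, (∑ k, Y j k (ξ k)) ^ 2 ∂(clientLaw C)
      = ∑ k, ∫ ξ, Y j k ξ ^ 2 ∂(C k).law := fun j =>
    integral_sq_sum_pi_of_integral_eq_zero (hYL j) (hY0 j)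
  simp only [h2]
  rw [Finset.sum_comm]
  have h3 : ∀ k, ∑ j, ∫ ξ, Y j k ξ ^ 2 ∂(C k).law ≤ if k ∈ A then σ ^ 2 else 0 := fun k => by
    rw [← integral_finsetSum _ fun j _ => (hYL j k).integrable_sq]
    simp only [Y]
    split_ifs
    · refine le_trans (le_of_eq ?_) (h.deviation k x hx)
      refine integral_congr_ae (ae_of_all _ fun ξ => ?_)
      simp only []
      rw [← WZ.sum_sq_coord]
      rfl
    · simp
  have h4 : ∑ k, ∑ j, ∫ ξ, Y j k ξ ^ 2 ∂(C k).law ≤ A.card * σ ^ 2 := by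
    refine (Finset.sum_le_sum fun k _ => h3 k).trans ?_
    rw [Finset.sum_ite_mem, Finset.univ_inter, Finset.sum_const, nsmul_eq_mul]
  calc _ ≤ (1 / (A.card : ℝ)) ^ 2 * (A.card * σ ^ 2) := by gcongr
    _ = _ := by field_simp

theorem InClass.integral_inner_mean (h : InClass X L B σ f G C) (hB : 0 ≤ B) {x : E d}
    (hx : x ∈ X) {A : Finset (Fin K)} (hA : 0 < A.card) (v : E d) :
    Integrable (fun ξ => inner ℝ ((1 / (A.card : ℝ)) • ∑ k ∈ A, replies C x ξ k - G x) v)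
      (clientLaw C) ∧
    ∫ ξ, inner ℝ ((1 / (A.card : ℝ)) • ∑ k ∈ A, replies C x ξ k - G x) v ∂(clientLaw C) = 0 := by
  have hA' : (A.card : ℝ) ≠ 0 := by exact_mod_cast hA.ne'
  have hmp := fun k => measurePreserving_eval (fun k => (C k).law) k
  have hi : ∀ k, Integrable (fun ξ => inner ℝ (replies C x ξ k) v) (clientLaw C) := fun k =>
    (hmp k).integrable_comp_of_integrable
      (g := fun ξ => inner ℝ ((C k).est x ξ) v) ((h.integrable_est hB k hx).inner_const v)
  have hv : ∀ k, ∫ ξ, inner ℝ (replies C x ξ k) v ∂(clientLaw C) = inner ℝ (G x) v := fun k => by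
    have hii := (h.integrable_est hB k hx).inner_const (𝕜 := ℝ) v
    have h1 := integral_map (hmp k).measurable.aemeasurable
      (f := fun ξ => inner ℝ ((C k).est x ξ) v)
      (by rw [(hmp k).map_eq]; exact hii.aestronglyMeasurable)
    rw [(hmp k).map_eq] at h1
    refine h1.symm.trans ?_
    have h2 := integral_inner (𝕜 := ℝ) (h.integrable_est hB k hx) v
    simp only [real_inner_comm v] at h2 ⊢
    rw [h2, h.unbiased k x hx]
  have e : ∀ ξ, inner ℝ ((1 / (A.card : ℝ)) • ∑ k ∈ A, replies C x ξ k - G x) v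
      = 1 / (A.card : ℝ) * ∑ k ∈ A, inner ℝ (replies C x ξ k) v - inner ℝ (G x) v := fun ξ => by
    rw [inner_sub_left, inner_smul_left, sum_inner]
    simp
  simp only [e]
  have hi2 : Integrable (fun ξ => 1 / (A.card : ℝ) * ∑ k ∈ A, inner ℝ (replies C x ξ k) v)
    (clientLaw C) := (integrable_finsetSum _ fun k _ => hi k).const_mul _
  refine ⟨hi2.sub (integrable_const _), ?_⟩
  rw [integral_sub hi2 (integrable_const _), integral_const_mul,
    integral_finsetSum _ fun k _ => hi k]
  simp only [hv, Finset.sum_const, nsmul_eq_mul, integral_const, probReal_univ, one_smul]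
  field_simp
  ring

end Class

/-! ### Gaussian tails -/

theorem measureReal_abs_ge_gaussianReal_le (v : NNReal) {t : ℝ} (ht : 0 ≤ t) :
    (gaussianReal 0 v).real {z | t ≤ |z|} ≤ 2 * Real.exp (-t ^ 2 / (2 * v)) := by
  have hsub : HasSubgaussianMGF (fun z : ℝ => z) v (gaussianReal 0 v) :=
    ⟨fun s => integrable_exp_mul_gaussianReal s, fun s => by
      have := mgf_gaussianReal (X := fun z : ℝ => z) (p := gaussianReal 0 v) (μ := 0) (v := v)
        Measure.map_id s
      rw [this, zero_mul, zero_add]⟩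
  have h1 := hsub.measure_ge_le ht
  have h2 := hsub.neg.measure_ge_le ht
  have hset : {z : ℝ | t ≤ |z|} = {z | t ≤ z} ∪ {z | t ≤ (-fun z : ℝ => z) z} := by
    ext z
    simp only [Set.mem_ofPred_eq, Set.mem_union, Pi.neg_apply]
    exact le_abs
  rw [hset]
  refine (measureReal_union_le _ _).trans ?_
  linarith

/-! ### Bias and variance of the noiseless estimate of one round -/

namespace WZ

variable {s : WZ} {X : Set (E s.d)} {L σ : ℝ} {f : E s.d → ℝ} {G : E s.d → E s.d}
  {C : Fin s.K → Client s.d}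

instance (σz : ℝ) : IsProbabilityMeasure (s.noiseLaw σz) := by
  unfold noiseLaw
  infer_instance

theorem isProbabilityMeasure_roundLaw (hs : s.Admissible) (C : Fin s.K → Client s.d) (σz : ℝ) :
    IsProbabilityMeasure (s.roundLaw C σz) := by
  have := s.isProbabilityMeasure_coinLaw hs.M_pos
  unfold roundLaw
  infer_instance

/-- Estimate of the server in a round with vanishing channel noise. -/
def noiselessEstimate (s : WZ) (C : Fin s.K → Client s.d) (x : E s.d) (w : s.Round C) : E s.d :=
  s.noiseless (replies C x w.1) w.2.1

theorem measurable_noiselessEstimate (C : Fin s.K → Client s.d) :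
    Measurable (Function.uncurry (s.noiselessEstimate C)) := by
  unfold noiselessEstimate noiseless Function.uncurry
  exact s.measurable_decoder_channel (g := fun a : E s.d × s.Round C => replies C a.1 a.2.1)
    (s.measurable_est C measurable_fst measurable_snd.fst) measurable_snd.snd.fst measurable_const

/-- As long as the noise is below the tolerance, the server obtains the noiseless estimate. -/
theorem estimate_eq_of_small_noise (hs : s.Admissible) (C : Fin s.K → Client s.d) (x : E s.d)
    {w : s.Round C} (hw : ∀ j, |w.2.2 j| < s.tolerance j) :
    s.estimate C x w = s.noiselessEstimate C x w :=
  s.decoder_eq_of_small_noise hs.even hs.K_pos (by rw [hs.v_eq]; norm_num) hs.I_pos hs.P_pos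
    hs.p_pos hs.p'_pos _ _ hw

theorem integral_roundLaw (hs : s.Admissible) (σz : ℝ) {F : (∀ k, (C k).Ξ) × s.Coins → ℝ}
    (hF : Measurable F) {c : ℝ} (hc : ∀ a, |F a| ≤ c) :
    Integrable (fun ξ => ∫ u, F (ξ, u) ∂s.coinLaw) (clientLaw C) ∧
    ∫ w : s.Round C, F (w.1, w.2.1) ∂s.roundLaw C σz
      = ∫ ξ, ∫ u, F (ξ, u) ∂s.coinLaw ∂clientLaw C := by
  have := s.isProbabilityMeasure_coinLaw hs.M_pos
  have hmp : MeasurePreserving (Prod.map id Prod.fst : s.Round C → (∀ k, (C k).Ξ) × s.Coins)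
      (s.roundLaw C σz) ((clientLaw C).prod s.coinLaw) :=
    (MeasurePreserving.id _).prod measurePreserving_fst
  have hi : Integrable F ((clientLaw C).prod s.coinLaw) :=
    integrable_of_bdd hF.aestronglyMeasurable hc
  refine ⟨hi.integral_prod_left, ?_⟩
  rw [← integral_prod _ hi]
  have h1 := integral_map (μ := s.roundLaw C σz) hmp.measurable.aemeasurable (f := F)
    (by rw [hmp.map_eq]; exact hi.aestronglyMeasurable)
  rw [hmp.map_eq] at h1
  exact h1.symm

theorem measurable_noiseless_replies (C : Fin s.K → Client s.d) (x : E s.d) :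
    Measurable fun a : (∀ k, (C k).Ξ) × s.Coins => s.noiseless (replies C x a.1) a.2 :=
  s.measurable_decoder_channel (g := fun a : (∀ k, (C k).Ξ) × s.Coins => replies C x a.1)
    (s.measurable_est C measurable_const measurable_fst) measurable_snd measurable_const

/-- Bound for the mean square of the bias caused by overflow. -/
def overflowBound (s : WZ) (l : ℝ) : ℝ := 2 ^ s.n * (4 * s.m ^ 2 * excessBound s l)

/-- Mean square error of order `B σ / m`: the distance of a reply to the side information is of
order `σ`, and the average of the second half of the clients adds `σ² / m ≤ B σ / m`. -/
theorem round_variance_le (hs : s.Admissible) (h : InClass X L s.B σ f G C) (σz : ℝ)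
    (hd : (2 : ℝ) ^ s.n ≤ 2 * s.m) (hσ0 : 0 < σ) (hσB : σ ≤ s.B)
    (hσ : s.B ^ 2 * 2 ^ s.n ≤ σ ^ 2 * (2 * s.m))
    (hMI : s.M / s.I ≤ s.B / (2 * s.m * √((2 : ℝ) ^ s.n))) {l : ℝ} (hl : 0 < l) {x : E s.d}
    (hx : x ∈ X) :
    ∫ w, ‖s.noiselessEstimate C x w - G x‖ ^ 2 ∂s.roundLaw C σz
      ≤ 12 * (s.B * σ / s.m) + 2 * s.overflowBound l := by
  have := s.isProbabilityMeasure_coinLaw hs.M_pos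
  have hm := hs.m_pos
  have hB := hs.B_pos
  obtain ⟨b, hb⟩ := s.exists_norm_decoder_le
  obtain ⟨hi, heq⟩ := integral_roundLaw (C := C) hs σz
    (F := fun a => ‖s.noiseless (replies C x a.1) a.2 - G x‖ ^ 2) (c := (b + ‖G x‖) ^ 2)
    (((measurable_noiseless_replies C x).sub_const _).norm.pow_const 2) (fun a => by
      rw [abs_pow, abs_norm]
      gcongr
      exact (norm_sub_le _ _).trans (add_le_add_left (hb _ _) _))
  refine heq.le.trans ?_
  have hm₁ : 0 < s.firstHalf.card := by
    rw [s.card_firstHalf]; exact s.m_pos hs.even hs.K_pos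
  have hm₂ : 0 < s.secondHalf.card := by
    rw [s.card_secondHalf hs.even]; exact s.m_pos hs.even hs.K_pos
  have d₁ := h.mean_deviation hB.le hx hm₁
  have d₂ := h.mean_deviation hB.le hx hm₂
  rw [s.card_firstHalf] at d₁
  rw [s.card_secondHalf hs.even] at d₂
  change Integrable (fun ξ => ‖s.mean₁ (replies C x ξ) - G x‖ ^ 2) _ ∧
    ∫ ξ, ‖s.mean₁ (replies C x ξ) - G x‖ ^ 2 ∂clientLaw C ≤ _ at d₁
  change Integrable (fun ξ => ‖s.mean₂ (replies C x ξ) - G x‖ ^ 2) _ ∧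
    ∫ ξ, ‖s.mean₂ (replies C x ξ) - G x‖ ^ 2 ∂clientLaw C ≤ _ at d₂
  have dk := fun k => h.replies_deviation hB.le k hx
  have hpt : ∀ᵐ ξ ∂clientLaw C, ∫ u, ‖s.noiseless (replies C x ξ) u - G x‖ ^ 2 ∂s.coinLaw
      ≤ 2 * (s.B / s.m * (1 / s.m * ∑ k ∈ s.secondHalf, (σ + 2 / σ *
          (‖replies C x ξ k - G x‖ ^ 2 + ‖s.mean₁ (replies C x ξ) - G x‖ ^ 2)))
          + s.overflowBound l) + 2 * ‖s.mean₂ (replies C x ξ) - G x‖ ^ 2 := by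
    filter_upwards [h.ae_replies hB.le hx] with ξ hξ
    set g := replies C x ξ
    have h1 : ∀ u, ‖s.noiseless g u - G x‖ ^ 2
        ≤ 2 * ‖s.noiseless g u - s.mean₂ g‖ ^ 2 + 2 * ‖s.mean₂ g - G x‖ ^ 2 := fun u => by
      have h2 := norm_add_le (s.noiseless g u - s.mean₂ g) (s.mean₂ g - G x)
      rw [sub_add_sub_cancel] at h2
      have h3 : ‖s.noiseless g u - G x‖ ^ 2
          ≤ (‖s.noiseless g u - s.mean₂ g‖ + ‖s.mean₂ g - G x‖) ^ 2 := by gcongr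
      nlinarith [sq_nonneg (‖s.noiseless g u - s.mean₂ g‖ - ‖s.mean₂ g - G x‖)]
    have hi1 := (integrable_norm_noiseless_sub_sq hs g (s.mean₂ g)).const_mul 2
    refine (integral_mono (integrable_norm_noiseless_sub_sq hs g (G x))
      (hi1.add (integrable_const _)) h1).trans ?_
    simp only [Pi.add_apply]
    rw [integral_add hi1 (integrable_const _), integral_const_mul]
    simp only [integral_const, probReal_univ, one_smul]
    gcongr
    refine (integral_noiseless_sub_sq_le hs hξ hd hσ0 hσ hMI hl (G x)).trans (le_of_eq ?_)
    rw [overflowBound]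
    congr 4
    funext k
    ring
  have hik : ∀ k ∈ s.secondHalf, Integrable (fun ξ => σ + 2 / σ * (‖replies C x ξ k - G x‖ ^ 2
      + ‖s.mean₁ (replies C x ξ) - G x‖ ^ 2)) (clientLaw C) := fun k _ =>
    (integrable_const _).add (((dk k).1.add d₁.1).const_mul _)
  have hiA : Integrable (fun ξ => s.B / s.m * (1 / s.m * ∑ k ∈ s.secondHalf, (σ + 2 / σ *
          (‖replies C x ξ k - G x‖ ^ 2 + ‖s.mean₁ (replies C x ξ) - G x‖ ^ 2)))) (clientLaw C) :=
    ((integrable_finsetSum _ hik).const_mul _).const_mul _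
  have hiB : Integrable (fun ξ => 2 * (s.B / s.m * (1 / s.m * ∑ k ∈ s.secondHalf, (σ + 2 / σ *
          (‖replies C x ξ k - G x‖ ^ 2 + ‖s.mean₁ (replies C x ξ) - G x‖ ^ 2)))
          + s.overflowBound l)) (clientLaw C) := (hiA.add (integrable_const _)).const_mul 2
  refine (integral_mono_ae hi (hiB.add (d₂.1.const_mul 2)) hpt).trans ?_
  simp only [Pi.add_apply]
  rw [integral_add hiB (d₂.1.const_mul 2), integral_const_mul, integral_const_mul,
    integral_add hiA (integrable_const _), integral_const_mul, integral_const_mul,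
    integral_finsetSum _ hik]
  simp only [integral_const, probReal_univ, one_smul]
  have hm1 : (1 : ℝ) ≤ s.m := by exact_mod_cast s.m_pos hs.even hs.K_pos
  have hk : ∀ k ∈ s.secondHalf, ∫ ξ, (σ + 2 / σ * (‖replies C x ξ k - G x‖ ^ 2
      + ‖s.mean₁ (replies C x ξ) - G x‖ ^ 2)) ∂clientLaw C ≤ 5 * σ := by
    intro k _
    have hA : Integrable (fun ξ => 2 / σ * (‖replies C x ξ k - G x‖ ^ 2
        + ‖s.mean₁ (replies C x ξ) - G x‖ ^ 2)) (clientLaw C) :=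
      ((dk k).1.add d₁.1).const_mul _
    rw [integral_add (integrable_const _) hA, integral_const_mul, integral_add (dk k).1 d₁.1]
    simp only [integral_const, probReal_univ, one_smul]
    have h1 : σ ^ 2 / s.m ≤ σ ^ 2 := div_le_self (sq_nonneg _) hm1
    have h2 : 2 / σ * (∫ ξ, ‖replies C x ξ k - G x‖ ^ 2 ∂clientLaw C
        + ∫ ξ, ‖s.mean₁ (replies C x ξ) - G x‖ ^ 2 ∂clientLaw C) ≤ 2 / σ * (σ ^ 2 + σ ^ 2) := by
      gcongr
      · exact (dk k).2
      · exact d₁.2.trans h1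
    have h3 : 2 / σ * (σ ^ 2 + σ ^ 2) = 4 * σ := by field_simp; ring
    linarith
  have hsum : s.B / s.m * (1 / s.m * ∑ k ∈ s.secondHalf, ∫ ξ, (σ + 2 / σ *
      (‖replies C x ξ k - G x‖ ^ 2 + ‖s.mean₁ (replies C x ξ) - G x‖ ^ 2)) ∂clientLaw C)
      ≤ 5 * (s.B * σ / s.m) := by
    calc _ ≤ s.B / s.m * (1 / s.m * (s.m * (5 * σ))) := by
          gcongr
          refine (Finset.sum_le_card_nsmul _ _ _ hk).trans ?_
          rw [s.card_secondHalf hs.even, nsmul_eq_mul]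
      _ = _ := by field_simp
  have h5 : σ ^ 2 / s.m ≤ s.B * σ / s.m := by
    gcongr
    nlinarith
  linarith [d₂.2]

/-- The replies of the second half are unbiased, so only the overflow contributes to the bias. -/
theorem abs_round_bias_le (hs : s.Admissible) (h : InClass X L s.B σ f G C) (σz : ℝ)
    (hd : (2 : ℝ) ^ s.n ≤ 2 * s.m) {β : ℝ} (hβ : 0 < β) {l : ℝ} (hl : 0 < l) {x : E s.d}
    (hx : x ∈ X) (v : E s.d) :
    |∫ w, inner ℝ (s.noiselessEstimate C x w - G x) v ∂s.roundLaw C σz|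
      ≤ (β / 2 + s.overflowBound l / (2 * β)) * ‖v‖ := by
  have := s.isProbabilityMeasure_coinLaw hs.M_pos
  have hB := hs.B_pos
  obtain ⟨b, hb⟩ := s.exists_norm_decoder_le
  obtain ⟨hi, heq⟩ := integral_roundLaw (C := C) hs σz
    (F := fun a => inner ℝ (s.noiseless (replies C x a.1) a.2 - G x) v)
    (c := (b + ‖G x‖) * ‖v‖)
    (((measurable_noiseless_replies C x).sub_const _).inner measurable_const) (fun a => by
      refine (abs_real_inner_le_norm _ _).trans ?_
      gcongr
      exact (norm_sub_le _ _).trans (add_le_add_left (hb _ _) _))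
  have hm₂ : 0 < s.secondHalf.card := by
    rw [s.card_secondHalf hs.even]; exact s.m_pos hs.even hs.K_pos
  have hmean := h.integral_inner_mean hB.le hx hm₂ v
  rw [s.card_secondHalf hs.even] at hmean
  change Integrable (fun ξ => inner ℝ (s.mean₂ (replies C x ξ) - G x) v) _ ∧
    ∫ ξ, inner ℝ (s.mean₂ (replies C x ξ) - G x) v ∂clientLaw C = 0 at hmean
  have hpt : ∀ᵐ ξ ∂clientLaw C,
      ‖∫ u, inner ℝ (s.noiseless (replies C x ξ) u - G x) v ∂s.coinLaw
        - inner ℝ (s.mean₂ (replies C x ξ) - G x) v‖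
      ≤ (β / 2 + s.overflowBound l / (2 * β)) * ‖v‖ := by
    filter_upwards [h.ae_replies hB.le hx] with ξ hξ
    set g := replies C x ξ
    have hint : ∀ c : E s.d, Integrable (fun u => inner ℝ (s.noiseless g u - c) v) s.coinLaw :=
      fun c => by
        refine integrable_of_bdd (C := (b + ‖c‖) * ‖v‖)
          (((measurable_noiseless g).sub_const _).inner
            measurable_const).aestronglyMeasurable fun u => ?_
        refine (norm_inner_le_norm _ _).trans ?_
        gcongr
        exact (norm_sub_le _ _).trans (add_le_add_left (hb _ _) _)
    have e : ∫ u, inner ℝ (s.noiseless g u - G x) v ∂s.coinLaw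
        - inner ℝ (s.mean₂ g - G x) v
        = ∫ u, inner ℝ (s.noiseless g u - s.mean₂ g) v ∂s.coinLaw := by
      have e1 : ∀ u, inner ℝ (s.noiseless g u - s.mean₂ g) v
          = inner ℝ (s.noiseless g u - G x) v - inner ℝ (s.mean₂ g - G x) v := fun u => by
        rw [← inner_sub_left, sub_sub_sub_cancel_right]
      simp only [e1]
      rw [integral_sub (hint _) (integrable_const _)]
      simp
    rw [e, Real.norm_eq_abs]
    exact abs_integral_inner_noiseless_le hs hξ hd hβ hl v
  have h2 := norm_integral_le_of_norm_le_const hpt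
  rw [integral_sub hi hmean.1, hmean.2, sub_zero, probReal_univ, mul_one, Real.norm_eq_abs] at h2
  exact (congrArg abs heq).le.trans h2

/-! ### Channel noise -/

/-- Bound for the probability that the noise of one round affects the decoder. -/
def noiseBound (s : WZ) (σz : ℝ) : ℝ :=
  ∑ j, 2 * Real.exp (-s.tolerance j ^ 2 / (2 * σz ^ 2))

theorem measureReal_large_noise_le {σz : ℝ} (htol : ∀ j, 0 ≤ s.tolerance j) :
    (s.noiseLaw σz).real {z | ∃ j, s.tolerance j ≤ |z j|} ≤ s.noiseBound σz := by
  have hset : {z : s.Uses → ℝ | ∃ j, s.tolerance j ≤ |z j|}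
      = ⋃ j, {z | s.tolerance j ≤ |z j|} := by
    ext z; simp
  rw [hset, noiseBound]
  refine (measureReal_iUnion_fintype_le _).trans (Finset.sum_le_sum fun j _ => ?_)
  have hmp : MeasurePreserving (Function.eval j) (s.noiseLaw σz)
      (gaussianReal 0 (σz ^ 2).toNNReal) := measurePreserving_eval _ j
  have hms : MeasurableSet {z : ℝ | s.tolerance j ≤ |z|} :=
    measurableSet_le measurable_const measurable_norm
  have h1 := hmp.measureReal_preimage hms.nullMeasurableSet
  have h2 := measureReal_abs_ge_gaussianReal_le (σz ^ 2).toNNReal (htol j)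
  rw [Real.coe_toNNReal _ (sq_nonneg _)] at h2
  exact h1.le.trans h2

theorem tolerance_nonneg (hs : s.Admissible) (j : s.Uses) : 0 ≤ s.tolerance j := by
  have hm := s.m_pos hs.even hs.K_pos
  have key : ∀ r : ℕ, 2 ≤ r → 0 ≤ √s.P / ((r : ℝ) - 1) := fun r hr => by
    have : (2 : ℝ) ≤ r := by exact_mod_cast hr
    exact div_nonneg (Real.sqrt_nonneg _) (by linarith)
  rcases j with j | j
  · exact key _ (two_le_askSize hm (by rw [hs.v_eq]; norm_num) hs.p_pos)
  · exact key _ (two_le_askSize hm (by have := hs.I_pos; omega) hs.p'_pos)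

/-- Event that the noise is large in some channel use of some round. -/
def largeNoise (s : WZ) (C : Fin s.K → Client s.d) (T : ℕ) : Set (Fin T → s.Round C) :=
  {ω | ∃ t j, s.tolerance j ≤ |(ω t).2.2 j|}

theorem measurableSet_largeNoise (T : ℕ) : MeasurableSet (s.largeNoise C T) := by
  have : s.largeNoise C T = ⋃ t, ⋃ j, {ω | s.tolerance j ≤ |(ω t).2.2 j|} := by
    ext ω; simp [largeNoise]
  rw [this]
  refine MeasurableSet.iUnion fun t => MeasurableSet.iUnion fun j => ?_
  have h1 : Measurable fun ω : Fin T → s.Round C => (ω t).2.2 j :=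
    measurable_pi_iff.1 (measurable_pi_apply (X := fun _ : Fin T => s.Round C) t).snd.snd j
  exact measurableSet_le measurable_const h1.norm

theorem measureReal_largeNoise_le (hs : s.Admissible) (σz : ℝ) (T : ℕ) :
    (Measure.pi fun _ : Fin T => s.roundLaw C σz).real (s.largeNoise C T)
      ≤ T * s.noiseBound σz := by
  have := isProbabilityMeasure_roundLaw hs C σz
  have := s.isProbabilityMeasure_coinLaw hs.M_pos
  have hset : s.largeNoise C T
      = ⋃ t, {ω | ∃ j, s.tolerance j ≤ |(ω t).2.2 j|} := by
    ext ω; simp [largeNoise]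
  rw [hset]
  refine (measureReal_iUnion_fintype_le _).trans ?_
  refine (Finset.sum_le_card_nsmul _ _ (s.noiseBound σz) fun t _ => ?_).trans (by simp)
  have hmp1 : MeasurePreserving (Function.eval t)
      (Measure.pi fun _ : Fin T => s.roundLaw C σz) (s.roundLaw C σz) :=
    measurePreserving_eval (fun _ : Fin T => s.roundLaw C σz) t
  have hmp2 : MeasurePreserving (Prod.snd : s.Round C → s.Coins × (s.Uses → ℝ))
      (s.roundLaw C σz) (s.coinLaw.prod (s.noiseLaw σz)) := measurePreserving_snd
  have hmp3 : MeasurePreserving (Prod.snd : s.Coins × (s.Uses → ℝ) → (s.Uses → ℝ))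
      (s.coinLaw.prod (s.noiseLaw σz)) (s.noiseLaw σz) := measurePreserving_snd
  have hms : MeasurableSet {z : s.Uses → ℝ | ∃ j, s.tolerance j ≤ |z j|} := by
    have : {z : s.Uses → ℝ | ∃ j, s.tolerance j ≤ |z j|}
        = ⋃ j, {z | s.tolerance j ≤ |z j|} := by
      ext z; simp
    rw [this]
    exact MeasurableSet.iUnion fun j => measurableSet_le measurable_const
      (measurable_pi_apply j).norm
  have h1 := ((hmp3.comp hmp2).comp hmp1).measureReal_preimage hms.nullMeasurableSet
  exact h1.le.trans (measureReal_large_noise_le (tolerance_nonneg hs))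

/-- Convergence of projected gradient descent driven by the scheme: the terms stem from the
descent method, the overflow of the dithered quantizer, the variance, and the channel noise. -/
theorem psgd_estimate_convergence (hs : s.Admissible) (h : InClass X L s.B σ f G C) {σz : ℝ}
    (hd : (2 : ℝ) ^ s.n ≤ 2 * s.m) (hσ0 : 0 < σ) (hσB : σ ≤ s.B)
    (hσ : s.B ^ 2 * 2 ^ s.n ≤ σ ^ 2 * (2 * s.m))
    (hMI : s.M / s.I ≤ s.B / (2 * s.m * √((2 : ℝ) ^ s.n))) {l : ℝ} (hl : 0 < l)
    {β : ℝ} (hβ : 0 < β) (hcl : IsClosed X) {D : ℝ} (hD : ∀ x ∈ X, ∀ y ∈ X, ‖x - y‖ ≤ D)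
    {x₀ : E s.d} (hx₀ : x₀ ∈ X) {η : ℝ} (hη : 0 < η) (hηL : η * L ≤ 1) {T : ℕ} (hT : 0 < T)
    {z : E s.d} (hz : z ∈ X) :
    Integrable (fun ω => f (psgdOutput X η (s.estimate C) x₀ ω))
      (Measure.pi fun _ : Fin T => s.roundLaw C σz) ∧
    ∫ ω, f (psgdOutput X η (s.estimate C) x₀ ω) ∂(Measure.pi fun _ : Fin T => s.roundLaw C σz)
      ≤ f z + D ^ 2 / (2 * η * T) + (β / 2 + s.overflowBound l / (2 * β)) * D
        + η * (12 * (s.B * σ / s.m) + 2 * s.overflowBound l)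
        + s.B * D * (T * s.noiseBound σz) := by
  have := isProbabilityMeasure_roundLaw hs C σz
  have hB := hs.B_pos
  have hconv := h.convex.1
  have k₀ : Fin s.K := ⟨0, hs.K_pos⟩
  have hm := hs.m_pos
  obtain ⟨b, hb⟩ := s.exists_norm_decoder_le
  have hlip : ∀ x ∈ X, ∀ y ∈ X, |f x - f y| ≤ s.B * ‖x - y‖ := fun x hx y hy =>
    h.lipschitz hB.le k₀ hx hy
  have hD0 : 0 ≤ D := (norm_nonneg _).trans (hD z hz z hz)
  have hO : 0 ≤ s.overflowBound l := by
    rw [overflowBound, excessBound]; positivity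
  obtain ⟨hi0, h0⟩ := psgd_convergence (T := T) (x₀ := x₀) (μ := s.roundLaw C σz)
    (est := s.noiselessEstimate C) (η := η) hcl hD hx₀ h.convex hB.le hlip
    (fun x hx y hy => h.lower hx hy) h.smooth (measurable_noiselessEstimate C)
    (fun x w => hb _ _)
    (fun x hx v hv => (abs_round_bias_le hs h σz hd hβ hl hx v).trans
      (mul_le_mul_of_nonneg_left hv (by positivity)))
    (fun x hx => round_variance_le hs h σz hd hσ0 hσB hσ hMI hl hx) hη hηL hT hz
  set ν := Measure.pi fun _ : Fin T => s.roundLaw C σz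
  have hmem := psgdOutput_mem (η := η) (est := s.estimate C) hconv hcl hx₀ hT
  have hi : Integrable (fun ω => f (psgdOutput X η (s.estimate C) x₀ ω)) ν := by
    refine integrable_of_bdd (C := s.B * D + |f z|) (measurable_comp_of_lipschitz hB.le hlip
      (measurable_psgdOutput hconv hcl hx₀ (s.measurable_estimate C))
      hmem).aestronglyMeasurable fun ω => ?_
    rw [Real.norm_eq_abs]
    have h1 := abs_sub_abs_le_abs_sub (f (psgdOutput X η (s.estimate C) x₀ ω)) (f z)
    have h2 := hlip _ (hmem ω) z hz
    have h3 := mul_le_mul_of_nonneg_left (hD _ (hmem ω) z hz) hB.le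
    linarith
  refine ⟨hi, ?_⟩
  -- unless the noise is large somewhere, the noise does not change the iterates
  have hpt : ∀ ω, f (psgdOutput X η (s.estimate C) x₀ ω)
      ≤ f (psgdOutput X η (s.noiselessEstimate C) x₀ ω)
        + s.B * D * (s.largeNoise C T).indicator 1 ω := by
    intro ω
    by_cases hω : ω ∈ s.largeNoise C T
    · rw [Set.indicator_of_mem hω, Pi.one_apply, mul_one]
      have hmem' := psgdOutput_mem (η := η) (est := s.noiselessEstimate C) hconv hcl hx₀ hT ω
      have h2 := hlip _ (hmem ω) _ hmem'
      have h3 := mul_le_mul_of_nonneg_left (hD _ (hmem ω) _ hmem') hB.le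
      have h4 := le_abs_self (f (psgdOutput X η (s.estimate C) x₀ ω)
        - f (psgdOutput X η (s.noiselessEstimate C) x₀ ω))
      linarith
    · rw [Set.indicator_of_notMem hω, mul_zero, add_zero]
      refine le_of_eq (congrArg f ?_)
      rw [psgdOutput_eq, psgdOutput_eq]
      refine Finset.sum_congr rfl fun t _ => ?_
      rw [psgd_congr (ω := ω) (ω' := ω) (est := s.estimate C) (est' := s.noiselessEstimate C)]
      intro i _ x
      refine estimate_eq_of_small_noise hs C x fun j => ?_
      by_contra! hj
      exact hω ⟨i, j, hj⟩
  have hind : Integrable ((s.largeNoise C T).indicator (1 : (Fin T → s.Round C) → ℝ)) ν :=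
    (integrable_const (1 : ℝ)).indicator (measurableSet_largeNoise T)
  refine (integral_mono hi (hi0.add (hind.const_mul _)) hpt).trans ?_
  simp only [Pi.add_apply]
  rw [integral_add hi0 (hind.const_mul _), integral_const_mul,
    integral_indicator_one (measurableSet_largeNoise T)]
  have h5 := measureReal_largeNoise_le (C := C) hs σz T
  have h6 := mul_le_mul_of_nonneg_left h5 (mul_nonneg hB.le hD0)
  linarith

end WZ

/-! ### Choice of the parameters -/

theorem rpow_three_halves {x : ℝ} (hx : 0 < x) : x ^ (1.5 : ℝ) = x * √x := by
  rw [show (1.5 : ℝ) = 1 + 1 / 2 by norm_num, Real.rpow_add hx, Real.rpow_one, Real.sqrt_eq_rpow]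

/-- A block length below the floor of the logarithm keeps the power of the lattice base below
`Γ`. -/
theorem pow_le_of_le_floor_logb {b Γ : ℝ} (hb : 1 < b) (hΓ : 0 < Γ) {p : ℕ} (hp : 1 ≤ p)
    (h : p ≤ ⌊Real.logb b Γ⌋₊) : b ^ p ≤ Γ := by
  have h1 := (Nat.le_floor_iff' (by omega)).1 h
  rw [Real.le_logb_iff_rpow_le hb hΓ, Real.rpow_natCast] at h1
  exact h1

/-- The block length is chosen so that the noise exceeds half the distance of the constellation
points with probability of order `exp (-Λ)`. -/
theorem exp_neg_tolerance_le {m v p : ℕ} (hm : 0 < m) (hv : 2 ≤ v) (hp : 0 < p) {P σz Λ : ℝ}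
    (hP : 0 < P) (hσz : 0 < σz) (hΛ : 0 < Λ)
    (h : (latticeBase m v : ℝ) ^ p
      ≤ 1 + √(2 * m * (2 * m * P / σz ^ 2) / (8 * Λ))) :
    Real.exp (-(√P / ((askSize m v p : ℝ) - 1)) ^ 2 / (2 * σz ^ 2)) ≤ Real.exp (-Λ) := by
  have hm' : (0 : ℝ) < m := by exact_mod_cast hm
  have hr := two_le_askSize hm hv hp
  have hr' : (0 : ℝ) < (askSize m v p : ℝ) - 1 := by
    have : (2 : ℝ) ≤ askSize m v p := by exact_mod_cast hr
    linarith
  have hw : (latticeBase m v : ℝ) ^ p = m * ((askSize m v p : ℝ) - 1) + 1 := by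
    have h1 := mul_askSize_sub_one hm v p
    have h2 : ((askSize m v p - 1 : ℕ) : ℝ) = (askSize m v p : ℝ) - 1 := by
      rw [Nat.cast_sub (by omega)]; simp
    rw [← h2]
    exact_mod_cast h1.symm
  rw [hw] at h
  set ρ := (askSize m v p : ℝ) - 1
  have h3 : m * ρ ≤ √(2 * m * (2 * m * P / σz ^ 2) / (8 * Λ)) := by linarith
  have h4 := Real.le_sqrt' (by positivity : 0 < m * ρ) |>.1 h3
  rw [Real.exp_le_exp, div_pow, Real.sq_sqrt hP.le, neg_div, neg_le_neg_iff,
    le_div_iff₀ (by positivity), le_div_iff₀ (by positivity)]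
  have h5 : 2 * m * (2 * m * P / σz ^ 2) / (8 * Λ) = m ^ 2 * P / (2 * σz ^ 2 * Λ) := by
    field_simp
    ring
  rw [h5, le_div_iff₀ (by positivity)] at h4
  have h6 : (m : ℝ) ^ 2 * (Λ * (2 * σz ^ 2) * ρ ^ 2) ≤ m ^ 2 * P := by nlinarith
  exact le_of_mul_le_mul_left h6 (by positivity)

namespace WZ

variable {s : WZ}

theorem noiseBound_le (hs : s.Admissible) {σz Λ : ℝ} (hσz : 0 < σz) (hΛ : 0 < Λ)
    (h₁ : (latticeBase s.m s.v : ℝ) ^ s.p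
      ≤ 1 + √(2 * s.m * (2 * s.m * s.P / σz ^ 2) / (8 * Λ)))
    (h₂ : (latticeBase s.m (s.I + 1) : ℝ) ^ s.p'
      ≤ 1 + √(2 * s.m * (2 * s.m * s.P / σz ^ 2) / (8 * Λ))) :
    s.noiseBound σz ≤ s.len * (2 * Real.exp (-Λ)) := by
  have hm := s.m_pos hs.even hs.K_pos
  rw [noiseBound]
  refine (Finset.sum_le_card_nsmul _ _ (2 * Real.exp (-Λ)) fun j _ => ?_).trans (by simp [len])
  have hI := hs.I_pos
  rcases j with j | j
  · have := exp_neg_tolerance_le hm (by rw [hs.v_eq]; norm_num) hs.p_pos hs.P_pos hσz hΛ h₁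
    simp only [tolerance, Sum.elim_inl]
    linarith
  · have := exp_neg_tolerance_le hm (by omega) hs.p'_pos hs.P_pos hσz hΛ h₂
    simp only [tolerance, Sum.elim_inr]
    linarith

/-- With `M = 4 a √Λ`, where `a = B/(K√d)`, overflow contributes at most `16 B² exp (-Λ)`. -/
theorem overflowBound_le (hs : s.Admissible) {a Λ : ℝ} (hΛ : 1 ≤ Λ)
    (ha : a = s.B / (2 * s.m * √((2 : ℝ) ^ s.n))) (hM : s.M = 4 * a * √Λ) :
    s.overflowBound (√Λ / (2 * a)) ≤ 16 * s.B ^ 2 * Real.exp (-Λ) := by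
  have hm := hs.m_pos
  have hB := hs.B_pos
  have ha0 : 0 < a := by rw [ha]; positivity
  have hΛ0 : 0 < Λ := by linarith
  have hsq : √Λ ^ 2 = Λ := Real.sq_sqrt hΛ0.le
  have hs0 : 0 < √Λ := Real.sqrt_pos.2 hΛ0
  have ha2 : s.B ^ 2 / (s.m ^ 2 * 2 ^ s.n) = 4 * a ^ 2 := by
    rw [ha, div_pow, mul_pow, mul_pow, Real.sq_sqrt (by positivity)]
    field_simp
    norm_num
  have hexp : (√Λ / (2 * a)) ^ 2 * s.B ^ 2 / (s.m ^ 2 * 2 ^ s.n) - √Λ / (2 * a) * s.M = -Λ := by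
    have e1 : (√Λ / (2 * a)) ^ 2 * (4 * a ^ 2) = √Λ ^ 2 := by field_simp; norm_num
    have e2 : √Λ / (2 * a) * (4 * a * √Λ) = 2 * √Λ ^ 2 := by field_simp; norm_num
    rw [mul_div_assoc, ha2, hM, e1, e2, hsq]
    ring
  have hpre : 2 ^ s.n * (4 * s.m ^ 2 * (4 / (√Λ / (2 * a)) ^ 2)) = 16 * s.B ^ 2 / Λ := by
    have e1 : 4 / (√Λ / (2 * a)) ^ 2 = 16 * a ^ 2 / Λ := by
      rw [div_pow, hsq]; field_simp; norm_num
    have e2 : s.B ^ 2 = 4 * a ^ 2 * (s.m ^ 2 * 2 ^ s.n) := by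
      rw [← ha2]; field_simp
    rw [e1, e2]
    field_simp
  rw [overflowBound, excessBound, hexp, ← mul_assoc (4 * (s.m : ℝ) ^ 2), ← mul_assoc, hpre]
  gcongr
  exact div_le_self (by positivity) hΛ

end WZ

/-- The logarithms of the two lattice bases are of the order of `log K` and
`log K + log log N`. -/
theorem log_bases_le {K N I : ℕ} (hK : 2 ≤ K) (hN : 2 ≤ N)
    (hI : I = ⌈4 * √(Real.log ((K : ℝ) * √K * N))⌉₊) (hΛ : 1 ≤ Real.log ((K : ℝ) * √K * N)) :
    Real.log (3 * K + 1) ≤ 24 * Real.log K ∧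
      Real.log (K * I / 2 + 1) ≤ 24 * (Real.log K + Real.log (Real.log N)) := by
  have hK' : (2 : ℝ) ≤ K := by exact_mod_cast hK
  have hN' : (2 : ℝ) ≤ N := by exact_mod_cast hN
  have hlogK : Real.log 2 ≤ Real.log K := Real.log_le_log (by norm_num) hK'
  have hlogN : Real.log 2 ≤ Real.log N := Real.log_le_log (by norm_num) hN'
  have hl2 := Real.log_two_gt_d9
  have hll : -0.443 ≤ Real.log (Real.log N) := by
    have h1 := Real.one_sub_inv_le_log_of_pos (show 0 < Real.log N by linarith)
    have h2 : (Real.log N)⁻¹ ≤ (0.6931 : ℝ)⁻¹ := inv_anti₀ (by norm_num) (by linarith)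
    norm_num at h2 ⊢
    linarith
  constructor
  · have h1 : Real.log (3 * K + 1) ≤ Real.log ((K : ℝ) ^ 3) := by
      refine Real.log_le_log (by positivity) ?_
      have : (4 : ℝ) ≤ K ^ 2 := by nlinarith
      nlinarith
    rw [Real.log_pow] at h1
    push_cast at h1
    linarith
  · set Λ := Real.log ((K : ℝ) * √K * N) with hΛdef
    have hKpos : (0 : ℝ) < K := by linarith
    have hNpos : (0 : ℝ) < N := by linarith
    have hsq : √Λ ≤ Λ := by
      rw [Real.sqrt_le_left (by linarith)]
      nlinarith
    have hI5 : (I : ℝ) ≤ 5 * Λ := by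
      rw [hI]
      have := Nat.ceil_lt_add_one (show 0 ≤ 4 * √Λ by positivity)
      linarith
    have hI1 : (1 : ℝ) ≤ I := by
      have : 0 < I := by
        rw [hI]
        exact Nat.ceil_pos.2 (by have := Real.sqrt_pos.2 (show 0 < Λ by linarith); linarith)
      exact_mod_cast this
    have hΛle : Λ ≤ 4 * K * Real.log N := by
      have h1 : Λ = Real.log K + Real.log K / 2 + Real.log N := by
        rw [hΛdef, Real.log_mul (by positivity) (by positivity),
          Real.log_mul (by positivity) (by positivity), Real.log_sqrt hKpos.le]
      have h2 := Real.log_le_sub_one_of_pos hKpos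
      nlinarith
    have h3 : (K : ℝ) * I / 2 + 1 ≤ (K : ℝ) ^ 7 * Real.log N := by
      have h4 : (K : ℝ) * I / 2 + 1 ≤ K * I := by nlinarith
      have h5 : (K : ℝ) * I ≤ K * (20 * K * Real.log N) := by
        gcongr
        linarith
      have h6 : (32 : ℝ) ≤ K ^ 5 := by
        calc (32 : ℝ) = 2 ^ 5 := by norm_num
          _ ≤ K ^ 5 := by gcongr
      have h7 : 0 ≤ (K : ℝ) ^ 2 * Real.log N := by
        have : 0 ≤ Real.log N := by linarith
        positivity
      nlinarith
    have h8 : Real.log (K * I / 2 + 1) ≤ Real.log ((K : ℝ) ^ 7 * Real.log N) :=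
      Real.log_le_log (by positivity) h3
    rw [Real.log_mul (by positivity) (by linarith), Real.log_pow] at h8
    push_cast at h8
    -- the constant `24` absorbs the case `N = 2`, in which `log (log N)` is negative
    linarith

/-! ### The convergence bound for the chosen parameters -/

/-- The sum of the error terms for step size `min (1/L) (D/(α√(2T)))`: optimisation, bias
(with overflow `O`), variance and transmission errors `W`. -/
theorem error_terms_le {D L α T β η O W : ℝ} (hD : 0 < D) (hL : 0 < L) (hα : 0 < α) (hT : 1 ≤ T)
    (hβ : β = α / √T) (hη : η = min (1 / L) (D / (α * √(2 * T)))) (hO : O ≤ 16 * β ^ 2)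
    (hW : W ≤ 2 * D * β) :
    D ^ 2 / (2 * η * T) + (β / 2 + O / (2 * β)) * D + η * (24 * α ^ 2 + 2 * O) + W
      ≤ 68 * D * β + L * D ^ 2 / (2 * T) := by
  have hT0 : 0 < T := by linarith
  have hsT : 0 < √T := Real.sqrt_pos.2 hT0
  have hsq : √T ^ 2 = T := Real.sq_sqrt hT0.le
  have hβ0 : 0 < β := by rw [hβ]; positivity
  have h2T : √T ≤ √(2 * T) := Real.sqrt_le_sqrt (by linarith)
  have h2T' : √(2 * T) ≤ 2 * √T := by
    rw [Real.sqrt_le_left (by positivity)]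
    nlinarith
  have hη0 : 0 < η := by rw [hη]; exact lt_min (by positivity) (by positivity)
  have hηle : η ≤ D / (α * √T) := by
    rw [hη]
    exact (min_le_right _ _).trans (by gcongr)
  have hinv : 1 / η ≤ L + α * √(2 * T) / D := by
    have hx : 0 ≤ α * √(2 * T) / D := by positivity
    rcases min_choice (1 / L) (D / (α * √(2 * T))) with h | h
    · rw [hη, h, one_div_one_div]; linarith
    · rw [hη, h, one_div_div]; linarith
  have e1 : D ^ 2 / (2 * η * T) ≤ L * D ^ 2 / (2 * T) + D * β := by
    calc D ^ 2 / (2 * η * T) = D ^ 2 / (2 * T) * (1 / η) := by field_simp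
      _ ≤ D ^ 2 / (2 * T) * (L + α * (2 * √T) / D) := by
        gcongr
        exact hinv.trans (by gcongr)
      _ = L * D ^ 2 / (2 * T) + D * α * √T / √T ^ 2 := by rw [hsq]; field_simp
      _ = L * D ^ 2 / (2 * T) + D * β := by rw [hβ]; field_simp
  have e2 : O / (2 * β) ≤ 8 * β := by
    rw [div_le_iff₀ (by positivity)]
    linarith [sq β]
  have hβα : β ^ 2 ≤ α ^ 2 := by
    rw [hβ, div_pow, hsq]
    exact div_le_self (by positivity) hT
  have e3 : η * (24 * α ^ 2 + 2 * O) ≤ 56 * D * β := by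
    calc η * (24 * α ^ 2 + 2 * O) ≤ η * (56 * α ^ 2) := by gcongr; linarith
      _ ≤ D / (α * √T) * (56 * α ^ 2) := by gcongr
      _ = 56 * D * β := by rw [hβ]; field_simp
  have e4 : (β / 2 + O / (2 * β)) * D ≤ (β / 2 + 8 * β) * D := by gcongr
  have : 0 < D * β := by positivity
  linarith

theorem le_mul_sqrt_of_sq_le {B σ K : ℝ} (hσ : 0 < σ) (hK : 0 < K) (h : B ^ 2 ≤ σ ^ 2 * K) :
    B ≤ σ * √K := by
  refine le_of_abs_le (abs_le_of_sq_le_sq ?_ (by positivity))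
  rwa [mul_pow, Real.sq_sqrt hK.le]

/-- With `Λ = ln (K^{1.5} N)` the overflow term is of the order of the square of the main error
term. -/
theorem overflow_error_le {B σ K N T : ℝ} (hB : 0 < B) (hσ : 0 < σ) (hK : 0 < K) (hT : 1 ≤ T)
    (hTN : T ≤ N) (hBK : B ^ 2 ≤ σ ^ 2 * K) :
    16 * B ^ 2 * Real.exp (-Real.log (K * √K * N)) ≤ 16 * (√(B * σ / K) / √T) ^ 2 := by
  have hT0 : 0 < T := by linarith
  have hN0 : 0 < N := by linarith
  have hsK := Real.sqrt_pos.2 hK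
  rw [div_pow, Real.sq_sqrt (by positivity), Real.sq_sqrt hT0.le, Real.exp_neg,
    Real.exp_log (by positivity), ← div_eq_mul_inv, div_le_iff₀ (by positivity)]
  have h1 : 1 ≤ N / T := (one_le_div hT0).2 hTN
  have e : 16 * (B * σ / K / T) * (K * √K * N) = 16 * (B * (σ * √K) * (N / T)) := by field_simp
  rw [e]
  calc 16 * B ^ 2 = 16 * (B * B * 1) := by ring
    _ ≤ 16 * (B * (σ * √K) * (N / T)) := by
      gcongr
      exact le_mul_sqrt_of_sq_le hσ hK hBK

/-- With `Λ = ln (K N^{1.5})` the transmission errors of all rounds are of the order of the main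
error term. -/
theorem transmission_error_le {B σ K N T ℓ b : ℝ} (hB : 0 < B) (hσ : 0 < σ) (hK : 1 ≤ K)
    (hT : 1 ≤ T) (hTN : T ≤ N) (hBK : B ^ 2 ≤ σ ^ 2 * K) (hN : N = T * ℓ)
    (hb : b ≤ ℓ * (2 * Real.exp (-Real.log (K * (N * √N))))) :
    B * (T * b) ≤ 2 * (√(B * σ / K) / √T) := by
  have hT0 : 0 < T := by linarith
  have hN0 : 0 < N := by linarith
  have hK0 : 0 < K := by linarith
  have hsN := Real.sqrt_pos.2 hN0
  have hsT := Real.sqrt_pos.2 hT0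
  rw [Real.exp_neg, Real.exp_log (by positivity)] at hb
  have hBα : B / K ≤ √(B * σ / K) := by
    refine Real.le_sqrt_of_sq_le ?_
    rw [div_pow, div_le_div_iff₀ (by positivity) hK0]
    have h1 : √K ≤ K := by
      rw [Real.sqrt_le_left hK0.le]
      nlinarith
    have h2 : B ≤ σ * K := (le_mul_sqrt_of_sq_le hσ hK0 hBK).trans (by gcongr)
    calc B ^ 2 * K = B * B * K := by ring
      _ ≤ B * (σ * K) * K := by gcongr
      _ = B * σ * K ^ 2 := by ring
  calc B * (T * b) ≤ B * (T * (ℓ * (2 * (K * (N * √N))⁻¹))) := by gcongr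
    _ = 2 * B * ((T * ℓ) * (K * (N * √N))⁻¹) := by ring
    _ = 2 * (B / K / √N) := by
      rw [← hN]
      field_simp
    _ ≤ 2 * (√(B * σ / K) / √T) := by gcongr

namespace WZ

variable {s : WZ} {X : Set (E s.d)} {L σ : ℝ} {f : E s.d → ℝ} {G : E s.d → E s.d}
  {C : Fin s.K → Client s.d}

/-- Each of overflow and transmission errors is at most of the order of the main term
`D √(B σ / K) / √T` for the prescribed `M`, `I` and block lengths. -/
theorem psgd_suboptimality_le (hs : s.Admissible) (h : InClass X L s.B σ f G C) {σz D : ℝ}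
    (hσ0 : 0 < σ) (hσB : σ ≤ s.B) (hσz : 0 < σz) (hD0 : 0 < D) (hL : 0 < L)
    (hσ : s.B ^ 2 * 2 ^ s.n ≤ σ ^ 2 * s.K) {N T : ℕ} (hT : 1 ≤ T) (hN : N = T * s.len)
    (hTN : T ≤ N) {Λ₀ Λ : ℝ}
    (hΛ₀ : Λ₀ = Real.log (s.K * √s.K * N)) (hΛ₀1 : 1 ≤ Λ₀) (hΛ : Λ = Real.log (s.K * (N * √N)))
    (hΛ0 : 0 < Λ)
    (hM : s.M = 4 * s.B / (s.K * √((2 : ℝ) ^ s.n)) * √Λ₀) (hI : s.I = ⌈4 * √Λ₀⌉₊)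
    (h₁ : (latticeBase s.m s.v : ℝ) ^ s.p ≤ 1 + √(s.K * (s.K * s.P / σz ^ 2) / (8 * Λ)))
    (h₂ : (latticeBase s.m (s.I + 1) : ℝ) ^ s.p' ≤ 1 + √(s.K * (s.K * s.P / σz ^ 2) / (8 * Λ)))
    (hcl : IsClosed X) (hD : ∀ x ∈ X, ∀ y ∈ X, ‖x - y‖ ≤ D) {x₀ : E s.d} (hx₀ : x₀ ∈ X) {η : ℝ}
    (hη : η = min (1 / L) (D / (√(s.B * σ / s.K) * √(2 * T)))) :
    Integrable (fun ω => f (psgdOutput X η (s.estimate C) x₀ ω))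
      (Measure.pi fun _ : Fin T => s.roundLaw C σz) ∧
    ∫ ω, f (psgdOutput X η (s.estimate C) x₀ ω) ∂(Measure.pi fun _ : Fin T => s.roundLaw C σz)
      - sInf (f '' X) ≤ 68 * D * (√(s.B * σ / s.K) / √T) + L * D ^ 2 / (2 * T) := by
  have hB := hs.B_pos
  have hK : (s.K : ℝ) = 2 * s.m := s.cast_K hs.even
  have hm := hs.m_pos
  have hK0 : (0 : ℝ) < s.K := by rw [hK]; positivity
  have hT' : (1 : ℝ) ≤ T := by exact_mod_cast hT
  have hTN' : (T : ℝ) ≤ N := by exact_mod_cast hTN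
  have hN0 : (0 : ℝ) < N := by linarith
  have hT0 : (0 : ℝ) < T := by linarith
  have hk0 : 0 < s.K := hs.K_pos
  have k₀ : Fin s.K := ⟨0, hk0⟩
  -- a minimizer exists because `X` is compact and `f` is Lipschitz on it
  have hlip : LipschitzOnWith s.B.toNNReal f X :=
    LipschitzOnWith.of_dist_le_mul fun x hx y hy => by
      rw [Real.coe_toNNReal _ hB.le, Real.dist_eq, dist_eq_norm]
      exact h.lipschitz hB.le k₀ hx hy
  have hbdd : Bornology.IsBounded X :=
    Metric.isBounded_iff.2 ⟨D, fun x hx y hy => by rw [dist_eq_norm]; exact hD x hx y hy⟩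
  obtain ⟨z, hz, hmin⟩ := (Metric.isCompact_of_isClosed_isBounded hcl hbdd).exists_isMinOn
    ⟨x₀, hx₀⟩ hlip.continuousOn
  have hInf : sInf (f '' X) = f z := by
    refine IsLeast.csInf_eq ⟨⟨z, hz, rfl⟩, ?_⟩
    rintro _ ⟨x, hx, rfl⟩
    exact hmin hx
  -- consequences of `K ≥ B² d / σ²`
  have hd1 : (1 : ℝ) ≤ 2 ^ s.n := one_le_pow₀ (by norm_num)
  have hdK : (2 : ℝ) ^ s.n ≤ s.K := by
    have h1 : σ ^ 2 * 2 ^ s.n ≤ σ ^ 2 * s.K := by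
      refine le_trans ?_ hσ
      gcongr
    exact le_of_mul_le_mul_left h1 (by positivity)
  have hBK : s.B ^ 2 ≤ σ ^ 2 * s.K := by
    refine le_trans ?_ hσ
    exact le_mul_of_one_le_right (by positivity) hd1
  have hK1 : (1 : ℝ) ≤ s.K := hd1.trans hdK
  set α := √(s.B * σ / s.K) with hα
  have hα0 : 0 < α := Real.sqrt_pos.2 (by positivity)
  set β := α / √T with hβ
  have hβ0 : 0 < β := div_pos hα0 (Real.sqrt_pos.2 hT0)
  -- the parameters of the second phase
  obtain ⟨a, ha⟩ : ∃ a, a = s.B / (2 * s.m * √((2 : ℝ) ^ s.n)) := ⟨_, rfl⟩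
  have ha0 : 0 < a := by rw [ha]; positivity
  have hMa : s.M = 4 * a * √Λ₀ := by rw [hM, ha, hK]; ring
  have hsΛ : 0 < √Λ₀ := Real.sqrt_pos.2 (by linarith)
  have hMI : s.M / s.I ≤ a := by
    have h1 : 4 * √Λ₀ ≤ s.I := by rw [hI]; exact Nat.le_ceil _
    rw [div_le_iff₀ (by linarith), hMa]
    nlinarith
  have hO : s.overflowBound (√Λ₀ / (2 * a)) ≤ 16 * β ^ 2 := by
    refine (overflowBound_le hs hΛ₀1 ha hMa).trans ?_
    rw [hΛ₀]
    exact overflow_error_le hB hσ0 hK0 hT' hTN' hBK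
  -- the transmission errors
  have hW : s.B * D * (T * s.noiseBound σz) ≤ 2 * D * β := by
    have hn := noiseBound_le hs hσz hΛ0 (by rw [← hK]; exact h₁) (by rw [← hK]; exact h₂)
    rw [hΛ] at hn
    have := transmission_error_le hB hσ0 hK1 hT' hTN' hBK (by exact_mod_cast hN) hn
    calc s.B * D * (T * s.noiseBound σz) = D * (s.B * (T * s.noiseBound σz)) := by ring
      _ ≤ D * (2 * β) := by gcongr
      _ = 2 * D * β := by ring
  have hη0 : 0 < η := by rw [hη]; exact lt_min (by positivity) (by positivity)
  have hηL : η * L ≤ 1 := by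
    rw [← le_div_iff₀ hL, hη]
    exact min_le_left _ _
  obtain ⟨hint, hle⟩ := psgd_estimate_convergence hs h (σz := σz) (hK ▸ hdK) hσ0 hσB (hK ▸ hσ)
    (ha ▸ hMI) (l := √Λ₀ / (2 * a)) (by positivity) hβ0 hcl hD hx₀ hη0 hηL hT hz
  refine ⟨hint, ?_⟩
  have hvar : 12 * (s.B * σ / s.m) = 24 * α ^ 2 := by
    rw [hα, Real.sq_sqrt (by positivity), hK]
    field_simp
    norm_num
  rw [hvar] at hle
  have := error_terms_le hD0 hL hα0 hT' hβ hη hO hW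
  rw [hInf]
  linarith

end WZ

end OTA

end

theorem theorem4p2 :
    ∃ c₂ c₃ c₄ c₅ : ℝ, 0 < c₂ ∧ 0 < c₃ ∧ 0 < c₄ ∧ 0 < c₅ ∧
    ∀ (n K T N p p' I : ℕ) (D B σ L P σz M q SNR Γ : ℝ),
      0 < D → 0 < B → 0 < σ → σ ≤ B → 0 < L → 0 < P → 0 < σz →
      Even K → B ^ 2 * (2 : ℝ) ^ n / σ ^ 2 ≤ K →
      1 ≤ p → 1 ≤ p' → ∀ (hp : p ∣ 2 ^ n) (hp' : p' ∣ 2 ^ n),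
      1 ≤ T → N = T * (2 ^ n / p + 2 ^ n / p') →
      M = c₂ * B / (K * √((2 : ℝ) ^ n)) * √(Real.log ((K : ℝ) ^ (1.5 : ℝ) * N)) →
      I = ⌈c₂ * √(Real.log ((K : ℝ) ^ (1.5 : ℝ) * N))⌉₊ →
      SNR = K * P / σz ^ 2 →
      Γ = 1 + √(K * SNR / (8 * Real.log (K * (N : ℝ) ^ (1.5 : ℝ)))) →
      p ≤ ⌊Real.logb (3 * K + 1) Γ⌋₊ →
      p' ≤ ⌊Real.logb (K * I / 2 + 1) Γ⌋₊ →
      1 / q = 1 / (p : ℝ) + 1 / (p' : ℝ) →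
      let s : OTA.WZ := ⟨n, K, 7, I, p, p', B, M, P, hp, hp'⟩
      -- the two logarithms are of the order of `log K` and `log K + log log N`
      (Real.log (3 * K + 1) ≤ c₅ * Real.log K ∧
        Real.log (K * I / 2 + 1) ≤ c₅ * (Real.log K + Real.log (Real.log N))) ∧
      -- the encoders satisfy the power constraint
      (∀ (k : Fin K) (g : OTA.E (2 ^ n)) (u : s.Coins), ‖g‖ ≤ B →
        ∑ j, s.encoder k g u j ^ 2 ≤ s.len * P) ∧
      -- convergence error
      ∀ (X : Set (OTA.E (2 ^ n))) (x₀ : OTA.E (2 ^ n)) (f : OTA.E (2 ^ n) → ℝ)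
        (gradf : OTA.E (2 ^ n) → OTA.E (2 ^ n)) (C : Fin K → OTA.Client (2 ^ n)),
        IsClosed X → (∀ x ∈ X, ∀ y ∈ X, ‖x - y‖ ≤ D) → x₀ ∈ X →
        OTA.InClass X L B σ f gradf C →
        let η : ℝ := min (1 / L) (D / (c₄ * √(B * σ / K) * √(2 * T)))
        let out : (Fin T → s.Round C) → OTA.E (2 ^ n) :=
          OTA.psgdOutput X η (s.estimate C) x₀
        let law : Measure (Fin T → s.Round C) := Measure.pi fun _ => s.roundLaw C σz
        Integrable (fun ω => f (out ω)) law ∧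
        ∫ ω, f (out ω) ∂law - sInf (f '' X) ≤
          c₃ * D * √(B * σ) / √(K * N) * √((2 : ℝ) ^ n / q)
            + L * D ^ 2 * (2 : ℝ) ^ n / (2 * N * q) := by
  refine ⟨4, 68, 1, 24, by norm_num, by norm_num, by norm_num, by norm_num, ?_⟩
  intro n K T N p p' I D B σ L P σz M q SNR Γ hD hB hσ hσB hL hP hσz heven hKB hp1 hp1' hp hp'
    hT hN hM hI hSNR hΓ hpΓ hpΓ' hq s
  have hd1 : (1 : ℝ) ≤ 2 ^ n := one_le_pow₀ (by norm_num)
  have hKσ : B ^ 2 * 2 ^ n ≤ σ ^ 2 * K := by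
    rw [div_le_iff₀ (by positivity)] at hKB
    linarith
  have hK0 : 0 < K := by
    have : (0 : ℝ) < K := lt_of_lt_of_le (by positivity) hKB
    exact_mod_cast this
  have hK2 : 2 ≤ K := by
    obtain ⟨a, rfl⟩ := heven
    omega
  -- each of the two phases uses the channel at least once per iteration
  have hℓ : 2 ≤ 2 ^ n / p + 2 ^ n / p' := by
    have h1 := Nat.div_pos (Nat.le_of_dvd (by positivity) hp) hp1
    have h2 := Nat.div_pos (Nat.le_of_dvd (by positivity) hp') hp1'
    omega
  have hTN : 2 * T ≤ N := by rw [hN]; nlinarith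
  have hKr : (2 : ℝ) ≤ K := by exact_mod_cast hK2
  have hNr : (2 : ℝ) ≤ N := by exact_mod_cast (by omega : 2 ≤ N)
  have hTr : (1 : ℝ) ≤ T := by exact_mod_cast hT
  rw [OTA.rpow_three_halves (by linarith)] at hM hI hΓ
  have hΛ₀1 : 1 ≤ Real.log (K * √K * N) := by
    rw [Real.le_log_iff_exp_le (by positivity)]
    have h1 : 1 ≤ √(K : ℝ) := Real.one_le_sqrt.2 (by linarith)
    have h2 : (2 : ℝ) * 1 * 2 ≤ K * √K * N := by gcongr
    linarith [Real.exp_one_lt_d9]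
  have hΛ0 : 0 < Real.log (K * (N * √N)) := by
    refine Real.log_pos ?_
    have h1 : 1 ≤ √(N : ℝ) := Real.one_le_sqrt.2 (by linarith)
    have h2 : (2 : ℝ) * (2 * 1) ≤ K * (N * √N) := by gcongr
    linarith
  have hsΛ : 0 < √(Real.log (K * √K * N)) := Real.sqrt_pos.2 (by linarith)
  have hI1 : 1 ≤ I := by rw [hI]; exact Nat.ceil_pos.2 (by positivity)
  have hIr : (1 : ℝ) ≤ I := by exact_mod_cast hI1
  have hΓ0 : 0 < Γ := by rw [hΓ]; positivity
  have hs : s.Admissible :=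
    { even := heven
      K_pos := hK0
      v_eq := rfl
      I_pos := hI1
      p_pos := hp1
      p'_pos := hp1'
      B_pos := hB
      M_pos := by
        change 0 < M
        rw [hM]
        positivity
      P_pos := hP }
  have hKm : (K : ℝ) = 2 * s.m := s.cast_K heven
  refine ⟨OTA.log_bases_le hK2 (by omega) hI hΛ₀1, fun k g u hg => ?_, ?_⟩
  · exact OTA.WZ.sum_encoder_sq_le s heven hK0 (by change 2 ≤ 7; norm_num) hI1 hB hP hp1 hp1'
      k g hg u
  intro X x₀ f gradf C hcl hdiam hx₀ hC η out law
  have h₁ : (OTA.latticeBase s.m s.v : ℝ) ^ s.p ≤ Γ := by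
    have e : (OTA.latticeBase s.m s.v : ℝ) = 3 * K + 1 := by
      rw [hKm, OTA.latticeBase, show s.v = 7 from rfl]
      push_cast
      ring
    rw [e]
    exact OTA.pow_le_of_le_floor_logb (by linarith) hΓ0 hp1 hpΓ
  have h₂ : (OTA.latticeBase s.m (s.I + 1) : ℝ) ^ s.p' ≤ Γ := by
    have e : (OTA.latticeBase s.m (s.I + 1) : ℝ) = K * I / 2 + 1 := by
      rw [hKm, OTA.latticeBase, show s.I = I from rfl, Nat.add_sub_cancel]
      push_cast
      ring
    rw [e]
    exact OTA.pow_le_of_le_floor_logb (by nlinarith) hΓ0 hp1' hpΓ'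
  rw [hΓ, hSNR] at h₁ h₂
  have hη : η = min (1 / L) (D / (√(B * σ / K) * √(2 * T))) := by
    simp only [η, one_mul]
  obtain ⟨hint, hle⟩ := OTA.WZ.psgd_suboptimality_le hs hC hσ hσB hσz hD hL hKσ hT hN (by omega) rfl
    hΛ₀1 rfl hΛ0 hM hI h₁ h₂ hcl hdiam hx₀ hη
  refine ⟨hint, hle.trans (le_of_eq ?_)⟩
  -- `d/q` is the number of channel uses of an iteration, so `N = T d/q`
  have hdq : (2 : ℝ) ^ n / q = N / T := by
    have hpr : (p : ℝ) ≠ 0 := by exact_mod_cast (by omega : p ≠ 0)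
    have hpr' : (p' : ℝ) ≠ 0 := by exact_mod_cast (by omega : p' ≠ 0)
    rw [div_eq_mul_one_div, hq, hN, Nat.cast_mul, Nat.cast_add, Nat.cast_div hp hpr,
      Nat.cast_div hp' hpr']
    push_cast
    field_simp
  have hTr0 : (0 : ℝ) < T := by linarith
  have hNr0 : (0 : ℝ) < N := by linarith
  have hKr0 : (0 : ℝ) < K := by linarith
  have e1 : √(B * σ / K) / √T = √(B * σ) / √(K * N) * √((2 : ℝ) ^ n / q) := by
    rw [hdq, ← Real.sqrt_div (by positivity), ← Real.sqrt_div (by positivity),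
      ← Real.sqrt_mul (by positivity)]
    congr 1
    field_simp
  have e2 : L * D ^ 2 * (2 : ℝ) ^ n / (2 * N * q) = L * D ^ 2 / (2 * T) := by
    calc L * D ^ 2 * (2 : ℝ) ^ n / (2 * N * q) = L * D ^ 2 / (2 * N) * ((2 : ℝ) ^ n / q) := by
          rw [div_mul_div_comm]
      _ = L * D ^ 2 / (2 * T) := by rw [hdq]; field_simp
  change 68 * D * (√(B * σ / K) / √T) + L * D ^ 2 / (2 * T) = _
  rw [e1, e2]
  ring
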